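/- Let $\mathbb F$ be a field, $d\ge 0$, and let $\mathcal M$ be the free monoid without unity on the letters $1,\dots,d,1^T,\dots,d^T$, with the involution $(\alpha_1\cdots\alpha_p)^T=\alpha_p^T\cdots\alpha_1^T$, $i^{TT}=i$. Let $\mathcal M_{\mathbb F}$ be the vector space with basis $\mathcal M$. Write $\alpha\sim\beta$ if a cyclic permutation of $\alpha$ equals $\beta$ or $\beta^T$; a word is primitive if it is not a power of a shorter word. Let $N_\sigma$ be the commutative polynomial ring over $\mathbb F$ freely generated by symbols $\sigma_t(\alpha)$, where $t>0$ and $\alpha$ ranges over the $\sim$-classes of primitive words. For arbitrary $\alpha\in\mathcal M_{\mathbb F}$ one regards $\sigma_t(\alpha)$ as an element of $N_\sigma$ by means of Amitsur's formula for $\sigma_t(\alpha_1+\cdots+\alpha_p)$, the rule $\sigma_t(a\alpha)=a^t\sigma_t(\alpha)$ ($a\in\mathbb F$), and the integer polynomials expressing $\sigma_t(\alpha^l)$ through $\sigma_1(\alpha),\dots,\sigma_{tl}(\alpha)$; put $\operatorname{tr}=\sigma_1$. The same notation is used for other alphabets. **Definition of $\sigma_{t,r}$.** Let $Q$ be the quiver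 with vertices $1,2$ and arrows $x:1\to1$, $x^T:2\to2$, $y,y^T:2\to1$, $z,z^T:1\to2$; a product $ab$ of arrows is a path if the tail of $a$ is the head of $b$. For $t,r\ge0$ put $$\sigma_{t,r}(x,y,z)=\sum(-1)^{\xi}\,\sigma_{j_1}(\alpha_1)\cdots\sigma_{j_p}(\alpha_p),\qquad \xi=t+\sum_{i=1}^p j_i(\deg_y\alpha_i+\deg_z\alpha_i+1),$$ where the sum ranges over all finite sets $\{\alpha_1,\dots,\alpha_p\}$ of representatives of pairwise different $\sim$-classes of primitive closed paths in $Q$ together with $j_1,\dots,j_p\ge1$ such that $\sum_i j_i\operatorname{mdeg}(\alpha_i)=(t,r,r)$; here $\operatorname{mdeg}$ counts a letter together with its transpose, while $\deg_y,\deg_z$ count only $y$, respectively $z$. For $x,y,z\in\mathcal M_{\mathbb F}$ the element $\sigma_{t,r}(x,y,z)\in N_\sigma$ is obtained by substitution. **Definition of $\sigma'_{n,r}$ ($n\ge2r$).** Let $t=n-2r$ and consider a tableau with two columns and $n$ rows and with the arrows $x_i$ $(1\le i\le t)$ from row $i$ of column 1 to row $i$ of column 2, and $y_j$ (respectively $z_j$)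 $(1\le j\le r)$ from row $t+2j-1$ to row $t+2j$ within column 1 (respectively column 2). For $\pi\in S_n$ glue row $i$ of column 1 to row $\pi(i)$ of column 2. The arrow or transposed (i.e. reversed) arrow following a given one is the one whose tail is glued to the head of the given one. This splits the arrows and transposed arrows into closed paths; $\operatorname{tr}^*(\pi)$ is the product of $\operatorname{tr}(w)$ over the closed paths $w$, taken up to $\sim$. For $x,y,z\in\mathcal M_{\mathbb F}$ set $$S_{n,r}(x,y,z)=\sum_{\pi\in S_n}\operatorname{sign}(\pi)\,\operatorname{tr}^*(\pi)\big|_{x_i\to x,\;y_j\to z,\;z_j\to y}\in N_\sigma .$$ Let $\sigma'_{n,r}$ be the polynomial over $\mathbb Z$ in the symbols $\sigma_k(c)$, where $k>0$ and $c$ ranges over the $\sim$-classes of primitive words in three letters $x,y,z$ and their transposes, such that $(n-2r)!\,(r!)^2\,\sigma'_{n,r}=S_{n,r}(x,y,z)$ for these letters; it is unique if it exists. For $x,y,z\in\mathcal M_{\mathbb F}$ let $\sigma'_{n,r}(x,y,z)\in N_\sigma$ be the result of reducing the integer coefficients to $\mathbb F$ and substituting. **Lemma.** For all $t,r\ge0$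 the integer polynomial $\sigma'_{t+2r,r}$ exists, and for all $x,y,z\in\mathcal M_{\mathbb F}$ $$t!\,(r!)^2\,\sigma'_{t+2r,r}(x,z,y)=S_{t+2r,r}(x,z,y)\qquad\text{and}\qquad \sigma_{t,r}(x,y,z)=\sigma'_{t+2r,r}(x,z,y).$$ In particular, if $\operatorname{char}\mathbb F=0$, then $\sigma_{t,r}(x,y,z)=\frac1{t!\,(r!)^2}\,S_{t+2r,r}(x,z,y)$. -/

import Mathlib

namespace MatInv

open MvPolynomial

/-! ### Words, primitive words, and the equivalence relation on words -/

/-- Monomials in letters `b : B` are the elements of `FreeSemigroup B`; this is the (nonempty)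
list of letters of a monomial. -/
def wordList {B : Type*} (w : FreeSemigroup B) : List B := w.head :: w.tail

theorem wordList_injective {B : Type*} :
    Function.Injective (wordList : FreeSemigroup B → List B) := by
  rintro ⟨a, l⟩ ⟨b, m⟩ h
  simp only [wordList, List.cons.injEq] at h
  obtain ⟨rfl, rfl⟩ := h
  rfl

theorem wordList_length {B : Type*} (w : FreeSemigroup B) : (wordList w).length = w.length := rfl

/-- `w = v ^ k`. -/
def IsPowOf {B : Type*} (w v : FreeSemigroup B) (k : ℕ) : Prop :=
  wordList w = (List.replicate k (wordList v)).flatten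

/-- `w` is not a power of a shorter monomial. -/
def IsPrimitive {B : Type*} (w : FreeSemigroup B) : Prop :=
  ∀ (v : FreeSemigroup B) (k : ℕ), v.length < w.length → ¬ IsPowOf w v k

abbrev PrimWord (B : Type*) := {w : FreeSemigroup B // IsPrimitive w}

theorem exists_root {B : Type*} (w : FreeSemigroup B) :
    ∃ p : PrimWord B × ℕ, IsPowOf w p.1.1 p.2 := by
  induction hn : w.length using Nat.strong_induction_on generalizing w with
  | _ n ih =>
    by_cases hw : IsPrimitive w
    · exact ⟨(⟨w, hw⟩, 1), by simp [IsPowOf]⟩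
    · simp only [IsPrimitive, not_forall, not_not] at hw
      obtain ⟨v, k, hlt, hk⟩ := hw
      obtain ⟨⟨u, m⟩, hu⟩ := ih v.length (hn ▸ hlt) v rfl
      refine ⟨(u, k * m), ?_⟩
      unfold IsPowOf at *
      rw [hk, hu]
      clear hk hu
      induction k with
      | zero => simp
      | succ k ihk =>
        rw [List.replicate_succ, List.flatten_cons, ihk, Nat.succ_mul, Nat.add_comm,
          List.replicate_add, List.flatten_append]

/-- The primitive word `v` with `w = v ^ k`, `k = rootExp w`. -/
noncomputable def root {B : Type*} (w : FreeSemigroup B) : PrimWord B :=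
  (exists_root w).choose.1

noncomputable def rootExp {B : Type*} (w : FreeSemigroup B) : ℕ :=
  (exists_root w).choose.2

/-- Equality of primitive words up to cyclic permutation. -/
instance cycSetoid (B : Type*) : Setoid (PrimWord B) where
  r v w := wordList v.1 ~r wordList w.1
  iseqv := ⟨fun _ => List.IsRotated.refl _, fun h => h.symm, fun h h' => h.trans h'⟩

/-- Primitive cycles in letters from `B`. -/
abbrev PrimCycle (B : Type*) := Quotient (cycSetoid B)

/-- The letters are `a` and `aᵀ` for `a : A`; they are represented by `(a, false)` and
`(a, true)` respectively. -/
abbrev Letter (A : Type*) := A × Bool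

/-- Transposition of letters. -/
def Letter.tr {A : Type*} (a : Letter A) : Letter A := (a.1, !a.2)

/-- `(a₁ ⋯ a_p)ᵀ = a_pᵀ ⋯ a₁ᵀ` on lists of letters. -/
def listTr {A : Type*} (l : List (Letter A)) : List (Letter A) := (l.map Letter.tr).reverse

theorem listTr_listTr {A : Type*} (l : List (Letter A)) : listTr (listTr l) = l := by
  have h : (Letter.tr ∘ Letter.tr : Letter A → Letter A) = id := by
    funext a; simp [Letter.tr]
  simp [listTr, List.map_reverse, h]

theorem listTr_rotated {A : Type*} {l m : List (Letter A)} (h : l ~r m) :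
    listTr l ~r listTr m := (h.map _).reverse

/-- The monoid (without unity) `M` freely generated by the letters `a, aᵀ`, `a : A`. -/
abbrev Word (A : Type*) := FreeSemigroup (Letter A)

/-- The involution `w ↦ wᵀ` of `M`. -/
def Word.tr {A : Type*} (w : Word A) : Word A :=
  (FreeSemigroup.lift (fun a : Letter A => MulOpposite.op (FreeSemigroup.of a.tr)) w).unop

theorem wordList_tr {A : Type*} (w : Word A) : wordList w.tr = listTr (wordList w) := by
  induction w using FreeSemigroup.recOnMul with
  | ih1 a => rfl
  | ih2 a w _ hw =>
    have : Word.tr (FreeSemigroup.of a * w) = Word.tr w * FreeSemigroup.of a.tr := by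
      simp [Word.tr]
    rw [this]
    have h2 : ∀ u v : Word A, wordList (u * v) = wordList u ++ wordList v := by
      intro u v; simp [wordList]
    rw [h2, h2, hw]
    simp [listTr, wordList, FreeSemigroup.of]

/-- `v ∼ w`: some cyclic permutation of `v` equals `w` or `wᵀ`. -/
instance wordSetoid (A : Type*) : Setoid (Word A) where
  r v w := wordList v ~r wordList w ∨ wordList v ~r wordList w.tr
  iseqv := by
    simp only [wordList_tr]
    refine ⟨fun _ => Or.inl (List.IsRotated.refl _), ?_, ?_⟩
    · rintro v w (h | h)
      · exact Or.inl h.symm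
      · have := (listTr_rotated h).symm
        rw [listTr_listTr] at this
        exact Or.inr this
    · rintro u v w (h | h) (h' | h')
      · exact Or.inl (h.trans h')
      · exact Or.inr (h.trans h')
      · exact Or.inr (h.trans (listTr_rotated h'))
      · have := listTr_rotated h'
        rw [listTr_listTr] at this
        exact Or.inl (h.trans this)

/-- `∼`-equivalence classes of words. -/
abbrev WordClass (A : Type*) := Quotient (wordSetoid A)

/-- `∼`-equivalence classes of primitive words. -/
abbrev PrimClass (A : Type*) :=
  Quotient (Setoid.comap (Subtype.val : PrimWord (Letter A) → Word A) (wordSetoid A))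

/-- A representative of a class of primitive words. -/
noncomputable def PrimClass.rep {A : Type*} (c : PrimClass A) : Word A := (Quotient.out c).1

/-- A representative of a primitive cycle. -/
noncomputable def PrimCycle.rep {B : Type*} (c : PrimCycle B) : FreeSemigroup B :=
  (Quotient.out c).1

theorem PrimClass.rep_injective {A : Type*} :
    Function.Injective (PrimClass.rep : PrimClass A → Word A) :=
  fun _ _ h => Quotient.out_injective (Subtype.ext h)

theorem PrimCycle.rep_injective {B : Type*} :
    Function.Injective (PrimCycle.rep : PrimCycle B → FreeSemigroup B) :=
  fun _ _ h => Quotient.out_injective (Subtype.ext h)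

/-! ### Finiteness of the index sets -/

theorem finite_configs {C B : Type*} [Finite B] (f : C → FreeSemigroup B)
    (hf : Function.Injective f) (n : ℕ) :
    {j : C →₀ ℕ | (j.sum fun c k => k * (f c).length) = n}.Finite := by
  classical
  have hS : {c : C | (f c).length ≤ n}.Finite := by
    have h := (List.finite_length_le B n).preimage
      (f := fun c => wordList (f c)) ((wordList_injective.comp hf).injOn)
    exact h.subset fun c hc => hc
  refine (Finset.finite_toSet
    (Finset.finsupp hS.toFinset fun _ => Finset.range (n + 1))).subset ?_
  intro j hj
  have key : ∀ c ∈ j.support, j c * (f c).length ≤ n := by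
    intro c hc
    rw [← (show _ = n from hj)]
    exact Finset.single_le_sum (f := fun c => j c * (f c).length) (fun _ _ => Nat.zero_le _) hc
  have hpos : ∀ c, 1 ≤ (f c).length := fun c => Nat.succ_pos _
  rw [Finset.mem_coe, Finset.mem_finsupp_iff]
  refine ⟨fun c hc => ?_, fun c hc => ?_⟩
  · have h1 : 1 ≤ j c := Nat.one_le_iff_ne_zero.mpr (Finsupp.mem_support_iff.mp hc)
    simp only [Set.mem_ofPred_eq, Set.Finite.mem_toFinset]
    nlinarith [key c hc]
  · rw [Finset.mem_range]
    by_cases h0 : j c = 0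
    · omega
    · nlinarith [key c (Finsupp.mem_support_iff.mpr h0), hpos c]

/-! ### The ring `N_σ` and its elements `σ_t(α)` -/

/-- The ring `N_σ` over `R`: commutative polynomials in the symbols `σ_t(c)`, where `t > 0` and
`c` is a `∼`-class of primitive words in the letters `a, aᵀ`, `a : A`. -/
abbrev NSigma (R A : Type*) [CommRing R] := MvPolynomial (ℕ+ × PrimClass A) R

/-- `σ_t(c)`, with `σ_0(c) = 1`. -/
noncomputable def gen (R : Type*) {A : Type*} [CommRing R] (t : ℕ) (c : PrimClass A) :
    NSigma R A :=
  if h : 0 < t then X (⟨t, h⟩, c) else 1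

/-- The elementary symmetric polynomial `e_t(x₁ˡ, …, x_nˡ)` in `n` variables. -/
noncomputable def esymmPow (n t l : ℕ) : symmetricSubalgebra (Fin n) ℤ :=
  ⟨expand l (esymm (Fin n) ℤ t), fun e => by
    rw [rename_expand, rename_esymm]⟩

/-- The integer polynomial `P_{t,l}` with `e_t(x₁ˡ, …, x_nˡ) = P_{t,l}(e₁, …, e_{tl})`, where
`n = tl`; here variable number `i : Fin (t * l)` stands for `e_{i+1}`. So
`σ_t(Aˡ) = P_{t,l}(σ₁(A), …, σ_{tl}(A))` for matrices `A` of any size. -/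
noncomputable def powPoly (t l : ℕ) : MvPolynomial (Fin (t * l)) ℤ :=
  (esymmAlgEquiv (Fin (t * l)) ℤ (Fintype.card_fin (t * l))).symm (esymmPow (t * l) t l)

/-- `σ_t(w) = P_{t,l}(σ₁(v), …, σ_{tl}(v))` for a word `w = vˡ` with `v` primitive. -/
noncomputable def sigmaWord (R : Type*) {A : Type*} [CommRing R] (t : ℕ) (w : Word A) :
    NSigma R A :=
  aeval (fun i : Fin (t * rootExp w) => gen R (i.1 + 1) (Quotient.mk _ (root w)))
    (powPoly t (rootExp w))

/-- The space `M_R` with basis `M`. -/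
abbrev MF (R A : Type*) [CommRing R] := MonoidAlgebra R (Word A)

/-- The index set in Amitsur's formula: finitely many pairwise different primitive cycles `c` with
multiplicities `j c ≥ 1` such that `∑ j c * deg c = t`. -/
theorem finite_amitsur (B : Type*) [Finite B] (t : ℕ) :
    {j : PrimCycle B →₀ ℕ | (j.sum fun c k => k * c.rep.length) = t}.Finite :=
  finite_configs PrimCycle.rep PrimCycle.rep_injective t

/-- The element `σ_t(α)` of `N_σ` for `α = ∑ a_w w ∈ M_R`. By Amitsur's formula
`σ_t(A₁ + ⋯ + A_p) = ∑ (-1)^(t - ∑ j_i) σ_{j₁}(γ₁) ⋯ σ_{j_q}(γ_q)`, the sum being over primitive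
cycles `γ_i` in `A₁, …, A_p` (here: in the summands `a_w w` of `α`), together with
`σ_j(a w) = a ^ j σ_j(w)`. -/
noncomputable def sigma {R A : Type*} [CommRing R] (t : ℕ) (α : MF R A) : NSigma R A :=
  ∑ j ∈ (finite_amitsur {w // w ∈ α.coeff.support} t).toFinset,
    (-1) ^ (t + j.sum fun _ k => k) *
      j.prod fun c k =>
        C (((wordList c.rep).map fun w => α.coeff w.1).prod ^ k) *
          sigmaWord R k (FreeSemigroup.lift (fun w => w.1) c.rep)

/-- The element of `M_R` given by a word. -/
noncomputable def ofWord (R : Type*) {A : Type*} [CommRing R] (w : Word A) : MF R A :=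
  MonoidAlgebra.single w 1

/-- The involution of `M_R`. -/
noncomputable def MF.tr {R A : Type*} [CommRing R] (α : MF R A) : MF R A :=
  MonoidAlgebra.mapDomain Word.tr α

/-- The result of the substitution `a → g a`, `aᵀ → (g a)ᵀ` in a word. -/
noncomputable def substWord {R A B : Type*} [CommRing R] (g : A → MF R B) (w : Word A) :
    MF R B :=
  FreeSemigroup.lift (fun a : Letter A => if a.2 then MF.tr (g a.1) else g a.1) w

/-- The substitution `a → g a` in elements of `N_σ`, i.e. `σ_t(c) ↦ σ_t(c|_{a → g a})`. -/
noncomputable def subst {R A B : Type*} [CommRing R] (g : A → MF R B) :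
    NSigma R A →ₐ[R] NSigma R B :=
  aeval fun p => sigma (p.1 : ℕ) (substWord g p.2.rep)

/-! ### The element `σ_{t,r}` -/

/-- The arrows of the quiver `Q` are the letters `x, y, z, xᵀ, yᵀ, zᵀ`, where `x = 0`, `y = 1`,
`z = 2` in `Fin 3`. The two vertices are `false` (vertex 1) and `true` (vertex 2). The arrow `x` is
a loop at 1, `xᵀ` is a loop at 2, `y, yᵀ` go from 2 to 1, and `z, zᵀ` go from 1 to 2. -/
def qHead (a : Letter (Fin 3)) : Bool := ![a.2, false, true] a.1

/-- The tail of an arrow of `Q`. -/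
def qTail (a : Letter (Fin 3)) : Bool := ![a.2, true, false] a.1

/-- `a₁ ⋯ a_s` is a closed path of `Q`: the tail of each letter is the head of the (cyclically)
next one. -/
def IsClosedPath (w : Word (Fin 3)) : Prop :=
  Cycle.Chain (fun a b => qTail a = qHead b) (wordList w : Cycle (Letter (Fin 3)))

/-- The degree of `w` in the letter `a`. -/
def degLetter {A : Type*} [DecidableEq A] (a : Letter A) (w : Word A) : ℕ :=
  (wordList w).count a

/-- The component of the multidegree of `w` that belongs to `a : A`. -/
def mdeg {A : Type*} [DecidableEq A] (w : Word A) (a : A) : ℕ :=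
  degLetter (a, false) w + degLetter (a, true) w

/-- The index set of `σ_{t,r}`: finitely many pairwise different classes `c` of primitive closed
paths of `Q`, with multiplicities `j c ≥ 1`, such that `∑ j c * mdeg c = (t, r, r)`. -/
def indexSet (t r : ℕ) : Set (PrimClass (Fin 3) →₀ ℕ) :=
  {j | (∀ c ∈ j.support, IsClosedPath c.rep) ∧
    ∀ a, (j.sum fun c k => k * mdeg c.rep a) = ![t, r, r] a}

theorem length_eq_mdeg (w : Word (Fin 3)) : w.length = ∑ a, mdeg w a := by
  rw [← wordList_length]
  simp only [mdeg, degLetter]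
  induction wordList w with
  | nil => simp
  | cons b l ih =>
    rw [List.length_cons, ih]
    obtain ⟨a, s⟩ := b
    fin_cases a <;> cases s <;> simp [Fin.sum_univ_three, List.count_cons] <;> omega

theorem finite_indexSet (t r : ℕ) : (indexSet t r).Finite := by
  refine (finite_configs PrimClass.rep PrimClass.rep_injective (t + r + r)).subset ?_
  rintro j ⟨-, hj⟩
  have h : (j.sum fun c k => k * c.rep.length) = ∑ a, j.sum fun c k => k * mdeg c.rep a := by
    simp only [Finsupp.sum, length_eq_mdeg, Finset.mul_sum]
    exact Finset.sum_comm
  show (j.sum fun c k => k * c.rep.length) = t + r + r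
  rw [h]
  simp [hj, Fin.sum_univ_three]

/-- `σ_{t,r}(x, y, z)` for the letters `x, y, z`:
`∑ (-1)^ξ σ_{j₁}(c₁) ⋯ σ_{j_p}(c_p)` with `ξ = t + ∑ j_i (deg_y c_i + deg_z c_i + 1)`. -/
noncomputable def sigmaTRLetters (R : Type*) [CommRing R] (t r : ℕ) : NSigma R (Fin 3) :=
  ∑ j ∈ (finite_indexSet t r).toFinset,
    (-1) ^ (t + j.sum fun c k =>
        k * (degLetter (1, false) c.rep + degLetter (2, false) c.rep + 1)) *
      j.prod fun c k => gen R k c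

/-- `σ_{t,r}(x, y, z) ∈ N_σ` for `x, y, z ∈ M_R`. -/
noncomputable def sigmaTR {R A : Type*} [CommRing R] (t r : ℕ) (x y z : MF R A) : NSigma R A :=
  subst ![x, y, z] (sigmaTRLetters R t r)

/-! ### The element `σ'_{n,r}` -/

/-- The `t + 2r` rows: first `t` rows, followed by `r` pairs of consecutive rows
`(j, false), (j, true)`. -/
abbrev Row (t r : ℕ) := Fin t ⊕ (Fin r × Bool)

/-- The arrows `x_1, …, x_t, y_1, …, y_r, z_1, …, z_r` of a tableau with two columns and `t + 2r`
rows: `x_i` goes from the cell of the first column in row `i` to the cell of the second column in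
row `i`, `y_j` goes from row `(j, false)` to row `(j, true)` in the first column, and `z_j` goes
from row `(j, false)` to row `(j, true)` in the second column. -/
abbrev Arr (t r : ℕ) := Fin t ⊕ Fin r ⊕ Fin r

/-- The column (`false` is the first one) and the row of the head of an arrow or of a transposed
arrow; transposition interchanges head and tail. -/
def cellHead {t r : ℕ} : Letter (Arr t r) → Bool × Row t r
  | (Sum.inl i, s) => (!s, Sum.inl i)
  | (Sum.inr (Sum.inl j), s) => (false, Sum.inr (j, !s))
  | (Sum.inr (Sum.inr j), s) => (true, Sum.inr (j, !s))

/-- The arrow or transposed arrow with its tail in the given cell. -/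
def withTail {t r : ℕ} : Bool × Row t r → Letter (Arr t r)
  | (col, Sum.inl i) => (Sum.inl i, col)
  | (false, Sum.inr (j, s)) => (Sum.inr (Sum.inl j), s)
  | (true, Sum.inr (j, s)) => (Sum.inr (Sum.inr j), s)

/-- Row `i` of the first column is glued to row `π i` of the second column. The letter that follows
`a` is the one whose tail is glued to the head of `a`. -/
def nextLetter {t r : ℕ} (π : Equiv.Perm (Row t r)) (a : Letter (Arr t r)) : Letter (Arr t r) :=
  match cellHead a with
  | (false, i) => withTail (true, π i)
  | (true, i) => withTail (false, π.symm i)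

/-- The closed path that starts with `a`. -/
noncomputable def cycleWord {t r : ℕ} (π : Equiv.Perm (Row t r)) (a : Letter (Arr t r)) :
    Word (Arr t r) :=
  ⟨a, (List.range (Function.minimalPeriod (nextLetter π) a - 1)).map
    fun i => (nextLetter π)^[i + 1] a⟩

open Classical in
/-- `tr*(π)`: the product of the traces of all closed paths, taken up to `∼`. -/
noncomputable def trStar (R : Type*) [CommRing R] {t r : ℕ} (π : Equiv.Perm (Row t r)) :
    NSigma R (Arr t r) :=
  ∏ c ∈ Finset.univ.image (fun a => (Quotient.mk _ (cycleWord π a) : WordClass (Arr t r))),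
    sigmaWord R 1 (Quotient.out c)

/-- `∑ sign(π) f(tr*(π))` over all permutations `π` of the `t + 2r` rows, where `f` is the
substitution `x_i → x`, `y_j → y`, `z_j → z`. -/
noncomputable def trStarSum {R A : Type*} [CommRing R] (t r : ℕ) (x y z : MF R A) : NSigma R A :=
  ∑ π : Equiv.Perm (Row t r), ((Equiv.Perm.sign π : ℤˣ) : ℤ) •
    subst (Sum.elim (fun _ => x) (Sum.elim (fun _ => y) (fun _ => z))) (trStar R π)

/-- `(n - 2r)! (r!)² σ'_{n,r}(x, y, z)`, for `n ≥ 2r`. In `σ'_{n,r}` the third argument is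
substituted for the `y_j` and the second one for the `z_j`. -/
noncomputable def zubkovSum {R A : Type*} [CommRing R] (n r : ℕ) (x y z : MF R A) : NSigma R A :=
  trStarSum (n - 2 * r) r x z y

/-- `(n - 2r)! (r!)²`. -/
def zubkovDen (n r : ℕ) : ℕ := (n - 2 * r).factorial * r.factorial ^ 2

/-- `s` is the polynomial with integer coefficients
`σ'_{n,r}(x, y, z) = 1 / ((n - 2r)! (r!)²) ∑ sign(π) f(tr*(π))` for letters `x, y, z`. -/
def IsZubkovLetters (n r : ℕ) (s : NSigma ℤ (Fin 3)) : Prop :=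
  zubkovDen n r • s = zubkovSum n r (ofWord ℤ (FreeSemigroup.of (0, false)))
    (ofWord ℤ (FreeSemigroup.of (1, false))) (ofWord ℤ (FreeSemigroup.of (2, false)))

open Classical in
/-- The integer form of `σ'_{n,r}` in letters `x, y, z`. It is unique if it exists, as `NSigma ℤ _`
is torsion-free. -/
noncomputable def zubkovLetters (n r : ℕ) : NSigma ℤ (Fin 3) :=
  if h : ∃ s, IsZubkovLetters n r s then h.choose else 0

/-- `σ'_{n,r}(x, y, z) ∈ N_σ` for `x, y, z ∈ M_R`, where `n ≥ 2r`: the integer form is considered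
over `R`, and `x, y, z` are substituted for the letters. -/
noncomputable def zubkovSigma {R A : Type*} [CommRing R] (n r : ℕ) (x y z : MF R A) :
    NSigma R A :=
  subst ![x, y, z] (MvPolynomial.map (Int.castRingHom R) (zubkovLetters n r))

end MatInv

/-! Call sequences `s`, `p` in a commutative ring a Newton pair (`Newton`) if they are related like
elementary symmetric functions and power sums. The `s` always determine the `p`. The converse holds
in a domain of characteristic zero. For every `α` the pair formed by `σ_t(α)` and the traces of
powers of `α` is such a pair (`newton_sigma`), so identities between the `σ_t` follow from
identities between traces, proved over polynomial rings over `ℤ` and then specialised.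

Side of `σ_{t,r}`. Give each letter a weight recording its sign and its degree. The sum over finite
sets of classes of primitive closed paths with multiplicities becomes an Euler product. By
`Newton.euler` its power sums run over all closed words of a given length, each contributing half of
its weighted trace (`newton_classE`). The half appears because a closed path is never a rotation of
its transpose, so a class of primitive closed words of length `ℓ` has exactly `2ℓ` members. The
expansion of `n! s_n` as a signed sum over `S_n` (`Newton.factorial_mul`) turns this into a sum over
labellings of an `n`-set by letters together with a permutation `ν`. The labellings of content `(t,
r, r)`, directions forgotten, form one `S_n`-orbit with stabiliser of order `t! (r!)²`. Hence `t!
(r!)² σ_{t,r}` is a sum over pairs (directions `σ` of the tableau arrows, permutation `ν` of the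
arrows) of sign times half-traces (`factorial_mul_sigmaTRLetters`).

Tableau side. A gluing `π` splits the letters into closed paths. Choosing a direction on each path
gives a pair `(σ, ν)`, so `π` has `2 ^ #paths` pairs (`card_follows`), which cancels the halves.
Conversely, a pair whose labels form closed paths comes from exactly one `π`
(`Compat.existsUnique`), and the signs agree (`Follows.sign_eq`). Thus the two sums coincide over
`ℚ` (`trSum_eq_orientedSum`), hence over `ℤ`. So `σ_{t,r}` with `y` and `z` exchanged is the
required integer polynomial, and the rest is compatibility of substitution with traces
(`subst_sigmaWord_one`). -/

namespace MatInv
open MvPolynomial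

/-! ### Powers and rotations of lists. -/

section Lists
variable {B : Type*}

/-- The `k`-th power of a list under concatenation. -/
def lpow (u : List B) (k : ℕ) : List B := (List.replicate k u).flatten

@[simp] theorem lpow_zero (u : List B) : lpow u 0 = [] := rfl

theorem lpow_succ (u : List B) (k : ℕ) : lpow u (k + 1) = u ++ lpow u k := by
  simp [lpow, List.replicate_succ]

@[simp] theorem lpow_one (u : List B) : lpow u 1 = u := by simp [lpow]

@[simp] theorem length_lpow (u : List B) (k : ℕ) : (lpow u k).length = k * u.length := by
  simp [lpow]

theorem lpow_add (u : List B) (k m : ℕ) : lpow u (k + m) = lpow u k ++ lpow u m := by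
  rw [lpow, List.replicate_add, List.flatten_append, lpow, lpow]

theorem lpow_mul (u : List B) (k m : ℕ) : lpow (lpow u k) m = lpow u (m * k) := by
  induction m with
  | zero => simp
  | succ m ih => rw [lpow_succ, ih, Nat.succ_mul, Nat.add_comm, lpow_add]

theorem lpow_succ' (u : List B) (k : ℕ) : lpow u (k + 1) = lpow u k ++ u := by
  rw [lpow_add, lpow_one]

theorem lpow_cons_append (a : B) (u : List B) (k : ℕ) :
    lpow (a :: u) k ++ [a] = a :: lpow (u ++ [a]) k := by
  induction k with
  | zero => simp
  | succ k ih => rw [lpow_succ, List.append_assoc, ih, lpow_succ]; simp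

theorem rotate_lpow (u : List B) (k i : ℕ) : (lpow u k).rotate i = lpow (u.rotate i) k := by
  induction i with
  | zero => simp
  | succ i ih =>
    rw [← List.rotate_rotate, ih, ← List.rotate_rotate]
    generalize u.rotate i = v
    rcases v with _ | ⟨a, v⟩
    · simp [lpow]
    · rcases k with _ | k
      · simp
      · have h1 : (a :: v).rotate 1 = v ++ [a] := by simp
        rw [h1, lpow_succ, List.cons_append, List.rotate_cons_succ, List.rotate_zero,
          List.append_assoc, lpow_cons_append, lpow_succ]
        simp

theorem map_lpow {B' : Type*} (f : B → B') (u : List B) (k : ℕ) :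
    (lpow u k).map f = lpow (u.map f) k := by
  simp [lpow, List.map_flatten]

theorem reverse_lpow (u : List B) (k : ℕ) : (lpow u k).reverse = lpow u.reverse k := by
  induction k with
  | zero => simp
  | succ k ih => rw [lpow_succ', List.reverse_append, ih, lpow_succ]

theorem lpow_inj_base {u v : List B} {k : ℕ} (hk : 0 < k) (hl : u.length = v.length)
    (h : lpow u k = lpow v k) : u = v := by
  obtain ⟨k, rfl⟩ := Nat.exists_eq_succ_of_ne_zero hk.ne'
  rw [lpow_succ, lpow_succ] at h
  exact (List.append_inj h hl).1

/-- The rotations fixing `l` are closed under multiples, and by Bézout the gcd is a multiple of `i`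
modulo the length. -/
theorem rotate_gcd_eq {l : List B} {i : ℕ} (h : l.rotate i = l) :
    l.rotate (Nat.gcd i l.length) = l := by
  have hmul : ∀ m, l.rotate (i * m) = l := by
    intro m
    induction m with
    | zero => simp
    | succ m ih => rw [Nat.mul_succ, ← List.rotate_rotate, ih, h]
  rcases Nat.eq_zero_or_pos l.length with h0 | h0
  · rw [List.length_eq_zero_iff.mp h0]; simp
  · rcases (Nat.gcd_le_right i h0).lt_or_eq with hlt | heq
    · obtain ⟨m, -, hm⟩ := Nat.exists_mul_mod_eq_gcd hlt
      rw [← hm, List.rotate_mod, hmul]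
    · rw [heq, List.rotate_length]

/-- A list fixed by the rotation by a divisor of its length is a power of a prefix. -/
theorem eq_lpow_take {l : List B} {g k : ℕ} (hl : l.length = k * g) (h : l.rotate g = l) :
    l = lpow (l.take g) k := by
  induction k generalizing l with
  | zero => simpa using hl
  | succ k ih =>
    have hg : g ≤ l.length := by rw [hl]; nlinarith
    rcases Nat.eq_zero_or_pos k with rfl | hk
    · rw [lpow_one, List.take_of_length_le (by omega)]
    have h1 : l.drop g ++ l.take g = l := by rw [← List.rotate_eq_drop_append_take hg, h]
    have hlen : (l.drop g).length = k * g := by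
      rw [List.length_drop, hl, Nat.succ_mul]; omega
    have hgk : g ≤ (l.drop g).length := by rw [hlen]; nlinarith
    have h2 : (l.drop g).take g = l.take g := by
      conv_rhs => rw [← h1]
      rw [List.take_append_of_le_length hgk]
    have h3 : (l.drop g).rotate g = l.drop g := by
      rw [List.rotate_eq_drop_append_take hgk, h2]
      conv_rhs => rw [← h1]
      rw [List.drop_append_of_le_length hgk]
    have h4 := ih hlen h3
    rw [h2] at h4
    conv_lhs => rw [← List.take_append_drop g l]
    rw [lpow_succ, ← h4]

theorem IsRotated_lpow {u v : List B} (h : u ~r v) (k : ℕ) : lpow u k ~r lpow v k := by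
  obtain ⟨i, rfl⟩ := h
  exact ⟨i, rotate_lpow u k i⟩

/-- No nontrivial rotation fixes `l`. -/
def Aperiodic (l : List B) : Prop := ∀ i, 0 < i → i < l.length → l.rotate i ≠ l

theorem Aperiodic.isRotated {l m : List B} (h : l ~r m) (hl : Aperiodic l) : Aperiodic m := by
  obtain ⟨j, rfl⟩ := h
  intro i hi hlt he
  rw [List.length_rotate] at hlt
  rw [List.rotate_rotate, Nat.add_comm, ← List.rotate_rotate, List.rotate_eq_rotate] at he
  exact hl i hi hlt he

theorem Aperiodic.reverse {l : List B} (hl : Aperiodic l) : Aperiodic l.reverse := by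
  intro i hi hlt he
  rw [List.length_reverse] at hlt
  rw [List.rotate_reverse, List.reverse_inj, Nat.mod_eq_of_lt hlt] at he
  exact hl _ (by omega) (by omega) he

theorem Aperiodic.map {B' : Type*} {f : B → B'} (hf : Function.Injective f) {l : List B}
    (hl : Aperiodic l) : Aperiodic (l.map f) := by
  intro i hi hlt he
  rw [List.length_map] at hlt
  rw [← List.map_rotate] at he
  exact hl i hi hlt (hf.list_map he)

theorem Aperiodic.rotate_inj {l : List B} (hl : Aperiodic l) {i j : ℕ} (hi : i < l.length)
    (hj : j < l.length) (h : l.rotate i = l.rotate j) : i = j := by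
  wlog hij : i < j generalizing i j
  · by_contra hne
    exact hne (this hj hi h.symm (by omega)).symm
  exfalso
  have h2 : (l.rotate (j - i)).rotate i = l.rotate i := by
    rw [List.rotate_rotate, h]; congr 1; omega
  exact hl (j - i) (by omega) (by omega) (List.rotate_eq_rotate.mp h2)

/-- Rotating a power rotates its base, so a rotation fixing the power already fixes the base. -/
theorem Aperiodic.lpow_rotate {u : List B} (hu : Aperiodic u) (hne : u ≠ []) {k i : ℕ}
    (hk : 0 < k) (h : (lpow u k).rotate i = lpow u k) : u.length ∣ i := by
  have hpos : 0 < u.length := List.length_pos_of_ne_nil hne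
  rw [rotate_lpow] at h
  have h2 := lpow_inj_base hk (by simp) h
  rw [← List.rotate_mod] at h2
  by_contra hd
  exact hu (i % u.length) (Nat.pos_of_ne_zero fun h0 => hd (Nat.dvd_of_mod_eq_zero h0))
    (Nat.mod_lt _ hpos) h2

theorem lpow_rotate_length (u : List B) (k : ℕ) : (lpow u k).rotate u.length = lpow u k := by
  rw [rotate_lpow, List.rotate_length]

/-- The common power is fixed by rotation through either base length, so the two lengths divide each
other. -/
theorem Aperiodic.lpow_unique {u v : List B} (hu : Aperiodic u) (hv : Aperiodic v)
    (hune : u ≠ []) (hvne : v ≠ []) {k m : ℕ} (hk : 0 < k) (hm : 0 < m)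
    (h : lpow u k = lpow v m) : u = v ∧ k = m := by
  have h1 : u.length ∣ v.length := hu.lpow_rotate hune hk (by rw [h, lpow_rotate_length])
  have h2 : v.length ∣ u.length := hv.lpow_rotate hvne hm (by rw [← h, lpow_rotate_length])
  have hl := Nat.dvd_antisymm h1 h2
  have hpos : 0 < v.length := List.length_pos_of_ne_nil hvne
  have hkm : k = m := by
    have := congrArg List.length h
    rw [length_lpow, length_lpow, hl] at this
    exact Nat.eq_of_mul_eq_mul_right hpos this
  subst hkm
  exact ⟨lpow_inj_base hk hl h, rfl⟩

end Lists

/-! ### Primitive words and primitive roots. -/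

section Words
variable {B : Type*}

theorem wordList_ne_nil (w : FreeSemigroup B) : wordList w ≠ [] := List.cons_ne_nil _ _

theorem wordList_mul (u v : FreeSemigroup B) : wordList (u * v) = wordList u ++ wordList v := by
  simp [wordList]

theorem exists_wordList_eq {l : List B} (h : l ≠ []) : ∃ w : FreeSemigroup B, wordList w = l := by
  rcases l with _ | ⟨a, l⟩
  · exact absurd rfl h
  · exact ⟨⟨a, l⟩, rfl⟩

@[simp] theorem wordList_of (b : B) : wordList (FreeSemigroup.of b) = [b] := rfl

theorem wordList_map {B' : Type*} (f : B → B') (w : FreeSemigroup B) :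
    wordList (FreeSemigroup.map f w) = (wordList w).map f := by
  induction w using FreeSemigroup.recOnMul with
  | ih1 a => rfl
  | ih2 a w _ hw => rw [map_mul, wordList_mul, wordList_mul, hw]; simp

theorem isPowOf_iff {w v : FreeSemigroup B} {k : ℕ} :
    IsPowOf w v k ↔ wordList w = lpow (wordList v) k := Iff.rfl

theorem IsPowOf.pos {w v : FreeSemigroup B} {k : ℕ} (h : IsPowOf w v k) : 0 < k := by
  rcases Nat.eq_zero_or_pos k with rfl | hk
  · exact absurd h (by simp [isPowOf_iff, wordList_ne_nil])
  · exact hk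

/-- A rotation fixing the word may be replaced by the gcd with the length, and then the word is a
power of its prefix of that length. Conversely, a proper power is fixed by rotation through its
base. -/
theorem isPrimitive_iff {w : FreeSemigroup B} : IsPrimitive w ↔ Aperiodic (wordList w) := by
  constructor
  · intro h i hi hlt he
    have h1 := rotate_gcd_eq he
    set g := Nat.gcd i (wordList w).length with hg
    have hgpos : 0 < g := Nat.gcd_pos_of_pos_left _ hi
    have hglt : g < (wordList w).length := (Nat.gcd_le_left _ hi).trans_lt hlt
    obtain ⟨k, hk⟩ := Nat.gcd_dvd_right i (wordList w).length
    have h2 := eq_lpow_take (k := k) (by rw [← hg] at hk; rw [hk, Nat.mul_comm]) h1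
    have hne : (wordList w).take g ≠ [] := by
      intro h0
      have := congrArg List.length h0
      rw [List.length_take, List.length_nil] at this
      omega
    obtain ⟨v, hv⟩ := exists_wordList_eq hne
    refine h v k ?_ (by rw [isPowOf_iff, hv]; exact h2)
    rw [← wordList_length, ← wordList_length, hv, List.length_take]
    omega
  · intro h v k hlt hk
    rw [isPowOf_iff] at hk
    refine h v.length (Nat.succ_pos _) hlt ?_
    rw [hk, ← wordList_length, lpow_rotate_length]

theorem PrimWord.aperiodic (u : PrimWord B) : Aperiodic (wordList u.1) := isPrimitive_iff.mp u.2

theorem root_spec (w : FreeSemigroup B) :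
    wordList w = lpow (wordList (root w).1) (rootExp w) :=
  (exists_root w).choose_spec

theorem rootExp_pos (w : FreeSemigroup B) : 0 < rootExp w :=
  IsPowOf.pos (exists_root w).choose_spec

/-- `root` and `rootExp` are obtained by choice; uniqueness of primitive roots makes them
computable. -/
theorem root_eq {w : FreeSemigroup B} {u : PrimWord B} {k : ℕ}
    (h : wordList w = lpow (wordList u.1) k) : root w = u ∧ rootExp w = k := by
  have := (root w).aperiodic.lpow_unique u.aperiodic (wordList_ne_nil _) (wordList_ne_nil _)
    (rootExp_pos w) (IsPowOf.pos h) ((root_spec w).symm.trans h)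
  exact ⟨Subtype.ext (wordList_injective this.1), this.2⟩

theorem root_prim (u : PrimWord B) : root u.1 = u ∧ rootExp u.1 = 1 := root_eq (by simp)

/-- The power `a ^ (k + 1)` in a semigroup. -/
def pw {S : Type*} [Mul S] (a : S) : ℕ → S
  | 0 => a
  | k + 1 => a * pw a k

theorem map_pw {S T F : Type*} [Mul S] [Mul T] [FunLike F S T] [MulHomClass F S T] (f : F) (a : S)
    (k : ℕ) : f (pw a k) = pw (f a) k := by
  induction k with
  | zero => rfl
  | succ k ih => rw [pw, map_mul, ih, pw]

theorem pw_comm {S : Type*} [Semigroup S] (a : S) (k : ℕ) : a * pw a k = pw a k * a := by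
  induction k with
  | zero => rfl
  | succ k ih => rw [pw, mul_assoc, ← ih]

theorem pw_mul_mul {S : Type*} [Semigroup S] (a b : S) (k : ℕ) :
    pw (a * b) (k + 1) = a * (pw (b * a) k * b) := by
  induction k with
  | zero => simp [pw, mul_assoc]
  | succ k ih => rw [pw, ih]; simp only [pw, mul_assoc]

theorem wordList_pw (w : FreeSemigroup B) (k : ℕ) :
    wordList (pw w k) = lpow (wordList w) (k + 1) := by
  induction k with
  | zero => simp [pw]
  | succ k ih => rw [pw, wordList_mul, ih, ← lpow_succ]

theorem eq_pw_root (w : FreeSemigroup B) : w = pw (root w).1 (rootExp w - 1) := by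
  apply wordList_injective
  rw [wordList_pw, Nat.sub_add_cancel (rootExp_pos w), ← root_spec]

theorem root_pw (w : FreeSemigroup B) (k : ℕ) :
    root (pw w k) = root w ∧ rootExp (pw w k) = (k + 1) * rootExp w := by
  apply root_eq
  rw [wordList_pw, ← lpow_mul, ← root_spec]

theorem root_of_isRotated {v w : FreeSemigroup B} (h : wordList v ~r wordList w) :
    wordList (root v).1 ~r wordList (root w).1 ∧ rootExp v = rootExp w := by
  obtain ⟨i, hi⟩ := h
  obtain ⟨u, hu⟩ := exists_wordList_eq (l := (wordList (root v).1).rotate i)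
    (by simpa using wordList_ne_nil (root v).1)
  have hp : IsPrimitive u := by
    rw [isPrimitive_iff, hu]
    exact (root v).aperiodic.isRotated ⟨i, rfl⟩
  have := root_eq (w := w) (u := ⟨u, hp⟩) (k := rootExp v) (by
    rw [← hi, hu, root_spec v, rotate_lpow])
  rw [this.1, this.2]
  exact ⟨⟨i, hu.symm⟩, rfl⟩

/-- The members of the cycle are the rotations of its representative, pairwise different by
aperiodicity. -/
theorem card_primCycle (c : PrimCycle B) :
    Nat.card {u : PrimWord B // (Quotient.mk _ u : PrimCycle B) = c} = c.rep.length := by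
  obtain ⟨v, rfl⟩ := Quotient.exists_rep c
  set c : PrimCycle B := Quotient.mk _ v
  have hap := (Quotient.out c).aperiodic
  have hex : ∀ i : Fin c.rep.length, ∃ u : PrimWord B,
      wordList u.1 = (wordList c.rep).rotate i := by
    intro i
    obtain ⟨u, hu⟩ := exists_wordList_eq (l := (wordList c.rep).rotate i)
      (by simpa using wordList_ne_nil c.rep)
    exact ⟨⟨u, by rw [isPrimitive_iff, hu]; exact hap.isRotated ⟨i, rfl⟩⟩, hu⟩
  choose f hf using hex
  have hmem : ∀ u : PrimWord B, (Quotient.mk _ u : PrimCycle B) = c ↔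
      wordList c.rep ~r wordList u.1 := by
    intro u
    conv_lhs => rw [← Quotient.out_eq c]
    rw [Quotient.eq]
    exact ⟨fun h => List.IsRotated.symm h, fun h => List.IsRotated.symm h⟩
  have : Function.Bijective (fun i => (⟨f i, (hmem _).mpr ⟨i, (hf i).symm⟩⟩ :
      {u : PrimWord B // (Quotient.mk _ u : PrimCycle B) = c})) := by
    constructor
    · intro i j hij
      have h1 : f i = f j := congrArg Subtype.val hij
      have h2 : (wordList c.rep).rotate i = (wordList c.rep).rotate j := by
        rw [← hf, ← hf, h1]
      exact Fin.ext (hap.rotate_inj i.2 j.2 h2)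
    · rintro ⟨u, hu⟩
      obtain ⟨i, hi⟩ := (hmem u).mp hu
      refine ⟨⟨i % c.rep.length, Nat.mod_lt _ (Nat.succ_pos _)⟩, ?_⟩
      apply Subtype.ext
      apply Subtype.ext
      apply wordList_injective
      show wordList (f _).1 = _
      rw [hf, ← hi]
      exact List.rotate_mod (wordList c.rep) i
  rw [← Nat.card_eq_of_bijective _ this, Nat.card_eq_fintype_card, Fintype.card_fin]

end Words

/-! ### Transposition of words. -/

section Transpose
variable {A : Type*}

@[simp] theorem Letter.tr_tr (a : Letter A) : a.tr.tr = a := by simp [Letter.tr]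

theorem Letter.tr_ne (a : Letter A) : a.tr ≠ a := by
  intro h
  have := congrArg Prod.snd h
  simp [Letter.tr] at this

theorem Letter.tr_injective : Function.Injective (Letter.tr : Letter A → Letter A) :=
  Function.LeftInverse.injective Letter.tr_tr

@[simp] theorem length_listTr (l : List (Letter A)) : (listTr l).length = l.length := by
  simp [listTr]

theorem listTr_lpow (u : List (Letter A)) (k : ℕ) : listTr (lpow u k) = lpow (listTr u) k := by
  rw [listTr, map_lpow, reverse_lpow, listTr]

theorem Aperiodic.listTr {l : List (Letter A)} (h : Aperiodic l) : Aperiodic (listTr l) :=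
  (h.map Letter.tr_injective).reverse

theorem Word.tr_tr (w : Word A) : w.tr.tr = w := by
  apply wordList_injective
  rw [wordList_tr, wordList_tr, listTr_listTr]

theorem Word.tr_mul (u v : Word A) : Word.tr (u * v) = Word.tr v * Word.tr u := by
  apply wordList_injective
  simp [wordList_tr, wordList_mul, MatInv.listTr]

theorem IsPrimitive.tr {w : Word A} (h : IsPrimitive w) : IsPrimitive w.tr := by
  rw [isPrimitive_iff, wordList_tr]
  exact (isPrimitive_iff.mp h).listTr

theorem root_tr (w : Word A) : (root w.tr).1 = Word.tr (root w).1 ∧ rootExp w.tr = rootExp w := by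
  have := root_eq (w := w.tr) (u := ⟨Word.tr (root w).1, (root w).2.tr⟩) (k := rootExp w) (by
    rw [wordList_tr, wordList_tr, root_spec w, listTr_lpow])
  rw [this.1, this.2]
  exact ⟨rfl, rfl⟩

theorem root_of_equiv {v w : Word A} (h : v ≈ w) :
    (root v).1 ≈ (root w).1 ∧ rootExp v = rootExp w := by
  rcases h with h | h
  · exact ⟨Or.inl (root_of_isRotated h).1, (root_of_isRotated h).2⟩
  · have h1 := root_of_isRotated h
    rw [(root_tr w).1, (root_tr w).2] at h1
    exact ⟨Or.inr h1.1, h1.2⟩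

theorem mk_root_eq_of_equiv {v w : Word A} (h : v ≈ w) :
    (Quotient.mk _ (root v) : PrimClass A) = Quotient.mk _ (root w) :=
  Quotient.sound (root_of_equiv h).1

theorem PrimClass.rep_mk_equiv (u : PrimWord (Letter A)) :
    PrimClass.rep (Quotient.mk _ u) ≈ u.1 := by
  have h : (Quotient.mk _ (Quotient.out (Quotient.mk _ u : PrimClass A)) : PrimClass A)
      = Quotient.mk _ u := Quotient.out_eq _
  exact (Quotient.exact h :)

/-- A word without adjacent mutually transposed letters is not a cyclic permutation of its
transpose. -/
theorem not_isRotated_listTr {l : List (Letter A)} (hne : l ≠ [])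
    (h : ∀ (i : ℕ) (hi : i + 1 < l.length), l[i] ≠ (l[i + 1]).tr) : ¬ l ~r listTr l := by
  intro hr
  obtain ⟨k, hk, hkl⟩ : ∃ k, k < l.length ∧ l.rotate k = listTr l := by
    obtain ⟨k, hk⟩ := hr
    exact ⟨k % l.length, Nat.mod_lt _ (List.length_pos_of_ne_nil hne), by rw [List.rotate_mod, hk]⟩
  have key : ∀ i j (hi : i < l.length) (hj : j < l.length), k ≤ i → i - k + j + 1 = l.length →
      l[i] = (l[j]).tr := by
    intro i j hi hj hki hij
    have h1 : (l.rotate k)[i - k]'(by rw [List.length_rotate]; omega) = l[i] := by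
      rw [List.getElem_rotate]
      congr 1
      rw [Nat.sub_add_cancel hki, Nat.mod_eq_of_lt hi]
    have h2 : (listTr l)[i - k]'(by rw [length_listTr]; omega) = (l[j]).tr := by
      simp only [listTr, List.getElem_reverse, List.getElem_map, List.length_map]
      congr 2
      omega
    rw [← h1, ← h2]
    congr 1
  -- By `key`, the reflection of the positions `k, …, length - 1` pairs each letter with a transpose
  -- of it. Its centre is either one position, giving a letter equal to its own transpose, or two
  -- adjacent positions, which `h` excludes.
  rcases Nat.even_or_odd' (l.length - 1 - k) with ⟨i, hi | hi⟩
  · exact Letter.tr_ne _ (key (k + i) (k + i) (by omega) (by omega) (by omega) (by omega)).symm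
  · exact h (k + i) (by omega)
      (key (k + i) (k + i + 1) (by omega) (by omega) (by omega) (by omega))

end Transpose

end MatInv

namespace MatInv
open MvPolynomial

/-! ### Newton's identities. -/

section Newton
variable {K : Type*} [CommRing K]

/-- Newton's identities for elementary symmetric functions `s k` and power sums; here `p i` stands
for the power sum of degree `i + 1`. -/
def Newton (s p : ℕ → K) : Prop :=
  s 0 = 1 ∧ ∀ k : ℕ, ((k : K) + 1) * s (k + 1) =
    ∑ i ∈ Finset.range (k + 1), (-1) ^ i * p i * s (k - i)

/-- The power sums determined by `s`. -/
noncomputable def newtonP (s : ℕ → K) : ℕ → K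
  | k => (-1) ^ k * (((k : K) + 1) * s (k + 1) -
      ∑ i : Fin k, (-1) ^ (i : ℕ) * newtonP s i * s (k - i))

theorem newton_newtonP {s : ℕ → K} (h : s 0 = 1) : Newton s (newtonP s) := by
  refine ⟨h, fun k => ?_⟩
  rw [Finset.sum_range_succ, newtonP]
  rw [Finset.sum_range (fun i => (-1) ^ i * newtonP s i * s (k - i)), Nat.sub_self, h, mul_one,
    ← mul_assoc, ← mul_pow]
  simp

/-- The identity number `k` contains `p k` with coefficient `± s 0 = ± 1`, so no division is needed
and any commutative ring will do. -/
theorem Newton.p_unique {s p p' : ℕ → K} {N : ℕ}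
    (h0 : s 0 = 1) (h : ∀ k < N, ((k : K) + 1) * s (k + 1) =
      ∑ i ∈ Finset.range (k + 1), (-1) ^ i * p i * s (k - i))
    (h' : ∀ k < N, ((k : K) + 1) * s (k + 1) =
      ∑ i ∈ Finset.range (k + 1), (-1) ^ i * p' i * s (k - i)) : ∀ k < N, p k = p' k := by
  intro k
  induction k using Nat.strong_induction_on with
  | _ k ih =>
    intro hk
    have h1 := (h k hk).symm.trans (h' k hk)
    rw [Finset.sum_range_succ, Finset.sum_range_succ, Nat.sub_self, h0, mul_one, mul_one] at h1
    rw [Finset.sum_congr rfl (fun i hi => by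
      rw [ih i (Finset.mem_range.mp hi) ((Finset.mem_range.mp hi).trans hk)])] at h1
    have h2 := add_left_cancel h1
    have h3 : ((-1 : K) ^ k * (-1) ^ k) = 1 := by rw [← mul_pow]; simp
    calc p k = ((-1 : K) ^ k * (-1) ^ k) * p k := by rw [h3, one_mul]
      _ = ((-1 : K) ^ k * (-1) ^ k) * p' k := by rw [mul_assoc, h2, mul_assoc]
      _ = p' k := by rw [h3, one_mul]

theorem Newton.p_eq {s p p' : ℕ → K} (h : Newton s p) (h' : Newton s p') : p = p' :=
  funext fun k => Newton.p_unique (N := k + 1) h.1 (fun k _ => h.2 k) (fun k _ => h'.2 k) k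
    (Nat.lt_succ_self k)

/-- Here the factor `k + 1` has to be cancelled, which is why the ring is a domain of characteristic
zero. The bound `N` allows for identities that hold only in low degree, as with finitely many
variables. -/
theorem s_unique_of_newton [IsDomain K] [CharZero K] {s s' p : ℕ → K} {N : ℕ}
    (h0 : s 0 = 1) (h0' : s' 0 = 1) (h : ∀ k < N, ((k : K) + 1) * s (k + 1) =
      ∑ i ∈ Finset.range (k + 1), (-1) ^ i * p i * s (k - i))
    (h' : ∀ k < N, ((k : K) + 1) * s' (k + 1) =
      ∑ i ∈ Finset.range (k + 1), (-1) ^ i * p i * s' (k - i)) : ∀ k ≤ N, s k = s' k := by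
  intro k
  induction k using Nat.strong_induction_on with
  | _ k ih =>
    intro hk
    rcases k with _ | k
    · rw [h0, h0']
    · have h1 : ((k : K) + 1) * s (k + 1) = ((k : K) + 1) * s' (k + 1) := by
        rw [h k hk, h' k hk]
        exact Finset.sum_congr rfl fun i _ => by rw [ih (k - i) (by omega) (by omega)]
      exact mul_left_cancel₀ (by exact_mod_cast Nat.succ_ne_zero k) h1

theorem Newton.s_eq [IsDomain K] [CharZero K] {s s' p : ℕ → K} (h : Newton s p)
    (h' : Newton s' p) : s = s' :=
  funext fun k => s_unique_of_newton (N := k) h.1 h'.1 (fun k _ => h.2 k) (fun k _ => h'.2 k) k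
    le_rfl

theorem Newton.map {L F : Type*} [CommRing L] [FunLike F K L] [RingHomClass F K L] {s p : ℕ → K}
    (h : Newton s p) (f : F) :
    Newton (fun k => f (s k)) (fun k => f (p k)) := by
  refine ⟨by simp [h.1], fun k => ?_⟩
  have := congrArg f (h.2 k)
  simpa using this

theorem Newton.scale {s p : ℕ → K} (h : Newton s p) (a : K) :
    Newton (fun k => a ^ k * s k) (fun k => a ^ (k + 1) * p k) := by
  refine ⟨by simp [h.1], fun k => ?_⟩
  rw [mul_left_comm, h.2, Finset.mul_sum]
  refine Finset.sum_congr rfl fun i hi => ?_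
  have : k + 1 = (i + 1) + (k - i) := by have := Finset.mem_range.mp hi; omega
  rw [this, pow_add]; ring

theorem newton_esymm (σ : Type*) [Fintype σ] (R : Type*) [CommRing R] :
    Newton (esymm σ R) (fun i => psum σ R (i + 1)) := by
  refine ⟨esymm_zero σ R, fun k => ?_⟩
  have h := mul_esymm_eq_sum σ R (k + 1)
  push_cast at h
  rw [h, Finset.sum_filter, Finset.Nat.sum_antidiagonal_eq_sum_range_succ_mk,
    Finset.sum_range_succ, if_neg (by simp), add_zero, Finset.mul_sum,
    ← Finset.sum_range_reflect]
  refine Finset.sum_congr rfl fun i hi => ?_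
  have hi' := Finset.mem_range.mp hi
  have e1 : k + 1 - 1 - i = k - i := by omega
  have e2 : k + 1 - (k - i) = i + 1 := by omega
  simp only [e1, e2]
  rw [if_pos (by omega)]
  have e3 : (-1 : MvPolynomial σ R) ^ (k + 1 + 1) * (-1) ^ (k - i) = (-1) ^ i := by
    rw [← pow_add, show k + 1 + 1 + (k - i) = i + 2 * (k - i + 1) by omega, pow_add, pow_mul]
    simp
  rw [← e3]; ring

/-- The homomorphism from the symmetric polynomials in `N` variables that maps the elementary
symmetric polynomials to `s 1, …, s N`. -/
noncomputable def symHom (s : ℕ → K) (N : ℕ) : symmetricSubalgebra (Fin N) ℤ →ₐ[ℤ] K :=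
  (aeval fun i : Fin N => s (i.1 + 1)).comp
    (esymmAlgEquiv (Fin N) ℤ (Fintype.card_fin N)).symm.toAlgHom

theorem symHom_esymm {s : ℕ → K} (h0 : s 0 = 1) {N k : ℕ} (hk : k ≤ N) :
    symHom s N ⟨esymm (Fin N) ℤ k, esymm_isSymmetric _ _ _⟩ = s k := by
  rcases k with _ | k
  · have : (⟨esymm (Fin N) ℤ 0, esymm_isSymmetric _ _ _⟩ : symmetricSubalgebra (Fin N) ℤ) = 1 :=
      Subtype.ext (esymm_zero (Fin N) ℤ)
    rw [this, map_one, h0]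
  · show aeval _ ((esymmAlgEquiv (Fin N) ℤ (Fintype.card_fin N)).symm _) = _
    rw [esymmAlgEquiv_symm_apply ℤ (Fintype.card_fin N) ⟨k, hk⟩, aeval_X]

/-- The elementary symmetric polynomial in the `l`-th powers of the variables. -/
noncomputable def psumSym (N l : ℕ) : symmetricSubalgebra (Fin N) ℤ :=
  ⟨psum (Fin N) ℤ l, psum_isSymmetric _ _ _⟩

/-- Raising all variables to the power `l` is a ring homomorphism, so it preserves Newton's
identities. -/
theorem newton_esymmPow (N l : ℕ) :
    Newton (fun k => esymmPow N k l) (fun i => psumSym N ((i + 1) * l)) := by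
  have h := (newton_esymm (Fin N) ℤ).map (expand l : MvPolynomial (Fin N) ℤ →ₐ[ℤ] _)
  refine ⟨Subtype.ext h.1, fun k => Subtype.ext ?_⟩
  have h2 := h.2 k
  simp only [esymmPow, psumSym]
  have hp : ∀ i, (expand l : MvPolynomial (Fin N) ℤ →ₐ[ℤ] _) (psum (Fin N) ℤ i)
      = psum (Fin N) ℤ (i * l) := by
    intro i
    simp only [psum, map_sum, map_pow, expand_X, ← pow_mul, Nat.mul_comm]
  simpa [hp] using h2

theorem esymmPow_one_right (N k : ℕ) :
    esymmPow N k 1 = ⟨esymm (Fin N) ℤ k, esymm_isSymmetric _ _ _⟩ :=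
  Subtype.ext (expand_one_apply _)

theorem esymmPow_one (N l : ℕ) : esymmPow N 1 l = psumSym N l := by
  apply Subtype.ext
  simp [esymmPow, psumSym, psum, esymm_one]

/-- `symHom` prescribes the elementary symmetric polynomials up to degree `N`, and these determine
the power sums up to the same degree. -/
theorem symHom_psum {s p : ℕ → K} (h : Newton s p) {N i : ℕ} (hi : i < N) :
    symHom s N (psumSym N (i + 1)) = p i := by
  refine Newton.p_unique (s := s) (p := fun i => symHom s N (psumSym N (i + 1))) (N := N) h.1
    (fun k hk => ?_) (fun k _ => h.2 k) i hi
  have h2 := congrArg (symHom s N) ((newton_esymmPow N 1).2 k)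
  simp only [esymmPow_one_right, map_mul, map_add, map_natCast, map_one, map_sum, map_pow, map_neg,
    mul_one] at h2
  rw [symHom_esymm h.1 hk] at h2
  rw [h2]
  refine Finset.sum_congr rfl fun i _ => ?_
  rw [symHom_esymm h.1 (by omega)]

theorem symHom_esymmPow_newton {s p : ℕ → K} (h : Newton s p) {N l k : ℕ} (hl : 0 < l)
    (hk : (k + 1) * l ≤ N) :
    ((k : K) + 1) * symHom s N (esymmPow N (k + 1) l) =
    ∑ i ∈ Finset.range (k + 1), (-1) ^ i * p ((i + 1) * l - 1) *
      symHom s N (esymmPow N (k - i) l) := by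
  have h2 := congrArg (symHom s N) ((newton_esymmPow N l).2 k)
  simp only [map_mul, map_add, map_natCast, map_one, map_sum, map_pow, map_neg] at h2
  rw [h2]
  refine Finset.sum_congr rfl fun i hi => ?_
  have hi' := Finset.mem_range.mp hi
  have h3 : 0 < (i + 1) * l := by positivity
  have h4 : (i + 1) * l ≤ (k + 1) * l := Nat.mul_le_mul_right _ (by omega)
  rw [← symHom_psum h (N := N) (i := (i + 1) * l - 1) (by omega), Nat.sub_add_cancel h3]

theorem symHom_esymmPow_zero (s : ℕ → K) (N l : ℕ) : symHom s N (esymmPow N 0 l) = 1 := by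
  exact (congrArg (symHom s N) (newton_esymmPow N l).1).trans (map_one _)

theorem newton_symHom_esymmPow [IsDomain K] [CharZero K] {s p : ℕ → K} (h : Newton s p) {l : ℕ}
    (hl : 0 < l) :
    Newton (fun k => symHom s (k * l) (esymmPow (k * l) k l)) (fun i => p ((i + 1) * l - 1)) := by
  refine ⟨symHom_esymmPow_zero _ _ _, fun k => ?_⟩
  rw [symHom_esymmPow_newton h hl le_rfl]
  refine Finset.sum_congr rfl fun i hi => ?_
  congr 1
  -- The recursion was written in `(k + 1) * l` variables, while the term of degree `k - i` is
  -- defined with `(k - i) * l` variables. Both versions satisfy the same recursion up to that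
  -- degree, so the number of variables is irrelevant once it is large enough.
  refine s_unique_of_newton (N := k - i) (p := fun i => p ((i + 1) * l - 1))
    (s := fun j => symHom s ((k + 1) * l) (esymmPow _ j l))
    (s' := fun j => symHom s ((k - i) * l) (esymmPow _ j l))
    (symHom_esymmPow_zero _ _ _) (symHom_esymmPow_zero _ _ _)
    (fun j hj => symHom_esymmPow_newton h hl (Nat.mul_le_mul_right _ (by omega)))
    (fun j hj => symHom_esymmPow_newton h hl (Nat.mul_le_mul_right _ (by omega))) _ le_rfl

end Newton

/-! ### The elements `σ_t(w)` for words. -/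

section SigmaWord
variable {R A : Type*} [CommRing R]

@[simp] theorem gen_zero (c : PrimClass A) : gen R 0 c = 1 := rfl

theorem map_gen {R' : Type*} [CommRing R'] (φ : R →+* R') (t : ℕ) (c : PrimClass A) :
    MvPolynomial.map φ (gen R t c) = gen R' t c := by
  unfold gen
  split_ifs <;> simp

theorem map_sigmaWord {R' : Type*} [CommRing R'] (φ : R →+* R') (t : ℕ) (w : Word A) :
    MvPolynomial.map φ (sigmaWord R t w) = sigmaWord R' t w := by
  unfold sigmaWord
  rw [map_aeval, aeval_def, ← coe_eval₂Hom]
  congr 1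
  refine ringHom_ext (fun r => ?_) fun i => by simp [map_gen]
  simp

theorem sigmaWord_eq_symHom (t : ℕ) (w : Word A) :
    sigmaWord R t w = symHom (fun k => gen R k (Quotient.mk _ (root w))) (t * rootExp w)
      (esymmPow _ t (rootExp w)) := rfl

theorem sigmaWord_congr {v w : Word A} (h : v ≈ w) (t : ℕ) : sigmaWord R t v = sigmaWord R t w := by
  rw [sigmaWord_eq_symHom, sigmaWord_eq_symHom, mk_root_eq_of_equiv h, (root_of_equiv h).2]

theorem sigmaWord_prim (t : ℕ) (u : PrimWord (Letter A)) :
    sigmaWord R t u.1 = gen R t (Quotient.mk _ u) := by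
  rw [sigmaWord_eq_symHom, (root_prim u).1, (root_prim u).2, esymmPow_one_right,
    symHom_esymm (by simp) (by simp)]

theorem sigmaWord_one_eq_newtonP (w : Word A) :
    sigmaWord R 1 w = newtonP (fun k => gen R k (Quotient.mk _ (root w))) (rootExp w - 1) := by
  have h1 := rootExp_pos w
  rw [sigmaWord_eq_symHom, esymmPow_one]
  conv_lhs => rw [show psumSym (1 * rootExp w) (rootExp w) = psumSym (1 * rootExp w)
    (rootExp w - 1 + 1) by rw [Nat.sub_add_cancel h1]]
  rw [symHom_psum (newton_newtonP (gen_zero _)) (by omega)]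

/-- Both sequences are built from the symbols of the same primitive root, with dilation by `rootExp
w`. The argument runs over `ℤ`, where the ring is a domain of characteristic zero, and is then
mapped to `R`. -/
theorem newton_sigmaWord (w : Word A) :
    Newton (fun k => sigmaWord R k w) (fun i => sigmaWord R 1 (pw w i)) := by
  have h : Newton (fun k => sigmaWord ℤ k w) (fun i => sigmaWord ℤ 1 (pw w i)) := by
    have := newton_symHom_esymmPow
      (newton_newtonP (s := fun k => gen ℤ k (Quotient.mk _ (root w))) (gen_zero _))
      (rootExp_pos w)
    simp only [sigmaWord_one_eq_newtonP, (root_pw w _).1, (root_pw w _).2]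
    exact this
  have := h.map (MvPolynomial.map (Int.castRingHom R))
  simpa only [map_sigmaWord] using this

end SigmaWord

end MatInv

namespace MatInv
open MvPolynomial Function

/-! ### Cycles of a permutation. -/

section Cycles
variable {U : Type*}

/-- The cycles of a permutation (including the fixed points). -/
abbrev Cyc (ν : Equiv.Perm U) := Quotient (Equiv.Perm.SameCycle.setoid ν)

theorem sameCycle_iff_iterate [Finite U] {ν : Equiv.Perm U} {a b : U} :
    ν.SameCycle a b ↔ ∃ n : ℕ, ν^[n] a = b := by
  constructor
  · intro h
    obtain ⟨n, hn⟩ := h.exists_nat_pow_eq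
    exact ⟨n, by rw [← hn, Equiv.Perm.iterate_eq_pow]⟩
  · rintro ⟨n, rfl⟩
    rw [Equiv.Perm.iterate_eq_pow]
    exact ⟨n, by simp⟩

theorem perm_mem_periodicPts [Finite U] (ν : Equiv.Perm U) (a : U) : a ∈ periodicPts ν :=
  ν.injective.mem_periodicPts a

theorem perm_minimalPeriod_pos [Finite U] (ν : Equiv.Perm U) (a : U) : 0 < minimalPeriod ν a :=
  minimalPeriod_pos_of_mem_periodicPts (perm_mem_periodicPts ν a)

theorem Cyc.sameCycle_out {ν : Equiv.Perm U} (a : U) :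
    ν.SameCycle (Quotient.out (Quotient.mk _ a : Cyc ν)) a :=
  Quotient.exact (Quotient.out_eq (Quotient.mk _ a : Cyc ν))

theorem mk_eq_of_iterate [Finite U] {ν : Equiv.Perm U} (q : Cyc ν) (i : ℕ) :
    (Quotient.mk _ (ν^[i] q.out) : Cyc ν) = q := by
  conv_rhs => rw [← Quotient.out_eq q]
  exact Quotient.sound (sameCycle_iff_iterate.mpr ⟨i, rfl⟩).symm

theorem cycEquiv_bijective [Finite U] (ν : Equiv.Perm U) :
    Bijective (fun x : Σ q : Cyc ν, Fin (minimalPeriod ν q.out) => ν^[x.2] x.1.out) := by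
  constructor
  · rintro ⟨q, i⟩ ⟨q', i'⟩ h
    have h1 : q = q' := by
      rw [← mk_eq_of_iterate q i, ← mk_eq_of_iterate q' i']
      exact congrArg _ h
    subst h1
    have h2 := (iterate_eq_iterate_iff_of_lt_minimalPeriod i.2 i'.2).mp h
    rw [Fin.ext h2]
  · intro a
    obtain ⟨n, hn⟩ := sameCycle_iff_iterate.mp (Cyc.sameCycle_out (ν := ν) a)
    refine ⟨⟨Quotient.mk _ a, ⟨n % _, Nat.mod_lt _ (perm_minimalPeriod_pos ν _)⟩⟩, ?_⟩
    show ν^[n % _] _ = a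
    rw [iterate_mod_minimalPeriod_eq, hn]

/-- A finite type is the disjoint union of the cycles of a permutation. -/
noncomputable def cycEquiv [Finite U] (ν : Equiv.Perm U) :
    (Σ q : Cyc ν, Fin (minimalPeriod ν q.out)) ≃ U :=
  Equiv.ofBijective _ (cycEquiv_bijective ν)

noncomputable instance [Finite U] (ν : Equiv.Perm U) : Fintype (Cyc ν) := Fintype.ofFinite _

theorem prod_eq_prod_cyc [Fintype U] {K : Type*} [CommMonoid K] (ν : Equiv.Perm U) (g : U → K) :
    ∏ a, g a = ∏ q : Cyc ν, ∏ i : Fin (minimalPeriod ν q.out), g (ν^[i] q.out) := by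
  rw [← Equiv.prod_comp (cycEquiv ν), Fintype.prod_sigma]
  rfl

theorem periodicOrbit_map_eq {B : Type*} (f : U → U) (a : U) (l : U → B) :
    (periodicOrbit f a).map l =
      ((List.ofFn fun i : Fin (minimalPeriod f a) => l (f^[i] a) : List B) : Cycle B) := by
  rw [periodicOrbit_def, Cycle.map_coe, List.map_map, List.ofFn_eq_map, ← List.map_coe_finRange_eq_range,
    List.map_map]
  rfl

theorem periodicOrbit_eq_of_sameCycle [Finite U] {ν : Equiv.Perm U} {a b : U}
    (h : ν.SameCycle a b) : periodicOrbit ν a = periodicOrbit ν b := by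
  obtain ⟨n, rfl⟩ := sameCycle_iff_iterate.mp h
  exact (periodicOrbit_apply_iterate_eq (perm_mem_periodicPts ν a) n).symm

/-- A labelling of `U` is an independent choice of a labelling on every cycle, so the sum of
products factors. -/
theorem sum_prod_cyc [Fintype U] {K B : Type*} [CommRing K] [Fintype B] [DecidableEq U]
    (ν : Equiv.Perm U) (W : Cycle B → K) :
    ∑ l : U → B, ∏ q : Cyc ν, W ((periodicOrbit ν q.out).map l) =
      ∏ q : Cyc ν, ∑ ω : Fin (minimalPeriod ν q.out) → B, W (List.ofFn ω : List B) := by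
  classical
  rw [Finset.prod_univ_sum, Fintype.piFinset_univ]
  refine Fintype.sum_equiv (((cycEquiv ν).symm.arrowCongr (Equiv.refl B)).trans
    (Equiv.piCurry fun _ _ => B)) _ _ fun l => ?_
  refine Finset.prod_congr rfl fun q _ => ?_
  rw [periodicOrbit_map_eq]
  rfl

end Cycles

/-! ### The expansion of `n! s_n` over the symmetric group. -/

section Expansion
variable {U : Type*} [Fintype U] [DecidableEq U]

/-- The sum is the determinant of the matrix of the relation `f u = f v`, which has two equal rows
unless `f` is injective. -/
theorem sum_sign_stabilizer {N : Type*} [DecidableEq N] (f : U → N) :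
    ∑ ν : Equiv.Perm U, (if f ∘ ν = f then ((Equiv.Perm.sign ν : ℤˣ) : ℤ) else 0)
      = if Injective f then 1 else 0 := by
  have h : ∑ ν : Equiv.Perm U, (if f ∘ ν = f then ((Equiv.Perm.sign ν : ℤˣ) : ℤ) else 0)
      = (Matrix.of fun u v => if f u = f v then (1 : ℤ) else 0).det := by
    rw [Matrix.det_apply']
    refine Finset.sum_congr rfl fun ν _ => ?_
    simp only [Matrix.of_apply, Finset.prod_ite_zero, Finset.prod_const_one, Finset.mem_univ,
      true_implies, funext_iff, comp_apply]
    split_ifs <;> simp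
  split_ifs with hf
  · rw [Finset.sum_eq_single 1]
    · simp
    · intro ν _ hν
      rw [if_neg]
      intro h0
      exact hν (Equiv.ext fun u => hf (congrFun h0 u))
    · simp
  · rw [h]
    obtain ⟨u, v, huv, hne⟩ := Function.not_injective_iff.mp hf
    exact Matrix.det_zero_of_row_eq hne (funext fun w => by simp [huv])

/-- Expanding the product picks one variable per cycle, that is, a `ν`-invariant function on `U`. -/
theorem prod_psum_eq {N : Type*} [Fintype N] [DecidableEq N] (ν : Equiv.Perm U) :
    ∏ q : Cyc ν, psum N ℤ (minimalPeriod ν q.out) =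
      ∑ f : U → N, if f ∘ ν = f then ∏ u, (X (f u) : MvPolynomial N ℤ) else 0 := by
  classical
  simp only [psum]
  rw [Finset.prod_univ_sum, Fintype.piFinset_univ, ← Finset.sum_filter]
  refine Finset.sum_bij (fun g _ u => g (Quotient.mk _ u)) ?_ ?_ ?_ ?_
  · intro g _
    simp only [Finset.mem_filter, Finset.mem_univ, true_and]
    funext u
    exact congrArg g (Quotient.sound (Equiv.Perm.sameCycle_apply_left.mpr (.refl _ _)))
  · intro g _ g' _ h
    funext q
    obtain ⟨u, rfl⟩ := Quotient.exists_rep q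
    exact congrFun h u
  · intro f hf
    simp only [Finset.mem_filter, Finset.mem_univ, true_and] at hf
    refine ⟨Quotient.lift f ?_, Finset.mem_univ _, rfl⟩
    intro a b hab
    obtain ⟨n, rfl⟩ := sameCycle_iff_iterate.mp hab
    induction n with
    | zero => rfl
    | succ n ih =>
      rw [iterate_succ_apply', ih ⟨n, by simp [← Equiv.Perm.iterate_eq_pow]⟩]
      exact (congrFun hf _).symm
  · intro g _
    rw [prod_eq_prod_cyc ν]
    refine Finset.prod_congr rfl fun q _ => ?_
    simp only [mk_eq_of_iterate, Finset.prod_const, Finset.card_univ, Fintype.card_fin]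

theorem factorial_mul_prod_X {n : ℕ} (hn : Fintype.card U = n) :
    (n.factorial : MvPolynomial (Fin n) ℤ) * ∏ i, X i = ∑ ν : Equiv.Perm U,
      ((Equiv.Perm.sign ν : ℤˣ) : ℤ) • ∏ q : Cyc ν, psum (Fin n) ℤ (minimalPeriod ν q.out) := by
  simp only [prod_psum_eq, Finset.smul_sum]
  rw [Finset.sum_comm]
  have h1 : ∀ f : U → Fin n, ∑ ν : Equiv.Perm U, ((Equiv.Perm.sign ν : ℤˣ) : ℤ) •
      (if f ∘ ν = f then ∏ u, (X (f u) : MvPolynomial (Fin n) ℤ) else 0) =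
      if Injective f then ∏ i, X i else 0 := by
    intro f
    have h2 : ∀ ν : Equiv.Perm U, ((Equiv.Perm.sign ν : ℤˣ) : ℤ) •
      (if f ∘ ν = f then ∏ u, (X (f u) : MvPolynomial (Fin n) ℤ) else 0) =
      (if f ∘ ν = f then ((Equiv.Perm.sign ν : ℤˣ) : ℤ) else 0) • ∏ u, X (f u) := by
      intro ν; split_ifs <;> simp
    rw [Finset.sum_congr rfl fun ν _ => h2 ν, ← Finset.sum_smul, sum_sign_stabilizer]
    split_ifs with hf
    · have hb : Bijective f := (Fintype.bijective_iff_injective_and_card f).mpr ⟨hf, by simp [hn]⟩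
      rw [one_smul]
      exact Fintype.prod_bijective f hb _ _ fun _ => rfl
    · rw [zero_smul]
  rw [Finset.sum_congr rfl fun f _ => h1 f, ← Finset.sum_filter, Finset.sum_const, nsmul_eq_mul]
  congr 2
  rw [← Fintype.card_subtype, Fintype.card_congr (Equiv.subtypeInjectiveEquivEmbedding U (Fin n)),
    Fintype.card_embedding_eq, Fintype.card_fin, hn, Nat.descFactorial_self]

/-- It suffices to treat symmetric polynomials in exactly `n` variables, where `e_n` is the product
of all variables; `symHom` transports the result to any Newton pair. -/
theorem Newton.factorial_mul {K : Type*} [CommRing K] {s p : ℕ → K} (h : Newton s p) {n : ℕ}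
    (hn : Fintype.card U = n) :
    (n.factorial : K) * s n = ∑ ν : Equiv.Perm U, ((Equiv.Perm.sign ν : ℤˣ) : ℤ) •
      ∏ q : Cyc ν, p (minimalPeriod ν q.out - 1) := by
  have h1 : (n.factorial : symmetricSubalgebra (Fin n) ℤ) *
      ⟨esymm (Fin n) ℤ n, esymm_isSymmetric _ _ _⟩ = ∑ ν : Equiv.Perm U,
      ((Equiv.Perm.sign ν : ℤˣ) : ℤ) • ∏ q : Cyc ν, psumSym n (minimalPeriod ν q.out) := by
    apply Subtype.ext
    have h2 : esymm (Fin n) ℤ n = ∏ i, X i := by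
      have : Finset.powersetCard n (Finset.univ : Finset (Fin n)) = {Finset.univ} := by
        have h0 := Finset.powersetCard_self (Finset.univ : Finset (Fin n))
        rwa [Finset.card_fin] at h0
      rw [esymm, this, Finset.sum_singleton]
    have h3 := factorial_mul_prod_X hn
    simp only [psumSym]
    push_cast
    rw [h2, h3]
  have h4 := congrArg (symHom s n) h1
  simp only [map_mul, map_natCast, map_sum, map_zsmul, map_prod, symHom_esymm h.1 le_rfl] at h4
  rw [h4]
  refine Finset.sum_congr rfl fun ν _ => ?_
  congr 1
  refine Finset.prod_congr rfl fun q _ => ?_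
  have hpos := perm_minimalPeriod_pos ν q.out
  have hle : minimalPeriod ν q.out ≤ n := by
    rw [← hn, ← Fintype.card_fin (minimalPeriod ν q.out)]
    exact Fintype.card_le_of_injective (fun i : Fin _ => ν^[i] q.out)
      (fun i j hij => Fin.ext ((iterate_eq_iterate_iff_of_lt_minimalPeriod i.2 j.2).mp hij))
  rw [← symHom_psum h (N := n) (by omega), Nat.sub_add_cancel hpos]

end Expansion

end MatInv

namespace MatInv
open MvPolynomial Function

/-! ### Power sums of an Euler product. -/

section Euler
variable {C K : Type*} [CommRing K]

/-- In terms of the signed series `∑ (-1)^k s_k X^k` the identities say that its logarithmic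
derivative is `-∑ p_i X^i`. This form is suited to products. -/
theorem Newton.alternating {s p : ℕ → K} (h : Newton s p) (k : ℕ) :
    (k : K) * ((-1) ^ k * s k) =
      -∑ i ∈ Finset.range k, p i * ((-1) ^ (k - (i + 1)) * s (k - (i + 1))) := by
  rcases k with _ | k
  · simp
  · have h2 := h.2 k
    push_cast
    rw [mul_left_comm, h2, Finset.mul_sum, ← Finset.sum_neg_distrib]
    refine Finset.sum_congr rfl fun i hi => ?_
    have hi' := Finset.mem_range.mp hi
    obtain ⟨m, rfl⟩ : ∃ m, k = i + m := ⟨k - i, by omega⟩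
    have e2 : i + m - i = m := by omega
    rw [e2, pow_succ, pow_add]
    have e3 : ((-1 : K) ^ i * (-1) ^ i) = 1 := by rw [← mul_pow]; simp
    linear_combination (-(p i * (-1) ^ m * s m)) * e3

theorem newton_of_alternating {s p : ℕ → K} (h0 : s 0 = 1) (h : ∀ k : ℕ,
    ((k : K) + 1) * ((-1) ^ (k + 1) * s (k + 1)) =
      -∑ i ∈ Finset.range (k + 1), p i * ((-1) ^ (k - i) * s (k - i))) : Newton s p := by
  refine ⟨h0, fun k => ?_⟩
  have e0 : ((-1 : K) ^ (k + 1) * (-1) ^ (k + 1)) = 1 := by rw [← mul_pow]; simp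
  have h2 : ((k : K) + 1) * s (k + 1) = (-1) ^ (k + 1) *
      (((k : K) + 1) * ((-1) ^ (k + 1) * s (k + 1))) := by
    linear_combination (-(((k : K) + 1) * s (k + 1))) * e0
  rw [h2, h, ← Finset.sum_neg_distrib, Finset.mul_sum]
  refine Finset.sum_congr rfl fun i hi => ?_
  have hi' := Finset.mem_range.mp hi
  obtain ⟨m, rfl⟩ : ∃ m, k = i + m := ⟨k - i, by omega⟩
  have e2 : i + m - i = m := by omega
  rw [e2, pow_succ, pow_add]
  have e3 : ((-1 : K) ^ m * (-1) ^ m) = 1 := by rw [← mul_pow]; simp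
  linear_combination ((-1) ^ i * p i * s m) * e3

theorem wsum_add_single (deg : C → ℕ) (j : C →₀ ℕ) (c : C) (m : ℕ) :
    ((j + Finsupp.single c m).sum fun c k => k * deg c) = (j.sum fun c k => k * deg c) + m * deg c := by
  classical
  rw [Finsupp.sum_add_index' (by simp) (by intros; ring), Finsupp.sum_single_index (by simp)]

/-- The coefficients of the product of the series with coefficients `s c`, where the `c`-th series
is dilated by `deg c`, satisfy Newton's identities if the `s c` do. -/
theorem Newton.euler (deg : C → ℕ) (hdeg : ∀ c, 0 < deg c)
    (hJ : ∀ n, {j : C →₀ ℕ | (j.sum fun c k => k * deg c) = n}.Finite)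
    (hD : ∀ n, {c : C | deg c ∣ n + 1}.Finite)
    {s p : C → ℕ → K} (h : ∀ c, Newton (s c) (p c)) :
    Newton (fun n => ∑ j ∈ (hJ n).toFinset,
        (-1) ^ (n + j.sum fun _ k => k) * j.prod fun c k => s c k)
      (fun i => ∑ c ∈ (hD i).toFinset, (deg c : K) * p c ((i + 1) / deg c - 1)) := by
  classical
  set a : C → ℕ → K := fun c k => (-1) ^ k * s c k with ha
  have ha0 : ∀ c, a c 0 = 1 := fun c => by simp [ha, (h c).1]
  have hprod : ∀ (n : ℕ) (j : C →₀ ℕ), (-1 : K) ^ n * ((-1) ^ (n + j.sum fun _ k => k) *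
      j.prod fun c k => s c k) = j.prod a := by
    intro n j
    rw [← mul_assoc, ← pow_add, ← add_assoc, pow_add, ← two_mul, pow_mul, neg_one_sq, one_pow,
      one_mul, Finsupp.sum, ← Finset.prod_pow_eq_pow_sum, Finsupp.prod, Finsupp.prod,
      ← Finset.prod_mul_distrib]
  apply newton_of_alternating
  · have h0 : (hJ 0).toFinset = {0} := by
      ext j
      simp only [Set.Finite.mem_toFinset, Set.mem_ofPred_eq, Finset.mem_singleton]
      constructor
      · intro hj
        ext c
        by_contra hc
        have := Finset.single_le_sum (f := fun c => j c * deg c) (fun _ _ => Nat.zero_le _)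
          (Finsupp.mem_support_iff.mpr hc)
        rw [Finsupp.sum] at hj
        have h2 : 0 < j c * deg c := Nat.mul_pos (Nat.pos_of_ne_zero hc) (hdeg c)
        omega
      · rintro rfl; simp
    rw [h0]; simp
  intro k
  simp only [Finset.mul_sum (_ : Finset (C →₀ ℕ)), hprod]
  -- Leibniz rule: the total degree `k + 1` is split as `∑ j c * deg c`, and the identity for `s c`
  -- is applied to the factor at `c`.
  have hL : ∀ j ∈ (hJ (k + 1)).toFinset, ((k : K) + 1) * j.prod a =
      -∑ x ∈ j.support.sigma fun c => Finset.range (j c),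
        (deg x.1 : K) * p x.1 x.2 * (j - Finsupp.single x.1 (x.2 + 1)).prod a := by
    intro j hj
    simp only [Set.Finite.mem_toFinset, Set.mem_ofPred_eq] at hj
    have h1 : ((k : K) + 1) = ∑ c ∈ j.support, (j c : K) * deg c := by
      have := congrArg (Nat.cast : ℕ → K) hj
      rw [Finsupp.sum] at this
      push_cast at this
      exact this.symm
    rw [h1, Finset.sum_sigma, Finset.sum_mul, ← Finset.sum_neg_distrib]
    refine Finset.sum_congr rfl fun c _ => ?_
    rw [← Finsupp.mul_prod_erase' j c a ha0]
    have h2 := (h c).alternating (j c)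
    calc (j c : K) * deg c * (a c (j c) * (j.erase c).prod a)
        = deg c * (j.erase c).prod a * ((j c : K) * ((-1) ^ j c * s c (j c))) := by
          simp only [ha]; ring
      _ = _ := by
        rw [h2, mul_neg, Finset.mul_sum]
        congr 1
        refine Finset.sum_congr rfl fun m _ => ?_
        rw [← Finsupp.mul_prod_erase' (j - Finsupp.single c (m + 1)) c a ha0]
        have h3 : (j - Finsupp.single c (m + 1)).erase c = j.erase c := by
          ext c'
          by_cases hc : c' = c
          · subst hc; simp
          · simp [Finsupp.erase_ne hc, Finsupp.single_eq_of_ne hc]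
        rw [h3]
        simp only [ha, Finsupp.coe_tsub, Pi.sub_apply, Finsupp.single_eq_same]
        ring
  rw [Finset.sum_congr rfl hL, Finset.sum_neg_distrib]
  congr 1
  have hR : ∀ i ∈ Finset.range (k + 1),
      ∑ j ∈ (hJ (k - i)).toFinset,
        (∑ c ∈ (hD i).toFinset, (deg c : K) * p c ((i + 1) / deg c - 1)) * j.prod a =
      ∑ x ∈ (hD i).toFinset ×ˢ (hJ (k - i)).toFinset,
        (deg x.1 : K) * p x.1 ((i + 1) / deg x.1 - 1) * x.2.prod a := by
    intro i _
    rw [← Finset.mul_sum, Finset.sum_mul_sum, Finset.sum_product]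
  rw [Finset.sum_congr rfl hR, Finset.sum_sigma', Finset.sum_sigma']
  -- A term on the left removes `m + 1` copies of `c` from `j`. On the right these copies are
  -- recorded by their total degree `i + 1 = (m + 1) * deg c`, from which `m` is recovered by
  -- division.
  refine Finset.sum_bij'
    (fun x _ => ⟨(x.2.2 + 1) * deg x.2.1 - 1,
      (x.2.1, x.1 - Finsupp.single x.2.1 (x.2.2 + 1))⟩)
    (fun x _ => ⟨x.2.2 + Finsupp.single x.2.1 ((x.1 + 1) / deg x.2.1),
      ⟨x.2.1, (x.1 + 1) / deg x.2.1 - 1⟩⟩) ?_ ?_ ?_ ?_ ?_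
  · rintro ⟨j, c, m⟩ hx
    simp only [Finset.mem_sigma, Set.Finite.mem_toFinset, Set.mem_ofPred_eq, Finset.mem_range,
      Finset.mem_product] at hx ⊢
    obtain ⟨hj, -, hm⟩ := hx
    have hle : Finsupp.single c (m + 1) ≤ j := by
      rw [Finsupp.single_le_iff]; exact hm
    have h1 := wsum_add_single deg (j - Finsupp.single c (m + 1)) c (m + 1)
    rw [tsub_add_cancel_of_le hle, hj] at h1
    have h2 : 0 < (m + 1) * deg c := Nat.mul_pos (Nat.succ_pos _) (hdeg c)
    refine ⟨by omega, ?_, by omega⟩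
    rw [Nat.sub_add_cancel h2]
    exact Dvd.intro_left _ rfl
  · rintro ⟨i, c, j⟩ hx
    simp only [Finset.mem_sigma, Set.Finite.mem_toFinset, Set.mem_ofPred_eq, Finset.mem_range,
      Finset.mem_product] at hx ⊢
    obtain ⟨hi, ⟨d, hd⟩, hj⟩ := hx
    have h1 : (i + 1) / deg c = d := by rw [hd]; exact Nat.mul_div_cancel_left d (hdeg c)
    have hdpos : 0 < d := Nat.pos_of_ne_zero (by rintro rfl; simp at hd)
    rw [h1]
    refine ⟨?_, ?_, ?_⟩
    · rw [wsum_add_single, hj, Nat.mul_comm, ← hd]; omega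
    · rw [Finsupp.mem_support_iff, Finsupp.add_apply, Finsupp.single_eq_same]; omega
    · rw [Finsupp.add_apply, Finsupp.single_eq_same]; omega
  · rintro ⟨j, c, m⟩ hx
    simp only [Finset.mem_sigma, Set.Finite.mem_toFinset, Set.mem_ofPred_eq, Finset.mem_range] at hx
    obtain ⟨hj, -, hm⟩ := hx
    have hle : Finsupp.single c (m + 1) ≤ j := by
      rw [Finsupp.single_le_iff]; exact hm
    have h2 : 0 < (m + 1) * deg c := Nat.mul_pos (Nat.succ_pos _) (hdeg c)
    simp only [Nat.sub_add_cancel h2, Nat.mul_div_cancel _ (hdeg c), tsub_add_cancel_of_le hle,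
      Nat.add_sub_cancel]
  · rintro ⟨i, c, j⟩ hx
    simp only [Finset.mem_sigma, Set.Finite.mem_toFinset, Set.mem_ofPred_eq, Finset.mem_range,
      Finset.mem_product] at hx
    obtain ⟨hi, ⟨d, hd⟩, hj⟩ := hx
    have h1 : (i + 1) / deg c = d := by rw [hd]; exact Nat.mul_div_cancel_left d (hdeg c)
    have hdpos : 0 < d := Nat.pos_of_ne_zero (by rintro rfl; simp at hd)
    simp only [h1, Nat.sub_add_cancel hdpos, Nat.mul_comm d, ← hd,
      add_tsub_cancel_right]
  · rintro ⟨j, c, m⟩ hx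
    have h2 : 0 < (m + 1) * deg c := Nat.mul_pos (Nat.succ_pos _) (hdeg c)
    simp only [Nat.sub_add_cancel h2, Nat.mul_div_cancel _ (hdeg c), Nat.add_sub_cancel]

end Euler

end MatInv

namespace MatInv
open MvPolynomial Function

/-! ### Sums over words sorted by primitive roots. -/

section Regroup
variable {B : Type*}

/-- The word with letters `ω 0, …, ω k`. -/
def wordOfFn {k : ℕ} (ω : Fin (k + 1) → B) : FreeSemigroup B :=
  ⟨ω 0, List.ofFn fun i => ω i.succ⟩

@[simp] theorem wordList_wordOfFn {k : ℕ} (ω : Fin (k + 1) → B) :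
    wordList (wordOfFn ω) = List.ofFn ω := by
  rw [List.ofFn_succ]; rfl

theorem wordOfFn_injective {k : ℕ} :
    Injective (wordOfFn : (Fin (k + 1) → B) → FreeSemigroup B) := by
  intro ω ω' h
  have := congrArg wordList h
  rw [wordList_wordOfFn, wordList_wordOfFn] at this
  exact List.ofFn_injective this

theorem wordOfFn_cons {k : ℕ} (b : B) (ω : Fin (k + 1) → B) :
    wordOfFn (Fin.cons b ω : Fin (k + 2) → B) = FreeSemigroup.of b * wordOfFn ω := by
  apply wordList_injective
  rw [wordList_mul, wordList_wordOfFn, wordList_wordOfFn, List.ofFn_succ]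
  simp

theorem exists_wordOfFn {k : ℕ} (w : FreeSemigroup B) (h : w.length = k + 1) :
    ∃ ω : Fin (k + 1) → B, wordOfFn ω = w := by
  refine ⟨fun i => (wordList w)[i]'(by rw [wordList_length, h]; exact i.2), ?_⟩
  apply wordList_injective
  rw [wordList_wordOfFn]
  exact List.ext_getElem (by rw [List.length_ofFn, wordList_length, h])
    fun i h1 h2 => by rw [List.getElem_ofFn]; rfl

theorem length_root_mul (w : FreeSemigroup B) : rootExp w * (root w).1.length = w.length := by
  rw [← wordList_length w, root_spec w, length_lpow, wordList_length]

theorem wordOfFn_root_injective {k : ℕ} :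
    Injective (fun ω : Fin (k + 1) → B => root (wordOfFn ω)) := by
  intro ω ω' h
  apply wordOfFn_injective
  have hl : ∀ ω : Fin (k + 1) → B, rootExp (wordOfFn ω) * (root (wordOfFn ω)).1.length = k + 1 := by
    intro ω
    rw [length_root_mul, ← wordList_length, wordList_wordOfFn, List.length_ofFn]
  have h' : root (wordOfFn ω) = root (wordOfFn ω') := h
  have h1 : rootExp (wordOfFn ω) = rootExp (wordOfFn ω') := by
    have h2 := (hl ω).trans (hl ω').symm
    rw [h'] at h2
    exact Nat.eq_of_mul_eq_mul_right (Nat.succ_pos _) h2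
  rw [eq_pw_root (wordOfFn ω), eq_pw_root (wordOfFn ω'), h', h1]

/-- A sum over all words of length `k + 1`, sorted by the classes of their primitive roots. -/
theorem sum_words_eq [Fintype B] {C K : Type*} [CommRing K] (cls : PrimWord B → C) (deg : C → ℕ)
    (hdeg : ∀ u, deg (cls u) = u.1.length) (k : ℕ) (hD : {c : C | deg c ∣ k + 1}.Finite)
    (g : C → ℕ → K) :
    ∑ ω : Fin (k + 1) → B, g (cls (root (wordOfFn ω))) (rootExp (wordOfFn ω) - 1) =
      ∑ c ∈ hD.toFinset, (Nat.card {u // cls u = c} : K) * g c ((k + 1) / deg c - 1) := by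
  classical
  have hl : ∀ ω : Fin (k + 1) → B, rootExp (wordOfFn ω) * deg (cls (root (wordOfFn ω))) = k + 1 := by
    intro ω
    rw [hdeg, length_root_mul, ← wordList_length, wordList_wordOfFn, List.length_ofFn]
  have hpos : ∀ u, 0 < deg (cls u) := fun u => by rw [hdeg]; exact Nat.succ_pos _
  have h1 : ∀ ω : Fin (k + 1) → B, g (cls (root (wordOfFn ω))) (rootExp (wordOfFn ω) - 1) =
      g (cls (root (wordOfFn ω))) ((k + 1) / deg (cls (root (wordOfFn ω))) - 1) := by
    intro ω
    rw [← hl ω, Nat.mul_div_cancel _ (hpos _)]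
  rw [Finset.sum_congr rfl fun ω _ => h1 ω,
    ← Finset.sum_fiberwise_of_maps_to (t := hD.toFinset)
      (g := fun ω : Fin (k + 1) → B => cls (root (wordOfFn ω)))
      (fun ω _ => by
        simp only [Set.Finite.mem_toFinset, Set.mem_ofPred_eq]
        exact Dvd.intro_left _ (hl ω))]
  refine Finset.sum_congr rfl fun c hc => ?_
  simp only [Set.Finite.mem_toFinset, Set.mem_ofPred_eq] at hc
  rw [Finset.sum_congr rfl (g := fun _ => g c ((k + 1) / deg c - 1)) (fun ω hω => by
    rw [(Finset.mem_filter.mp hω).2]), Finset.sum_const, nsmul_eq_mul]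
  congr 2
  rw [← Fintype.card_subtype, ← Nat.card_eq_fintype_card]
  -- For fixed length `k + 1` a word is determined by its root, and every root of length dividing `k
  -- + 1` occurs.
  refine Nat.card_eq_of_bijective
    (fun ω => (⟨root (wordOfFn ω.1), ω.2⟩ : {u // cls u = c})) ⟨?_, ?_⟩
  · intro ω ω' h
    exact Subtype.ext (wordOfFn_root_injective (congrArg Subtype.val h))
  · rintro ⟨u, hu⟩
    obtain ⟨m, hm⟩ := hc
    rw [← hu, hdeg] at hm
    have hmpos : 0 < m := Nat.pos_of_ne_zero (by rintro rfl; simp at hm)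
    obtain ⟨ω, hω⟩ := exists_wordOfFn (k := k) (pw u.1 (m - 1)) (by
      rw [← wordList_length, wordList_pw, length_lpow, Nat.sub_add_cancel hmpos, wordList_length,
        hm, Nat.mul_comm])
    have h2 : root (wordOfFn ω) = u := by rw [hω, (root_pw u.1 _).1, (root_prim u).1]
    exact ⟨⟨ω, by rw [h2, hu]⟩, Subtype.ext h2⟩

theorem finite_dvd_primCycle [Finite B] (n : ℕ) :
    {c : PrimCycle B | c.rep.length ∣ n + 1}.Finite := by
  have hS : {l : List B | l.length ≤ n + 1}.Finite := List.finite_length_le B (n + 1)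
  refine (hS.preimage (f := fun c : PrimCycle B => wordList c.rep)
    ((wordList_injective.comp PrimCycle.rep_injective).injOn)).subset fun c hc => ?_
  exact Nat.le_of_dvd (Nat.succ_pos _) hc

theorem PrimCycle.rep_isRotated (u : PrimWord B) :
    wordList (PrimCycle.rep (Quotient.mk _ u : PrimCycle B)) ~r wordList u.1 := by
  have h : (Quotient.mk _ (Quotient.out (Quotient.mk _ u : PrimCycle B)) : PrimCycle B)
      = Quotient.mk _ u := Quotient.out_eq _
  exact (Quotient.exact h :)

theorem wordList_lift {B' : Type*} (e : B → FreeSemigroup B') (w : FreeSemigroup B) :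
    wordList (FreeSemigroup.lift e w) = (wordList w).flatMap fun b => wordList (e b) := by
  induction w using FreeSemigroup.recOnMul with
  | ih1 a => simp
  | ih2 a w _ hw => rw [map_mul, wordList_mul, wordList_mul, hw]; simp

theorem isRotated_flatMap {B' : Type*} {l m : List B} (h : l ~r m) (f : B → List B') :
    l.flatMap f ~r m.flatMap f := by
  obtain ⟨n, rfl⟩ := h
  induction n generalizing l with
  | zero => rw [List.rotate_zero]
  | succ n ih =>
    rcases l with _ | ⟨a, l⟩
    · simp
    · rw [List.rotate_cons_succ]
      refine List.IsRotated.trans ?_ ih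
      simpa using (List.isRotated_append (l := f a) (l' := l.flatMap f))

theorem lift_prod_eq {M : Type*} [CommMonoid M] (a : B → M) {v w : FreeSemigroup B}
    (h : wordList v ~r wordList w) :
    ((wordList v).map a).prod = ((wordList w).map a).prod := (h.perm.map a).prod_eq

end Regroup

/-! ### Traces and Amitsur's formula. -/

section Trace
variable {R A : Type*} [CommRing R]

/-- The linear extension of `tr = σ₁` to `M_R`. -/
noncomputable def trM : MF R A →ₗ[R] NSigma R A :=
  Finsupp.linearCombination R (fun w => sigmaWord R 1 w) ∘ₗ
    (MonoidAlgebra.coeffLinearEquiv (S := R) (M := Word A) R).toLinearMap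

theorem trM_single (w : Word A) (r : R) :
    trM (MonoidAlgebra.single w r) = C r * sigmaWord R 1 w := by
  rw [← smul_eq_C_mul]
  exact Finsupp.linearCombination_single _ _ _

theorem word_mul_comm_equiv (u v : Word A) : u * v ≈ v * u := by
  refine Or.inl ?_
  rw [wordList_mul, wordList_mul]
  exact List.isRotated_append

theorem trM_mul_comm (α β : MF R A) : trM (α * β) = trM (β * α) := by
  induction α using MonoidAlgebra.induction_linear with
  | zero => simp
  | add x y hx hy => rw [add_mul, mul_add, map_add, map_add, hx, hy]
  | single u r =>
    induction β using MonoidAlgebra.induction_linear with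
    | zero => simp
    | add x y hx hy => rw [add_mul, mul_add, map_add, map_add, hx, hy]
    | single v s =>
      rw [MonoidAlgebra.single_mul_single, MonoidAlgebra.single_mul_single, trM_single, trM_single,
        sigmaWord_congr (word_mul_comm_equiv u v), mul_comm r s]

theorem MF.tr_add (α β : MF R A) : (α + β).tr = α.tr + β.tr := MonoidAlgebra.mapDomain_add _ _ _

@[simp] theorem MF.tr_zero : (0 : MF R A).tr = 0 := MonoidAlgebra.mapDomain_zero _

theorem MF.tr_single (w : Word A) (r : R) :
    MF.tr (MonoidAlgebra.single w r : MF R A) = MonoidAlgebra.single w.tr r :=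
  MonoidAlgebra.mapDomain_single

theorem MF.tr_mul (α β : MF R A) : (α * β).tr = β.tr * α.tr := by
  induction α using MonoidAlgebra.induction_linear with
  | zero => simp
  | add x y hx hy => rw [add_mul, MF.tr_add, MF.tr_add, mul_add, hx, hy]
  | single u r =>
    induction β using MonoidAlgebra.induction_linear with
    | zero => simp
    | add x y hx hy => rw [mul_add, MF.tr_add, MF.tr_add, add_mul, hx, hy]
    | single v s =>
      rw [MonoidAlgebra.single_mul_single, MF.tr_single, MF.tr_single, MF.tr_single,
        MonoidAlgebra.single_mul_single, Word.tr_mul, mul_comm r s]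

theorem MF.tr_tr (α : MF R A) : α.tr.tr = α := by
  induction α using MonoidAlgebra.induction_linear with
  | zero => simp
  | add x y hx hy => rw [MF.tr_add, MF.tr_add, hx, hy]
  | single u r => rw [MF.tr_single, MF.tr_single, Word.tr_tr]

theorem MF.tr_pw (α : MF R A) (k : ℕ) : (pw α k).tr = pw α.tr k := by
  induction k with
  | zero => rfl
  | succ k ih => rw [pw, MF.tr_mul, ih, ← pw_comm, pw]

theorem word_tr_equiv (w : Word A) : w.tr ≈ w := Or.inr (List.IsRotated.refl _)

theorem trM_tr (α : MF R A) : trM α.tr = trM α := by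
  induction α using MonoidAlgebra.induction_linear with
  | zero => simp
  | add x y hx hy => rw [MF.tr_add, map_add, map_add, hx, hy]
  | single u r => rw [MF.tr_single, trM_single, trM_single, sigmaWord_congr (word_tr_equiv u)]

theorem pw_sum_single {B : Type*} [Fintype B] (e : B → Word A) (a : B → R) (k : ℕ) :
    pw (∑ b, MonoidAlgebra.single (e b) (a b) : MF R A) k =
      ∑ ω : Fin (k + 1) → B, MonoidAlgebra.single (FreeSemigroup.lift e (wordOfFn ω))
        ((wordList (wordOfFn ω)).map a).prod := by
  induction k with
  | zero =>
    refine Fintype.sum_equiv (Equiv.funUnique (Fin 1) B).symm _ _ fun b => ?_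
    simp [wordOfFn, wordList]
    rfl
  | succ k ih =>
    rw [pw, ih, Finset.sum_mul_sum, ← Finset.sum_product']
    refine Fintype.sum_equiv (Fin.consEquiv fun _ => B) _ _ fun x => ?_
    show _ = MonoidAlgebra.single (FreeSemigroup.lift e (wordOfFn (Fin.cons x.1 x.2))) _
    rw [MonoidAlgebra.single_mul_single]
    show _ = MonoidAlgebra.single (FreeSemigroup.lift e (wordOfFn (Fin.cons x.1 x.2)))
      ((wordList (wordOfFn (Fin.cons x.1 x.2 : Fin (k + 2) → B))).map a).prod
    rw [wordOfFn_cons, map_mul, FreeSemigroup.lift_of, wordList_mul]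
    simp

/-- The right-hand side of Amitsur's formula for a linear combination of words `e b`. -/
noncomputable def amitsur {B : Type*} [Finite B] (e : B → Word A) (a : B → R) (t : ℕ) :
    NSigma R A :=
  ∑ j ∈ (finite_amitsur B t).toFinset, (-1) ^ (t + j.sum fun _ k => k) *
    j.prod fun c k => C (((wordList c.rep).map a).prod ^ k) *
      sigmaWord R k (FreeSemigroup.lift e c.rep)

/-- Amitsur's sum is an Euler product over primitive cycles in the summands. A cycle of length `ℓ`
contains `ℓ` words (`card_primCycle`), which absorbs the factor `deg c` of `Newton.euler`. The power
sums thus run over all words in the summands, as does the expanded power of the linear combination.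
-/
theorem newton_amitsur {B : Type*} [Fintype B] (e : B → Word A) (a : B → R) :
    Newton (amitsur e a) (fun i => trM (pw (∑ b, MonoidAlgebra.single (e b) (a b)) i)) := by
  have h := Newton.euler (K := NSigma R A) (fun c : PrimCycle B => (PrimCycle.rep c).length)
    (fun c => Nat.succ_pos _) (finite_amitsur B) finite_dvd_primCycle
    (fun c => (newton_sigmaWord (R := R) (FreeSemigroup.lift e (PrimCycle.rep c))).scale
      (C ((wordList (PrimCycle.rep c)).map a).prod))
  have h1 : amitsur e a = _ := rfl
  convert h using 1
  · funext t
    simp only [amitsur, C_pow]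
  · funext k
    rw [pw_sum_single, map_sum]
    have h2 := sum_words_eq (B := B) (K := NSigma R A)
      (fun u => (Quotient.mk _ u : PrimCycle B)) (fun c => (PrimCycle.rep c).length)
      (fun u => (PrimCycle.rep_isRotated u).perm.length_eq) k (finite_dvd_primCycle k)
      (fun c i => C (((wordList (PrimCycle.rep c)).map a).prod) ^ (i + 1) *
        sigmaWord R 1 (pw (FreeSemigroup.lift e (PrimCycle.rep c)) i))
    simp only [card_primCycle] at h2
    rw [← h2]
    refine Finset.sum_congr rfl fun ω _ => ?_
    rw [trM_single]
    set w := wordOfFn ω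
    have hrot : wordList (pw (PrimCycle.rep (Quotient.mk _ (root w) : PrimCycle B)) (rootExp w - 1))
        ~r wordList w := by
      conv_rhs => rw [eq_pw_root w]
      rw [wordList_pw, wordList_pw]
      exact IsRotated_lpow (PrimCycle.rep_isRotated (root w)) _
    rw [← map_pw, ← lift_prod_eq a hrot, wordList_pw, ← C_pow]
    congr 1
    · congr 1
      generalize rootExp w - 1 + 1 = m
      induction m with
      | zero => simp
      | succ m ih => rw [lpow_succ, List.map_append, List.prod_append, ih, pow_succ']
    · refine sigmaWord_congr (Or.inl ?_) 1
      rw [wordList_lift, wordList_lift]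
      exact isRotated_flatMap hrot.symm _

/-- This replaces the explicit formula defining `sigma` from here on: over a domain of
characteristic zero the traces of powers determine every `σ_t(α)`. -/
theorem newton_sigma (α : MF R A) : Newton (fun t => sigma t α) (fun i => trM (pw α i)) := by
  have h := newton_amitsur (R := R) (fun w : {w // w ∈ α.coeff.support} => w.1)
    (fun w => α.coeff w.1)
  have h1 : (∑ b : {w // w ∈ α.coeff.support}, MonoidAlgebra.single b.1 (α.coeff b.1)) = α := by
    conv_rhs => rw [← MonoidAlgebra.sum_coeff_single α]
    rw [Finsupp.sum, Finset.univ_eq_attach, Finset.sum_attach α.coeff.support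
      (fun w => MonoidAlgebra.single w (α.coeff w))]
  rw [h1] at h
  exact h

theorem sigma_zero (α : MF R A) : sigma 0 α = 1 := (newton_sigma α).1

theorem sigma_one (α : MF R A) : sigma 1 α = trM α := by
  have := (newton_sigma α).2 0
  simpa [sigma_zero, pw] using this

end Trace

end MatInv

namespace MatInv
open MvPolynomial Function

/-! ### Change of scalars and reduction to characteristic zero. -/

section Naturality
variable {R A : Type*} [CommRing R]

theorem map_amitsur {R' B : Type*} [CommRing R'] [Finite B] (φ : R →+* R') (e : B → Word A)
    (a : B → R) (t : ℕ) :
    MvPolynomial.map φ (amitsur e a t) = amitsur e (fun b => φ (a b)) t := by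
  rw [amitsur, amitsur, map_sum]
  refine Finset.sum_congr rfl fun j _ => ?_
  rw [map_mul, Finsupp.prod, Finsupp.prod, map_prod]
  congr 1
  · simp
  · refine Finset.prod_congr rfl fun c _ => ?_
    rw [map_mul, map_C, map_sigmaWord, map_pow, map_list_prod, List.map_map]
    rfl

theorem amitsur_eq_sigma_of_domain {B : Type*} [Fintype B] [IsDomain R] [CharZero R]
    (e : B → Word A) (a : B → R) (t : ℕ) :
    amitsur e a t = sigma t (∑ b, MonoidAlgebra.single (e b) (a b)) :=
  congrFun ((newton_amitsur e a).s_eq (newton_sigma _)) t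

theorem sigma_eq_amitsur (t : ℕ) (α : MF R A) :
    sigma t α = amitsur (fun w : {w // w ∈ α.coeff.support} => w.1) (fun w => α.coeff w.1) t := rfl

/-- Needed because the index type of Amitsur's sum depends on the finite set. -/
theorem amitsur_finset_congr {S T : Finset (Word A)} (h : S = T) {a b : Word A → R}
    (hab : ∀ w ∈ S, a w = b w) (t : ℕ) :
    amitsur (fun w : {w // w ∈ S} => w.1) (fun w => a w.1) t =
      amitsur (fun w : {w // w ∈ T} => w.1) (fun w => b w.1) t := by
  subst h
  congr 1
  exact funext fun w => hab w.1 w.2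

theorem coeff_sum_single (S : Finset (Word A)) (a : Word A → R) (w : Word A) [Decidable (w ∈ S)] :
    (∑ v ∈ S, MonoidAlgebra.single v (a v) : MF R A).coeff w = if w ∈ S then a w else 0 := by
  classical
  rw [MonoidAlgebra.coeff_sum, Finsupp.finsetSum_apply]
  simp [Finsupp.single_apply]

/-- The canonical surjection from a polynomial ring over `ℤ` to `R`. -/
noncomputable def cover (R : Type*) [CommRing R] : MvPolynomial R ℤ →+* R :=
  eval₂Hom (Int.castRingHom R) id

theorem cover_surjective : Surjective (cover R) := fun r => ⟨X r, by simp [cover]⟩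

/-- Summands with coefficient zero may be included in Amitsur's formula. In a domain of
characteristic zero this holds because both sides have the same power sums; the general case is its
image under `cover`. -/
theorem amitsur_finset (S : Finset (Word A)) (a : Word A → R) (t : ℕ) :
    amitsur (fun w : {w // w ∈ S} => w.1) (fun w => a w.1) t =
      sigma t (∑ w ∈ S, MonoidAlgebra.single w (a w)) := by
  classical
  -- A section of `cover` under which exactly zero lifts to zero, so that the lifted combination has
  -- the same support.
  set s : R → MvPolynomial R ℤ := fun r => if r = 0 then 0 else X r with hs
  have hs0 : ∀ r, s r = 0 ↔ r = 0 := by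
    intro r
    simp only [hs]
    split_ifs with h
    · simp [h]
    · simp [h, X_ne_zero]
  have hφ : ∀ r, cover R (s r) = r := by
    intro r
    simp only [hs]
    split_ifs with h
    · simp [h]
    · simp [cover]
  have h1 := amitsur_eq_sigma_of_domain (fun w : {w // w ∈ S} => w.1) (fun w => s (a w.1)) t
  have h2 := congrArg (MvPolynomial.map (cover R)) h1
  rw [map_amitsur, sigma_eq_amitsur, map_amitsur] at h2
  simp only [hφ] at h2
  have h3 : (∑ b : {w // w ∈ S}, MonoidAlgebra.single b.1 (s (a b.1)) : MF (MvPolynomial R ℤ) A) =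
      ∑ w ∈ S, MonoidAlgebra.single w (s (a w)) := by
    rw [Finset.univ_eq_attach, Finset.sum_attach S fun w => MonoidAlgebra.single w (s (a w))]
  rw [h2, sigma_eq_amitsur, h3]
  refine amitsur_finset_congr (a := fun w => cover R (MonoidAlgebra.coeff
    (∑ w ∈ S, MonoidAlgebra.single w (s (a w))) w))
    (b := fun w => (MonoidAlgebra.coeff (∑ w ∈ S, MonoidAlgebra.single w (a w)) w)) ?_ ?_ t
  · ext w
    rw [Finsupp.mem_support_iff, Finsupp.mem_support_iff, coeff_sum_single, coeff_sum_single]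
    split_ifs
    · simp [hs0]
    · simp
  · intro w _
    rw [coeff_sum_single, coeff_sum_single]
    split_ifs
    · rw [hφ]
    · simp

/-- The support may shrink under `φ`; `amitsur_finset` lets the sum run over the old support. -/
theorem map_sigma {R' : Type*} [CommRing R'] (φ : R →+* R') (t : ℕ) (α : MF R A) :
    MvPolynomial.map φ (sigma t α) = sigma t (MonoidAlgebra.map (φ : R →+ R') α : MF R' A) := by
  classical
  rw [sigma_eq_amitsur, map_amitsur]
  refine (amitsur_finset α.coeff.support (fun w => φ (α.coeff w)) t).trans ?_
  congr 1
  apply MonoidAlgebra.coeff_injective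
  ext w
  rw [coeff_sum_single]
  have : (MonoidAlgebra.map (φ : R →+ R') α : MF R' A).coeff w = φ (α.coeff w) := rfl
  rw [this]
  split_ifs with h
  · rfl
  · rw [Finsupp.notMem_support_iff.mp h, map_zero]

theorem exists_lift (α : MF R A) : ∃ α' : MF (MvPolynomial R ℤ) A,
    MonoidAlgebra.map (cover R : MvPolynomial R ℤ →+ R) α' = α :=
  MonoidAlgebra.map_surjective _ cover_surjective α

/-- After lifting to coefficients in a polynomial ring over `ℤ`, it is enough that the powers of
`αβ` and `βα` have equal traces. -/
theorem sigma_mul_comm (t : ℕ) (α β : MF R A) : sigma t (α * β) = sigma t (β * α) := by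
  obtain ⟨α, rfl⟩ := exists_lift α
  obtain ⟨β, rfl⟩ := exists_lift β
  rw [← MonoidAlgebra.map_mul, ← MonoidAlgebra.map_mul, ← map_sigma, ← map_sigma]
  congr 1
  have h := newton_sigma (α * β)
  have h2 : (fun i => trM (pw (α * β) i)) = fun i => trM (pw (β * α) i) := by
    funext i
    rcases i with _ | i
    · exact trM_mul_comm _ _
    · rw [pw_mul_mul, trM_mul_comm, mul_assoc, ← pw_comm, pw]
  rw [h2] at h
  exact congrFun (h.s_eq (newton_sigma _)) t

theorem MF.tr_map {R' : Type*} [CommRing R'] (φ : R →+* R') (α : MF R A) :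
    MF.tr (MonoidAlgebra.map (φ : R →+ R') α : MF R' A) =
      MonoidAlgebra.map (φ : R →+ R') (MF.tr α) := by
  induction α using MonoidAlgebra.induction_linear with
  | zero => simp [MonoidAlgebra.map_zero]
  | add x y hx hy =>
    rw [MonoidAlgebra.map_add, MF.tr_add, MF.tr_add, MonoidAlgebra.map_add, hx, hy]
  | single u r => rw [MonoidAlgebra.map_single, MF.tr_single, MF.tr_single, MonoidAlgebra.map_single]

theorem sigma_tr (t : ℕ) (α : MF R A) : sigma t α.tr = sigma t α := by
  obtain ⟨α, rfl⟩ := exists_lift α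
  rw [MF.tr_map, ← map_sigma, ← map_sigma]
  congr 1
  have h := newton_sigma α.tr
  simp only [← MF.tr_pw, trM_tr] at h
  exact congrFun (h.s_eq (newton_sigma _)) t

theorem pw_single (w : Word A) (i : ℕ) :
    pw (MonoidAlgebra.single w 1 : MF R A) i = MonoidAlgebra.single (pw w i) 1 := by
  induction i with
  | zero => rfl
  | succ i ih => rw [pw, ih, MonoidAlgebra.single_mul_single, one_mul, pw]

theorem sigma_ofWord (t : ℕ) (w : Word A) : sigma t (ofWord R w) = sigmaWord R t w := by
  have h : sigma t (ofWord ℤ w) = sigmaWord ℤ t w := by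
    have h := newton_sigma (ofWord ℤ w)
    simp only [ofWord, pw_single, trM_single, map_one, one_mul] at h
    exact congrFun (h.s_eq (newton_sigmaWord w)) t
  have h2 := congrArg (MvPolynomial.map (Int.castRingHom R)) h
  rw [map_sigma, map_sigmaWord] at h2
  rw [← h2]
  congr 1
  simp [ofWord, MonoidAlgebra.map_single]

end Naturality

/-! ### Substitutions in `N_σ`. -/

section Substitution
variable {R A B : Type*} [CommRing R]

theorem substWord_mul (g : A → MF R B) (u v : Word A) :
    substWord g (u * v) = substWord g u * substWord g v := map_mul _ _ _

theorem substWord_of (g : A → MF R B) (a : Letter A) :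
    substWord g (FreeSemigroup.of a) = if a.2 then (g a.1).tr else g a.1 := rfl

theorem substWord_pw (g : A → MF R B) (u : Word A) (i : ℕ) :
    substWord g (pw u i) = pw (substWord g u) i := map_pw (FreeSemigroup.lift _) u i

theorem substWord_tr (g : A → MF R B) (w : Word A) :
    substWord g w.tr = (substWord g w).tr := by
  induction w using FreeSemigroup.recOnMul with
  | ih1 a =>
    have : Word.tr (FreeSemigroup.of a) = FreeSemigroup.of a.tr := wordList_injective rfl
    rw [this, substWord_of, substWord_of]
    obtain ⟨a, s⟩ := a
    cases s <;> simp [Letter.tr, MF.tr_tr]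
  | ih2 a w ha hw => rw [Word.tr_mul, substWord_mul, substWord_mul, MF.tr_mul, ha, hw]

theorem eq_or_eq_mul_of_isRotated {v w : FreeSemigroup B} (h : wordList v ~r wordList w) :
    v = w ∨ ∃ a b, v = a * b ∧ w = b * a := by
  obtain ⟨n, hn⟩ := h
  rw [List.rotate_eq_drop_append_take_mod] at hn
  have hlt : n % (wordList v).length < (wordList v).length :=
    Nat.mod_lt _ (List.length_pos_of_ne_nil (wordList_ne_nil v))
  generalize n % (wordList v).length = m at hn hlt
  rcases Nat.eq_zero_or_pos m with rfl | hm
  · left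
    apply wordList_injective
    simpa using hn
  · right
    obtain ⟨a, ha⟩ := exists_wordList_eq (l := (wordList v).take m) (by
      intro h0
      have := congrArg List.length h0
      rw [List.length_take, List.length_nil] at this
      omega)
    obtain ⟨b, hb⟩ := exists_wordList_eq (l := (wordList v).drop m) (by
      intro h0
      have := congrArg List.length h0
      rw [List.length_drop, List.length_nil] at this
      omega)
    refine ⟨a, b, wordList_injective ?_, wordList_injective ?_⟩
    · rw [wordList_mul, ha, hb, List.take_append_drop]
    · rw [wordList_mul, ha, hb, hn]

theorem sigma_substWord_congr (g : A → MF R B) {v w : Word A} (h : v ≈ w) (t : ℕ) :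
    sigma t (substWord g v) = sigma t (substWord g w) := by
  have key : ∀ {v w : Word A}, wordList v ~r wordList w →
      sigma t (substWord g v) = sigma t (substWord g w) := by
    intro v w h
    rcases eq_or_eq_mul_of_isRotated h with rfl | ⟨a, b, rfl, rfl⟩
    · rfl
    · rw [substWord_mul, substWord_mul, sigma_mul_comm]
  rcases h with h | h
  · exact key h
  · rw [key h, substWord_tr, sigma_tr]

/-- `subst` is defined through a chosen representative of the class; invariance of `sigma` under
rotation and transposition permits any other one. -/
theorem subst_gen (g : A → MF R B) (t : ℕ) (u : PrimWord (Letter A)) :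
    subst g (gen R t (Quotient.mk _ u)) = sigma t (substWord g u.1) := by
  rw [← sigma_substWord_congr g (PrimClass.rep_mk_equiv u)]
  unfold gen
  split_ifs with h
  · rw [subst, aeval_X]; rfl
  · obtain rfl : t = 0 := by omega
    rw [map_one, sigma_zero]

/-- On the symbols of the root, `subst` gives the `σ_k` of the substituted root. Traces of powers
are determined by these over any ring, so no lift to characteristic zero is needed. -/
theorem subst_sigmaWord_one (g : A → MF R B) (w : Word A) :
    subst g (sigmaWord R 1 w) = sigma 1 (substWord g w) := by
  have h1 := (newton_newtonP (s := fun k => gen R k (Quotient.mk _ (root w))) (gen_zero _)).map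
    (subst g)
  have h2 := newton_sigma (substWord g (root w).1)
  simp only [subst_gen] at h1
  have h4 := congrFun (h1.p_eq h2) (rootExp w - 1)
  rw [sigmaWord_one_eq_newtonP, sigma_one]
  conv_rhs => rw [eq_pw_root w, substWord_pw]
  exact h4

/-- The map of letters induced by `δ : A → B`. -/
def letterMap (δ : A → B) (a : Letter A) : Letter B := (δ a.1, a.2)

theorem letterMap_tr (δ : A → B) (a : Letter A) : letterMap δ a.tr = (letterMap δ a).tr := rfl

theorem letterMap_injective {δ : A → B} (h : Injective δ) : Injective (letterMap δ) := by
  rintro ⟨a, s⟩ ⟨b, s'⟩ hab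
  simp only [letterMap, Prod.mk.injEq] at hab
  rw [h hab.1, hab.2]

theorem substWord_ofWord (δ : A → B) (w : Word A) :
    substWord (fun a => ofWord R (FreeSemigroup.of (δ a, false))) w =
      ofWord R (FreeSemigroup.map (letterMap δ) w) := by
  induction w using FreeSemigroup.recOnMul with
  | ih1 a =>
    obtain ⟨a, s⟩ := a
    rw [substWord_of, FreeSemigroup.map_of]
    cases s
    · rfl
    · simp only [ofWord, if_true, MF.tr_single]
      rfl
  | ih2 a w ha hw =>
    rw [substWord_mul, ha, hw, map_mul, ofWord, ofWord, MonoidAlgebra.single_mul_single, one_mul,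
      ofWord]

theorem substWord_map {A' : Type*} (h : B → MF R A') (δ : A → B) (w : Word A) :
    substWord h (FreeSemigroup.map (letterMap δ) w) = substWord (fun a => h (δ a)) w := by
  induction w using FreeSemigroup.recOnMul with
  | ih1 a => rfl
  | ih2 a w ha hw => rw [map_mul, substWord_mul, substWord_mul, ha, hw]

theorem subst_C (g : A → MF R B) (a : R) : subst g (C a) = C a := (subst g).commutes a

theorem X_eq_gen (t : ℕ+) (c : PrimClass A) : (X (t, c) : NSigma R A) = gen R t c := by
  unfold gen
  split_ifs with h
  · rfl
  · exact absurd t.pos h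

/-- An injective renaming of letters keeps primitive words primitive, so it sends symbols to symbols
and composition can be checked on generators. -/
theorem subst_map_subst_letters {R' A' : Type*} [CommRing R'] (φ : R →+* R') (h : B → MF R' A')
    {δ : A → B} (hδ : Injective δ) (p : NSigma R A) :
    subst h (MvPolynomial.map φ
      (subst (fun a => ofWord R (FreeSemigroup.of (δ a, false))) p)) =
      subst (fun a => h (δ a)) (MvPolynomial.map φ p) := by
  induction p using MvPolynomial.induction_on with
  | C r =>
    rw [subst_C, map_C, subst_C, map_C, subst_C]
  | add p q hp hq => simp only [map_add, hp, hq]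
  | mul_X p i hp =>
    simp only [map_mul, hp]
    congr 1
    obtain ⟨t, c⟩ := i
    obtain ⟨u, rfl⟩ := Quotient.exists_rep c
    have hprim : IsPrimitive (FreeSemigroup.map (letterMap δ) u.1) := by
      rw [isPrimitive_iff, wordList_map]
      exact (isPrimitive_iff.mp u.2).map (letterMap_injective hδ)
    rw [map_X, X_eq_gen, X_eq_gen, subst_gen, subst_gen, substWord_ofWord, sigma_ofWord,
      sigmaWord_prim t ⟨_, hprim⟩, map_gen, subst_gen, substWord_map]

end Substitution

/-! ### Signed sums of traces for letter substitutions. -/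

section TraceSums
variable {R : Type*} [CommRing R] {t r : ℕ}

open Classical in
/-- The sum `∑ sign(π) f(tr*(π))` for a substitution `f` of letters for letters. -/
noncomputable def trSum (R : Type*) [CommRing R] {t r : ℕ} {B : Type*} (δ : Arr t r → B) :
    NSigma R B :=
  ∑ π : Equiv.Perm (Row t r), ((Equiv.Perm.sign π : ℤˣ) : ℤ) •
    ∏ c ∈ Finset.univ.image (fun a => (Quotient.mk _ (cycleWord π a) : WordClass (Arr t r))),
      sigmaWord R 1 (FreeSemigroup.map (letterMap δ) (Quotient.out c))

theorem subst_map_trSum {R' A B : Type*} [CommRing R'] (φ : R →+* R') (h : B → MF R' A)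
    (x y z : B) :
    subst h (MvPolynomial.map φ (trSum R (Sum.elim (fun _ => x)
      (Sum.elim (fun _ => y) (fun _ => z)) : Arr t r → B))) = trStarSum t r (h x) (h y) (h z) := by
  have hf : (Sum.elim (fun _ => h x) (Sum.elim (fun _ => h y) (fun _ => h z)) :
      Arr t r → MF R' A) = fun a => h ((Sum.elim (fun _ => x)
        (Sum.elim (fun _ => y) (fun _ => z)) : Arr t r → B) a) := by
    funext a
    rcases a with a | a | a <;> rfl
  rw [trStarSum, trSum, hf]
  simp only [map_sum, map_zsmul, map_prod, map_sigmaWord, subst_sigmaWord_one, substWord_map]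
  refine Finset.sum_congr rfl fun π _ => ?_
  rw [trStar, map_prod]
  simp only [subst_sigmaWord_one]

end TraceSums

end MatInv

namespace MatInv
open MvPolynomial Function

/-! ### Closed paths of the quiver. -/

section ClosedPaths

theorem qTail_tr (b : Letter (Fin 3)) : qTail b.tr = !qHead b := by
  obtain ⟨a, s⟩ := b
  fin_cases a <;> cases s <;> rfl

theorem qHead_tr (b : Letter (Fin 3)) : qHead b.tr = !qTail b := by
  obtain ⟨a, s⟩ := b
  fin_cases a <;> cases s <;> rfl

/-- `l` is a cyclic path of `Q`. -/
def ClosedList (l : List (Letter (Fin 3))) : Prop := l.map qTail = (l.map qHead).rotate 1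

theorem cycle_chain_iff (l : List (Letter (Fin 3))) :
    Cycle.Chain (fun a b => qTail a = qHead b) (l : Cycle (Letter (Fin 3))) ↔ ClosedList l := by
  rcases l with _ | ⟨a, l⟩
  · simp [ClosedList]
  · rw [Cycle.chain_coe_cons, ← List.cons_append, List.isChain_cons_append_singleton_iff_forall₂,
      ClosedList]
    have h : ((a :: l).map qHead).rotate 1 = (l ++ [a]).map qHead := by simp
    rw [h]
    have h2 : ∀ l l' : List (Letter (Fin 3)),
        List.Forall₂ (fun a b => qTail a = qHead b) l l' ↔ l.map qTail = l'.map qHead := by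
      intro l l'
      rw [← List.forall₂_eq_eq_eq, List.forall₂_map_left_iff, List.forall₂_map_right_iff]
    exact h2 _ _

theorem isClosedPath_iff (w : Word (Fin 3)) : IsClosedPath w ↔ ClosedList (wordList w) :=
  cycle_chain_iff _

theorem closedList_rotate {l : List (Letter (Fin 3))} (h : ClosedList l) (n : ℕ) :
    ClosedList (l.rotate n) := by
  rw [ClosedList, List.map_rotate, List.map_rotate, List.rotate_rotate, Nat.add_comm,
    ← List.rotate_rotate, ← h]

theorem ClosedList.isRotated {l m : List (Letter (Fin 3))} (h : l ~r m) (hl : ClosedList l) :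
    ClosedList m := by
  obtain ⟨n, rfl⟩ := h
  exact closedList_rotate hl n

theorem ClosedList.tr {l : List (Letter (Fin 3))} (h : ClosedList l) : ClosedList (listTr l) := by
  have e1 : (listTr l).map qTail = ((l.map qHead).map not).reverse := by
    simp only [listTr, List.map_reverse, List.map_map]
    congr 2
    exact funext qTail_tr
  have e2 : (listTr l).map qHead = ((l.map qTail).map not).reverse := by
    simp only [listTr, List.map_reverse, List.map_map]
    congr 2
    exact funext qHead_tr
  rw [ClosedList, e1, e2, h, List.map_rotate]
  generalize (l.map qHead).map not = m
  rcases m with _ | ⟨a, m⟩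
  · simp
  · simp

theorem ClosedList.lpow_iff (l : List (Letter (Fin 3))) (k : ℕ) (hk : 0 < k) :
    ClosedList (lpow l k) ↔ ClosedList l := by
  rw [ClosedList, ClosedList, map_lpow, map_lpow, rotate_lpow]
  exact ⟨fun h => lpow_inj_base hk (by simp) h, fun h => by rw [h]⟩

theorem isClosedPath_congr {v w : Word (Fin 3)} (h : v ≈ w) : IsClosedPath v ↔ IsClosedPath w := by
  have key : ∀ {v w : Word (Fin 3)}, v ≈ w → IsClosedPath v → IsClosedPath w := by
    intro v w h hv
    rw [isClosedPath_iff] at *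
    rcases h with h | h
    · exact hv.isRotated h
    · have := (hv.isRotated h).tr
      rwa [wordList_tr, listTr_listTr] at this
  exact ⟨key h, key (Setoid.symm h)⟩

/-- Transposition swaps the two vertices besides head and tail, so in `Q` a letter can never be
preceded by its own transpose. -/
theorem ClosedList.not_isRotated_listTr {l : List (Letter (Fin 3))} (hne : l ≠ [])
    (h : ClosedList l) : ¬ l ~r listTr l := by
  refine MatInv.not_isRotated_listTr hne fun i hi he => ?_
  have h1 : (l.map qTail)[i]'(by simp; omega) = ((l.map qHead).rotate 1)[i]'(by simp; omega) := by
    congr 1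
  rw [List.getElem_map, List.getElem_rotate, List.getElem_map, he, qTail_tr] at h1
  simp only [List.length_map, Nat.mod_eq_of_lt hi] at h1
  cases hb : qHead l[i + 1] <;> simp [hb] at h1

/-- The sign of a letter in `σ_{t,r}`: only `y` and `z` count. -/
def eps (b : Letter (Fin 3)) : ℤ := if b = (1, false) ∨ b = (2, false) then -1 else 1

theorem eps_mul_tr (b : Letter (Fin 3)) :
    eps b.tr * eps b = (if qTail b then -1 else 1) * (if qHead b then -1 else 1) := by
  obtain ⟨a, s⟩ := b
  fin_cases a <;> cases s <;> decide

/-- By `eps_mul_tr` the quotient of the two signs is a product over all tails and heads. Around a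
closed path these are the same vertices with the same multiplicities. Hence the sign of a class does
not depend on the representative. -/
theorem ClosedList.prod_eps_listTr {l : List (Letter (Fin 3))} (h : ClosedList l) :
    ((listTr l).map eps).prod = (l.map eps).prod := by
  have hsq : (l.map eps).prod * (l.map eps).prod = 1 := by
    rw [← List.prod_map_mul]
    refine List.prod_eq_one fun x hx => ?_
    obtain ⟨b, -, rfl⟩ := List.mem_map.mp hx
    unfold eps
    split_ifs <;> rfl
  have h1 : ((listTr l).map eps).prod * (l.map eps).prod = 1 := by
    have e1 : ((listTr l).map eps).prod = (l.map fun b => eps b.tr).prod := by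
      rw [listTr, List.map_reverse, List.prod_reverse, List.map_map]; rfl
    rw [e1, ← List.prod_map_mul]
    simp only [eps_mul_tr]
    rw [List.prod_map_mul]
    have e2 : (l.map fun b => if qTail b then (-1 : ℤ) else 1).prod =
        (l.map fun b => if qHead b then (-1 : ℤ) else 1).prod := by
      have e3 := congrArg (fun m => (m.map fun s : Bool => if s then (-1 : ℤ) else 1).prod) h
      simp only [List.map_map] at e3
      refine e3.trans ?_
      have e4 := ((List.rotate_perm (l.map qHead) 1).map
        (fun s : Bool => if s then (-1 : ℤ) else 1)).prod_eq
      rw [e4, List.map_map]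
      rfl
    rw [e2, ← List.prod_map_mul]
    refine List.prod_eq_one fun x hx => ?_
    obtain ⟨b, -, rfl⟩ := List.mem_map.mp hx
    split_ifs <;> rfl
  calc ((listTr l).map eps).prod = ((listTr l).map eps).prod * ((l.map eps).prod *
        (l.map eps).prod) := by rw [hsq, mul_one]
    _ = (l.map eps).prod := by rw [← mul_assoc, h1, one_mul]

theorem finite_primCycle_fiber {B : Type*} (c : PrimCycle B) :
    Finite {u : PrimWord B // (Quotient.mk _ u : PrimCycle B) = c} := by
  apply Nat.finite_of_card_ne_zero
  rw [card_primCycle]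
  exact Nat.succ_ne_zero _

/-- The class is the union of the rotations of the representative and those of its transpose, and
these are disjoint because the path is closed. -/
theorem card_primClass_of_closed (c : PrimClass (Fin 3)) (hc : IsClosedPath c.rep) :
    Nat.card {u : PrimWord (Letter (Fin 3)) // (Quotient.mk _ u : PrimClass (Fin 3)) = c} =
      2 * c.rep.length := by
  have hp : IsPrimitive c.rep := (Quotient.out c).2
  set u₁ : PrimWord (Letter (Fin 3)) := ⟨c.rep, hp⟩
  set u₂ : PrimWord (Letter (Fin 3)) := ⟨Word.tr c.rep, hp.tr⟩
  have hcyc : ∀ u v : PrimWord (Letter (Fin 3)), (Quotient.mk _ u : PrimCycle _) = Quotient.mk _ v ↔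
      wordList u.1 ~r wordList v.1 := fun u v => Quotient.eq
  have hmem : ∀ u : PrimWord (Letter (Fin 3)), (Quotient.mk _ u : PrimClass (Fin 3)) = c ↔
      ((Quotient.mk _ u : PrimCycle _) = Quotient.mk _ u₁ ∨
        (Quotient.mk _ u : PrimCycle _) = Quotient.mk _ u₂) := by
    intro u
    rw [hcyc, hcyc]
    conv_lhs => rw [← Quotient.out_eq c]
    rw [Quotient.eq]
    rfl
  have hdisj : Disjoint (fun u : PrimWord (Letter (Fin 3)) =>
      (Quotient.mk _ u : PrimCycle _) = Quotient.mk _ u₁)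
      (fun u => (Quotient.mk _ u : PrimCycle _) = Quotient.mk _ u₂) := by
    rw [Pi.disjoint_iff]
    intro u
    rw [Prop.disjoint_iff]
    by_contra h
    have h3 := (hcyc _ _).mp (h.1.symm.trans h.2)
    rw [wordList_tr] at h3
    exact ((isClosedPath_iff _).mp hc).not_isRotated_listTr (wordList_ne_nil _) h3
  classical
  have := finite_primCycle_fiber (Quotient.mk _ u₁ : PrimCycle (Letter (Fin 3)))
  have := finite_primCycle_fiber (Quotient.mk _ u₂ : PrimCycle (Letter (Fin 3)))
  rw [Nat.card_congr (Equiv.subtypeEquivRight hmem), Nat.card_congr (subtypeOrEquiv _ _ hdisj),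
    Nat.card_sum, card_primCycle, card_primCycle]
  have e1 := (PrimCycle.rep_isRotated u₁).perm.length_eq
  have e2 := (PrimCycle.rep_isRotated u₂).perm.length_eq
  rw [wordList_length] at e1 e2
  rw [e1, e2, wordList_tr, length_listTr]
  exact (two_mul _).symm

end ClosedPaths

/-! ### Weighted half-traces of cyclic words. -/

section CyclicTrace
variable {R A : Type*} [CommRing R]

/-- `tr` of a list of letters, `0` for the empty list. -/
noncomputable def trList (R : Type*) [CommRing R] {A : Type*} : List (Letter A) → NSigma R A
  | [] => 0
  | a :: l => sigmaWord R 1 ⟨a, l⟩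

/-- `tr` of a cyclic word. -/
noncomputable def trCycle (R : Type*) [CommRing R] {A : Type*} (c : Cycle (Letter A)) :
    NSigma R A :=
  Quotient.lift (trList R) (by
    intro l m h
    rcases l with _ | ⟨a, l⟩
    · rw [List.isRotated_nil_iff'.mp h]
    · rcases m with _ | ⟨b, m⟩
      · exact absurd (List.isRotated_nil_iff.mp h) (List.cons_ne_nil _ _)
      · exact sigmaWord_congr (v := ⟨a, l⟩) (w := ⟨b, m⟩) (Or.inl h) 1) c

theorem trCycle_wordList (w : Word A) :
    trCycle R (wordList w : Cycle (Letter A)) = sigmaWord R 1 w := rfl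

open Classical in
/-- Half of the trace of a closed path, `0` for other cyclic words. -/
noncomputable def halfTr (c : Cycle (Letter (Fin 3))) : NSigma ℚ (Fin 3) :=
  if Cycle.Chain (fun a b => qTail a = qHead b) c then C (1 / 2) * trCycle ℚ c else 0

open Classical in
theorem halfTr_wordList (w : Word (Fin 3)) : halfTr (wordList w : Cycle (Letter (Fin 3))) =
    if IsClosedPath w then C (1 / 2) * sigmaWord ℚ 1 w else 0 := rfl

/-- The factor of a letter that records its sign and its degree. -/
noncomputable def wt (b : Letter (Fin 3)) : MvPolynomial (Fin 3) (NSigma ℚ (Fin 3)) :=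
  monomial (Finsupp.single b.1 1) ((eps b : ℤ) : NSigma ℚ (Fin 3))

theorem prod_wt (l : List (Letter (Fin 3))) : (l.map wt).prod =
    monomial ((l.map fun b => Finsupp.single b.1 1).sum)
      (((l.map eps).prod : ℤ) : NSigma ℚ (Fin 3)) := by
  induction l with
  | nil => simp
  | cons b l ih =>
    rw [List.map_cons, List.prod_cons, ih, wt, monomial_mul]
    simp

/-- The weight of a cyclic word. -/
noncomputable def cycWt (c : Cycle (Letter (Fin 3))) :
    MvPolynomial (Fin 3) (NSigma ℚ (Fin 3)) :=
  (c.toMultiset.map wt).prod * C (halfTr c)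

theorem ClosedList.prod_wt_listTr {l : List (Letter (Fin 3))} (h : ClosedList l) :
    ((listTr l).map wt).prod = (l.map wt).prod := by
  rw [prod_wt, prod_wt, h.prod_eps_listTr]
  congr 2
  rw [listTr, List.map_reverse, List.sum_reverse, List.map_map]
  rfl

theorem prod_wt_congr {v w : Word (Fin 3)} (h : v ≈ w) (hw : IsClosedPath w) :
    ((wordList v).map wt).prod = ((wordList w).map wt).prod := by
  rcases h with h | h
  · exact lift_prod_eq wt h
  · rw [lift_prod_eq wt h, wordList_tr, ((isClosedPath_iff w).mp hw).prod_wt_listTr]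

theorem prod_map_lpow {B M : Type*} [CommMonoid M] (f : B → M) (l : List B) (k : ℕ) :
    ((lpow l k).map f).prod = (l.map f).prod ^ k := by
  induction k with
  | zero => simp
  | succ k ih => rw [lpow_succ, List.map_append, List.prod_append, ih, pow_succ']

end CyclicTrace

/-! ### The generating function of all `σ_{t,r}`. -/

section GeneratingFunction

theorem finite_dvd_primClass (n : ℕ) : {c : PrimClass (Fin 3) | c.rep.length ∣ n + 1}.Finite := by
  have hS : {l : List (Letter (Fin 3)) | l.length ≤ n + 1}.Finite := List.finite_length_le _ (n + 1)
  refine (hS.preimage (f := fun c : PrimClass (Fin 3) => wordList c.rep)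
    ((wordList_injective.comp PrimClass.rep_injective).injOn)).subset fun c hc => ?_
  exact Nat.le_of_dvd (Nat.succ_pos _) hc

/-- The product of the weights of the letters of a class of closed paths. -/
noncomputable def classWt (c : PrimClass (Fin 3)) : MvPolynomial (Fin 3) (NSigma ℚ (Fin 3)) :=
  ((wordList c.rep).map wt).prod

open Classical in
/-- `σ_k(c)` with its weight; `0` if `c` is not closed. -/
noncomputable def classS (c : PrimClass (Fin 3)) (k : ℕ) :
    MvPolynomial (Fin 3) (NSigma ℚ (Fin 3)) :=
  if IsClosedPath c.rep then classWt c ^ k * C (gen ℚ k c) else if k = 0 then 1 else 0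

open Classical in
/-- `tr(cⁱ⁺¹)` with its weight; `0` if `c` is not closed. -/
noncomputable def classP (c : PrimClass (Fin 3)) (i : ℕ) :
    MvPolynomial (Fin 3) (NSigma ℚ (Fin 3)) :=
  if IsClosedPath c.rep then classWt c ^ (i + 1) * C (sigmaWord ℚ 1 (pw c.rep i)) else 0

theorem newton_class (c : PrimClass (Fin 3)) : Newton (classS c) (classP c) := by
  classical
  by_cases hc : IsClosedPath c.rep
  · have h := ((newton_sigmaWord (R := ℚ) c.rep).map
      (C : _ →+* MvPolynomial (Fin 3) (NSigma ℚ (Fin 3)))).scale (classWt c)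
    have e1 : classS c = fun k => classWt c ^ k * C (sigmaWord ℚ k c.rep) := by
      funext k
      have := sigmaWord_prim (R := ℚ) k (Quotient.out c)
      rw [classS, if_pos hc]
      congr 2
      rw [PrimClass.rep, this]
      congr 1
      exact (Quotient.out_eq c).symm
    have e2 : classP c = fun i => classWt c ^ (i + 1) * C (sigmaWord ℚ 1 (pw c.rep i)) := by
      funext i
      rw [classP, if_pos hc]
    rw [e1, e2]
    exact h
  · refine ⟨by simp [classS, hc], fun k => ?_⟩
    simp [classS, classP, hc]

/-- The sum over all finite sets of classes of closed paths with multiplicities. -/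
noncomputable def classE (n : ℕ) : MvPolynomial (Fin 3) (NSigma ℚ (Fin 3)) :=
  ∑ j ∈ (finite_configs PrimClass.rep (PrimClass.rep_injective (A := Fin 3)) n).toFinset,
    (-1) ^ (n + j.sum fun _ k => k) * j.prod fun c k => classS c k

/-- `Newton.euler` gives each class `c` the factor `deg c`, whereas `2 deg c` words have roots in a
closed class. Halving the trace in `cycWt` reconciles the two, and words that are not closed
contribute nothing on either side. -/
theorem newton_classE : Newton classE
    (fun k => ∑ ω : Fin (k + 1) → Letter (Fin 3), cycWt (List.ofFn ω : List (Letter (Fin 3)))) := by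
  classical
  have h := Newton.euler (fun c : PrimClass (Fin 3) => (PrimClass.rep c).length)
    (fun c => Nat.succ_pos _) (finite_configs PrimClass.rep PrimClass.rep_injective)
    finite_dvd_primClass newton_class
  convert h using 1
  · rfl
  funext k
  have h2 := sum_words_eq (B := Letter (Fin 3)) (K := MvPolynomial (Fin 3) (NSigma ℚ (Fin 3)))
    (fun u => (Quotient.mk _ u : PrimClass (Fin 3))) (fun c => (PrimClass.rep c).length)
    (fun u => by
      rcases PrimClass.rep_mk_equiv u with h | h
      · exact h.perm.length_eq
      · rw [wordList_tr] at h
        have := h.perm.length_eq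
        rwa [length_listTr] at this) k (finite_dvd_primClass k)
    (fun c i => C (C (1 / 2)) * classP c i)
  refine Eq.trans (Finset.sum_congr rfl fun ω _ => ?_) (h2.trans (Finset.sum_congr rfl fun c _ => ?_))
  · set w := wordOfFn ω with hw
    set c : PrimClass (Fin 3) := Quotient.mk _ (root w)
    have hE := rootExp_pos w
    have hrep : PrimClass.rep c ≈ (root w).1 := PrimClass.rep_mk_equiv _
    have hcl : IsClosedPath w ↔ IsClosedPath (PrimClass.rep c) := by
      rw [isClosedPath_congr hrep, isClosedPath_iff, isClosedPath_iff, root_spec w,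
        ClosedList.lpow_iff _ _ hE]
    rw [← wordList_wordOfFn ω, ← hw, cycWt, halfTr_wordList, classP]
    by_cases hc : IsClosedPath w
    · rw [if_pos hc, if_pos (hcl.mp hc), Cycle.coe_toMultiset, Multiset.map_coe, Multiset.prod_coe,
        C_mul, classWt, Nat.sub_add_cancel hE,
        prod_wt_congr hrep ((isClosedPath_congr hrep).mp (hcl.mp hc)), ← prod_map_lpow,
        ← root_spec w]
      have : sigmaWord ℚ 1 w = sigmaWord ℚ 1 (pw (PrimClass.rep c) (rootExp w - 1)) := by
        conv_lhs => rw [eq_pw_root w]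
        refine sigmaWord_congr ?_ 1
        rcases hrep with h | h
        · refine Or.inl ?_
          rw [wordList_pw, wordList_pw]
          exact (IsRotated_lpow h _).symm
        · refine Setoid.symm (Or.inr ?_)
          rw [wordList_pw, wordList_tr, wordList_pw, listTr_lpow, ← wordList_tr]
          exact IsRotated_lpow h _
      rw [this]; ring
    · rw [if_neg hc, if_neg (fun h => hc (hcl.mpr h))]
      simp
  · rw [classP]
    split_ifs with hc
    · rw [card_primClass_of_closed c hc]
      have : (C (C (1 / 2)) : MvPolynomial (Fin 3) (NSigma ℚ (Fin 3))) * 2 = 1 := by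
        have h2 : (2 : MvPolynomial (Fin 3) (NSigma ℚ (Fin 3))) = C (C 2) := by
          rw [map_ofNat C 2, map_ofNat C 2]
        rw [h2, ← C_mul, ← C_mul]
        norm_num
      push_cast
      linear_combination (((PrimClass.rep c).length : MvPolynomial (Fin 3) (NSigma ℚ (Fin 3))) *
        (classWt c ^ ((k + 1) / (PrimClass.rep c).length - 1 + 1) *
        C (sigmaWord ℚ 1 (pw (PrimClass.rep c) ((k + 1) / (PrimClass.rep c).length - 1))))) * this
    · simp

end GeneratingFunction

end MatInv

namespace MatInv
open MvPolynomial Function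

/-! ### Extraction of `σ_{t,r}` as a coefficient. -/

section Coefficients

theorem sum_single_apply (l : List (Letter (Fin 3))) (a : Fin 3) :
    (l.map fun b => Finsupp.single b.1 1).sum a = l.count (a, false) + l.count (a, true) := by
  induction l with
  | nil => rfl
  | cons b l ih =>
    rw [List.map_cons, List.sum_cons, Finsupp.add_apply, ih]
    obtain ⟨c, s⟩ := b
    by_cases h : c = a
    · subst h
      cases s <;> simp <;> omega
    · cases s <;> simp [h]

theorem prod_eps (l : List (Letter (Fin 3))) :
    (l.map eps).prod = (-1) ^ (l.count (1, false) + l.count (2, false)) := by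
  induction l with
  | nil => rfl
  | cons b l ih =>
    rw [List.map_cons, List.prod_cons, ih, eps]
    by_cases h1 : b = (1, false)
    · subst h1
      simp [pow_succ, pow_add]
    · by_cases h2 : b = (2, false)
      · subst h2
        simp [pow_succ, pow_add]
      · simp [h1, h2]

/-- The multidegree of a class. -/
noncomputable def classDeg (c : PrimClass (Fin 3)) : Fin 3 →₀ ℕ :=
  ((wordList c.rep).map fun b => Finsupp.single b.1 1).sum

theorem classDeg_apply (c : PrimClass (Fin 3)) (a : Fin 3) : classDeg c a = mdeg c.rep a :=
  sum_single_apply _ _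

theorem classS_of_closed {c : PrimClass (Fin 3)} (hc : IsClosedPath c.rep) (k : ℕ) :
    classS c k = monomial (k • classDeg c)
      ((-1) ^ (k * (degLetter (1, false) c.rep + degLetter (2, false) c.rep)) * gen ℚ k c) := by
  rw [classS, if_pos hc, classWt, prod_wt, prod_eps, monomial_pow, mul_comm, C_mul_monomial]
  congr 1
  push_cast
  rw [← pow_mul, mul_comm (gen ℚ k c), mul_comm k]
  rfl

/-- The multidegree `(t, r, r)`. -/
noncomputable def degTR (t r : ℕ) : Fin 3 →₀ ℕ := Finsupp.equivFunOnFinite.symm ![t, r, r]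

theorem coeff_classE (t r : ℕ) :
    coeff (degTR t r) (classE (t + 2 * r)) = sigmaTRLetters ℚ t r := by
  classical
  rw [classE, coeff_sum, sigmaTRLetters]
  have hsub : (finite_indexSet t r).toFinset ⊆ (finite_configs PrimClass.rep
      (PrimClass.rep_injective (A := Fin 3)) (t + 2 * r)).toFinset := by
    intro j hj
    rw [Set.Finite.mem_toFinset] at hj ⊢
    have h : (j.sum fun c k => k * (PrimClass.rep c).length) =
        ∑ a, j.sum fun c k => k * mdeg (PrimClass.rep c) a := by
      simp only [Finsupp.sum, length_eq_mdeg, Finset.mul_sum]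
      exact Finset.sum_comm
    show (j.sum fun c k => k * (PrimClass.rep c).length) = t + 2 * r
    rw [h]
    simp only [hj.2, Fin.sum_univ_three]
    simp
    omega
  have hone : ∀ (n : ℕ) (q : MvPolynomial (Fin 3) (NSigma ℚ (Fin 3))) (μ : Fin 3 →₀ ℕ),
      coeff μ ((-1) ^ n * q) = (-1) ^ n * coeff μ q := by
    intro n q μ
    have : ((-1) ^ n : MvPolynomial (Fin 3) (NSigma ℚ (Fin 3))) = C ((-1) ^ n) := by simp
    rw [this, coeff_C_mul]
  have hmon : ∀ j : PrimClass (Fin 3) →₀ ℕ, (∀ c ∈ j.support, IsClosedPath (PrimClass.rep c)) →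
      (j.prod fun c k => classS c k) = monomial (∑ c ∈ j.support, j c • classDeg c)
        (∏ c ∈ j.support, ((-1) ^ (j c * (degLetter (1, false) (PrimClass.rep c) +
          degLetter (2, false) (PrimClass.rep c))) * gen ℚ (j c) c)) := by
    intro j hj
    rw [monomial_sum_prod]
    exact Finset.prod_congr rfl fun c hc => classS_of_closed (hj c hc) _
  have hdeg : ∀ j : PrimClass (Fin 3) →₀ ℕ, (∑ c ∈ j.support, j c • classDeg c) = degTR t r ↔
      ∀ a, (j.sum fun c k => k * mdeg (PrimClass.rep c) a) = ![t, r, r] a := by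
    intro j
    rw [Finsupp.ext_iff]
    refine forall_congr' fun a => ?_
    rw [Finsupp.finsetSum_apply]
    simp only [Finsupp.smul_apply, classDeg_apply, smul_eq_mul]
    rfl
  rw [← Finset.sum_subset hsub]
  · refine Finset.sum_congr rfl fun j hj => ?_
    rw [Set.Finite.mem_toFinset] at hj
    rw [hone, hmon j hj.1, coeff_monomial, if_pos ((hdeg j).mpr hj.2), Finset.prod_mul_distrib,
      Finset.prod_pow_eq_pow_sum, ← mul_assoc, ← pow_add]
    congr 1
    have h2 : (j.sum fun c k => k * (degLetter (1, false) (PrimClass.rep c) +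
        degLetter (2, false) (PrimClass.rep c) + 1)) = (j.sum fun _ k => k) +
        ∑ c ∈ j.support, j c * (degLetter (1, false) (PrimClass.rep c) +
          degLetter (2, false) (PrimClass.rep c)) := by
      rw [Finsupp.sum, Finsupp.sum, ← Finset.sum_add_distrib]
      exact Finset.sum_congr rfl fun c _ => by ring
    -- The sign in `classE` starts from the length `t + 2r` and the one in `σ_{t,r}` from `t`; the
    -- difference is even.
    rw [h2, show ∀ a b : ℕ, t + 2 * r + a + b = (t + (a + b)) + 2 * r by intros; ring, pow_add,
      pow_mul (-1 : NSigma ℚ (Fin 3)) 2 r]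
    simp
  · intro j _ hj
    rw [hone]
    by_cases hc : ∀ c ∈ j.support, IsClosedPath (PrimClass.rep c)
    · rw [hmon j hc, coeff_monomial, if_neg fun h => hj ?_, mul_zero]
      exact (Set.Finite.mem_toFinset _).mpr ⟨hc, (hdeg j).mp h⟩
    · push Not at hc
      obtain ⟨c, hc, hcl⟩ := hc
      have h0 : (j.prod fun c k => classS c k) = 0 := by
        refine Finset.prod_eq_zero hc ?_
        show classS c (j c) = 0
        rw [classS, if_neg hcl, if_neg (Finsupp.mem_support_iff.mp hc)]
      rw [h0, coeff_zero, mul_zero]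

end Coefficients

/-! ### Labellings of a finite set and their content. -/

section Content

theorem periodicOrbit_semiconj {U V : Type*} {f : U → U} {f' : V → V} {g : U → V} (hg : Injective g)
    (h : Semiconj g f f') (a : U) : periodicOrbit f' (g a) = (periodicOrbit f a).map g := by
  have hm : minimalPeriod f' (g a) = minimalPeriod f a :=
    minimalPeriod_eq_minimalPeriod_iff.mpr fun n => by
      rw [IsPeriodicPt, IsPeriodicPt, IsFixedPt, IsFixedPt, ← (h.iterate_right n).eq, hg.eq_iff]
  rw [periodicOrbit_def, periodicOrbit_def, hm, Cycle.map_coe, List.map_map]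
  congr 1
  exact List.map_congr_left fun n _ => ((h.iterate_right n).eq a).symm

variable {U : Type*} [Fintype U]

theorem prod_cyc_permCongr {M : Type*} [CommMonoid M] (e : Equiv.Perm U) (ν : Equiv.Perm U)
    (F : Cycle U → M) :
    ∏ q : Cyc (e * ν * e⁻¹), F (periodicOrbit (e * ν * e⁻¹ : Equiv.Perm U) q.out) =
      ∏ q : Cyc ν, F ((periodicOrbit ν q.out).map e) := by
  have hs : Semiconj e ν (e * ν * e⁻¹ : Equiv.Perm U) := fun a => by simp
  refine (Fintype.prod_equiv (Quotient.congr e fun a b => ?_) _ _ fun q => ?_).symm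
  · show ν.SameCycle a b ↔ (e * ν * e⁻¹).SameCycle (e a) (e b)
    rw [Equiv.Perm.sameCycle_conj]
    simp
  · rw [← periodicOrbit_semiconj e.injective hs]
    congr 1
    refine periodicOrbit_eq_of_sameCycle ?_
    have h := Cyc.sameCycle_out (ν := e * ν * e⁻¹) (e q.out)
    convert h.symm using 2
    conv_lhs => rw [← Quotient.out_eq q]
    rfl

theorem prod_cycWt (ν : Equiv.Perm U) (l : U → Letter (Fin 3)) :
    ∏ q : Cyc ν, cycWt ((periodicOrbit ν q.out).map l) =
      monomial (∑ a, Finsupp.single (l a).1 1)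
        ((∏ a, eps (l a)) • ∏ q : Cyc ν, halfTr ((periodicOrbit ν q.out).map l)) := by
  simp only [cycWt]
  rw [Finset.prod_mul_distrib]
  have h1 : ∏ q : Cyc ν, (((periodicOrbit ν q.out).map l).toMultiset.map wt).prod =
      ∏ a, wt (l a) := by
    rw [prod_eq_prod_cyc ν]
    refine Finset.prod_congr rfl fun q _ => ?_
    rw [periodicOrbit_map_eq, Cycle.coe_toMultiset, Multiset.map_coe, Multiset.prod_coe,
      List.map_ofFn, List.prod_ofFn]
    rfl
  rw [h1, ← map_prod C, mul_comm]
  simp only [wt]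
  rw [← monomial_sum_prod, C_mul_monomial, zsmul_eq_mul, mul_comm]
  push_cast
  rfl

theorem sum_single_card (m : U → Fin 3) (i : Fin 3) :
    (∑ a, Finsupp.single (m a) 1 : Fin 3 →₀ ℕ) i = Fintype.card {a // m a = i} := by
  rw [Finsupp.finsetSum_apply, Fintype.card_subtype, Finset.card_filter]
  exact Finset.sum_congr rfl fun a _ => Finsupp.single_apply

/-- Equal content means that corresponding fibres have equal size, and fibrewise bijections assemble
to a permutation. -/
theorem exists_comp_iff (δ m : U → Fin 3) : (∃ e : Equiv.Perm U, δ ∘ e = m) ↔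
    (∑ a, Finsupp.single (m a) 1 : Fin 3 →₀ ℕ) = ∑ a, Finsupp.single (δ a) 1 := by
  constructor
  · rintro ⟨e, rfl⟩
    exact Equiv.sum_comp e fun a => Finsupp.single (δ a) 1
  · intro h
    have h2 : ∀ i, Nonempty ({a // m a = i} ≃ {a // δ a = i}) := fun i =>
      Fintype.card_eq.mp (by rw [← sum_single_card, ← sum_single_card, h])
    exact ⟨Equiv.ofFiberEquiv fun i => (h2 i).some, funext fun a => Equiv.ofFiberEquiv_map _ a⟩

variable [DecidableEq U]

/-- The contribution of a labelling of `U` to `n! σ_{t,r}`. -/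
noncomputable def labelSum (l : U → Letter (Fin 3)) : NSigma ℚ (Fin 3) :=
  (∏ a, eps (l a)) • ∑ ν : Equiv.Perm U, ((Equiv.Perm.sign ν : ℤˣ) : ℤ) •
    ∏ q : Cyc ν, halfTr ((periodicOrbit ν q.out).map l)

/-- Relabelling by `e` amounts to conjugating `ν`, which preserves its sign and carries cycles to
cycles. -/
theorem labelSum_comp (l : U → Letter (Fin 3)) (e : Equiv.Perm U) :
    labelSum (l ∘ e) = labelSum l := by
  rw [labelSum, labelSum]
  congr 1
  · exact Equiv.prod_comp e fun a => eps (l a)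
  refine Fintype.sum_equiv (MulAut.conj e).toEquiv _ _ fun ν => ?_
  have : (MulAut.conj e).toEquiv ν = e * ν * e⁻¹ := rfl
  rw [this]
  congr 1
  · congr 1
    rw [map_mul, map_mul, map_inv, mul_comm, inv_mul_cancel_left]
  · rw [prod_cyc_permCongr e ν fun c => halfTr (c.map l)]
    refine Finset.prod_congr rfl fun q _ => ?_
    congr 1
    rw [periodicOrbit_map_eq, periodicOrbit_def, Cycle.map_coe, Cycle.map_coe, List.map_map,
      List.map_map, List.ofFn_eq_map, ← List.map_coe_finRange_eq_range, List.map_map]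
    rfl

theorem factorial_mul_classE {n : ℕ} (hn : Fintype.card U = n) :
    (n.factorial : MvPolynomial (Fin 3) (NSigma ℚ (Fin 3))) * classE n =
      ∑ l : U → Letter (Fin 3), monomial (∑ a, Finsupp.single (l a).1 1) (labelSum l) := by
  rw [newton_classE.factorial_mul hn]
  have h : ∀ m : ℕ, 0 < m → (∑ ω : Fin (m - 1 + 1) → Letter (Fin 3),
      cycWt (List.ofFn ω : List (Letter (Fin 3)))) =
      ∑ ω : Fin m → Letter (Fin 3), cycWt (List.ofFn ω : List (Letter (Fin 3))) := by
    intro m hm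
    obtain ⟨k, rfl⟩ : ∃ k, m = k + 1 := ⟨m - 1, by omega⟩
    rfl
  simp only [labelSum, Finset.smul_sum, map_sum]
  rw [Finset.sum_comm]
  refine Finset.sum_congr rfl fun ν _ => ?_
  rw [Finset.prod_congr rfl fun q _ => h _ (perm_minimalPeriod_pos ν (Quotient.out q)),
    ← sum_prod_cyc, Finset.smul_sum]
  refine Finset.sum_congr rfl fun l _ => ?_
  rw [prod_cycWt, smul_comm, ← map_zsmul (monomial _)]

/-- All labellings of `U` by unordered letters `m : U → Fin 3`. -/
noncomputable def orientedSum (m : U → Fin 3) : NSigma ℚ (Fin 3) :=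
  ∑ s : U → Bool, labelSum fun a => (m a, s a)

theorem orientedSum_comp (m : U → Fin 3) (e : Equiv.Perm U) :
    orientedSum (m ∘ e) = orientedSum m := by
  rw [orientedSum, orientedSum]
  refine Fintype.sum_equiv (e.arrowCongr (Equiv.refl Bool)) _ _ fun s => ?_
  rw [← labelSum_comp (fun a => (m a, (e.arrowCongr (Equiv.refl Bool)) s a)) e]
  congr 1
  funext a
  simp [Equiv.arrowCongr]

theorem factorial_mul_coeff_classE {n : ℕ} (hn : Fintype.card U = n) (μ : Fin 3 →₀ ℕ) :
    (n.factorial : NSigma ℚ (Fin 3)) * coeff μ (classE n) =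
      ∑ m : U → Fin 3 with ∑ a, Finsupp.single (m a) 1 = μ, orientedSum m := by
  classical
  have h := congrArg (coeff μ) (factorial_mul_classE hn)
  rw [← map_natCast C, coeff_C_mul, coeff_sum] at h
  rw [h, Finset.sum_filter]
  simp only [coeff_monomial]
  rw [← Equiv.sum_comp (Equiv.arrowProdEquivProdArrow U (fun _ => Fin 3) (fun _ => Bool)).symm,
    Fintype.sum_prod_type]
  refine Finset.sum_congr rfl fun m _ => ?_
  split_ifs with hm
  · exact Finset.sum_congr rfl fun s _ => if_pos hm
  · exact Finset.sum_eq_zero fun s _ => if_neg hm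

theorem card_comp_eq {N : Type*} [Fintype N] [DecidableEq N] (δ : U → N) (e₀ : Equiv.Perm U) :
    (Finset.univ.filter fun e : Equiv.Perm U => δ ∘ e = δ ∘ e₀).card =
      ∏ i, (Fintype.card {a // δ a = i}).factorial := by
  rw [← DomMulAct.stabilizer_card, ← Fintype.card_subtype]
  refine Fintype.card_congr (Equiv.subtypeEquiv (Equiv.mulRight e₀⁻¹) fun e => ?_)
  constructor
  · intro h
    funext a
    have := congrFun h (e₀⁻¹ a)
    simpa using this
  · intro h
    funext a
    have := congrFun h (e₀ a)
    simpa using this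

/-- The labellings of the given content form the orbit of `δ`, on which `orientedSum` is constant.
Summing over the whole symmetric group instead counts each of them as often as the order of the
stabiliser. -/
theorem prod_factorial_mul_coeff_classE {n : ℕ} (hn : Fintype.card U = n) (δ : U → Fin 3) :
    ((∏ i, (Fintype.card {a // δ a = i}).factorial : ℕ) : NSigma ℚ (Fin 3)) *
      coeff (∑ a, Finsupp.single (δ a) 1) (classE n) = orientedSum δ := by
  classical
  have hn0 : (n.factorial : NSigma ℚ (Fin 3)) ≠ 0 := Nat.cast_ne_zero.mpr n.factorial_ne_zero
  refine mul_left_cancel₀ hn0 ?_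
  rw [mul_left_comm, factorial_mul_coeff_classE hn]
  have h1 : ∑ e : Equiv.Perm U, orientedSum (δ ∘ e) =
      (n.factorial : NSigma ℚ (Fin 3)) * orientedSum δ := by
    simp only [orientedSum_comp, Finset.sum_const, Finset.card_univ, Fintype.card_perm, hn,
      nsmul_eq_mul]
  rw [← h1, Finset.sum_comp orientedSum (fun e : Equiv.Perm U => δ ∘ e), Finset.mul_sum]
  have himg : (Finset.univ.filter fun m : U → Fin 3 => ∑ a, Finsupp.single (m a) 1 =
      ∑ a, Finsupp.single (δ a) 1) = Finset.univ.image fun e : Equiv.Perm U => δ ∘ e := by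
    ext m
    rw [Finset.mem_filter, ← exists_comp_iff]
    simp
  rw [← himg]
  refine Finset.sum_congr rfl fun m hm => ?_
  · obtain ⟨e₀, rfl⟩ := (exists_comp_iff δ m).mpr (Finset.mem_filter.mp hm).2
    rw [card_comp_eq, nsmul_eq_mul]

end Content

/-! ### The labelling given by the tableau arrows. -/

section Tableau

/-- The letters of the arrows of the tableau. -/
def arrLetter {t r : ℕ} : Arr t r → Fin 3 :=
  Sum.elim (fun _ => 0) (Sum.elim (fun _ => 1) (fun _ => 2))

theorem factorial_mul_sigmaTRLetters (t r : ℕ) :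
    ((t.factorial * r.factorial ^ 2 : ℕ) : NSigma ℚ (Fin 3)) * sigmaTRLetters ℚ t r =
      orientedSum (arrLetter : Arr t r → Fin 3) := by
  have hn : Fintype.card (Arr t r) = t + 2 * r := by
    simp [Arr]; omega
  have hcard : ∀ i, Fintype.card {a : Arr t r // arrLetter a = i} = ![t, r, r] i := by
    intro i
    rw [← sum_single_card, Fintype.sum_sum_type, Fintype.sum_sum_type]
    fin_cases i <;> simp [arrLetter]
  rw [← prod_factorial_mul_coeff_classE hn, ← coeff_classE]
  congr 2
  · simp [hcard, Fin.prod_univ_three, sq, mul_assoc]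
  · ext i
    rw [sum_single_card, hcard]
    rfl

end Tableau

end MatInv

namespace MatInv
open MvPolynomial Function

/-! ### The closed paths of a gluing. -/

section Gluing
variable {t r : ℕ}

/-- Heads of letters: a bijection between the letters and the cells. -/
def headEquiv : Letter (Arr t r) ≃ Bool × Row t r where
  toFun := cellHead
  invFun c := (withTail c).tr
  left_inv b := by
    rcases b with ⟨i | j | j, s⟩ <;> cases s <;> rfl
  right_inv c := by
    rcases c with ⟨s, i | ⟨j, b⟩⟩ <;> cases s <;> first | rfl | (cases b <;> rfl)

theorem cellHead_tr_withTail (c : Bool × Row t r) : cellHead (withTail c).tr = c :=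
  headEquiv.apply_symm_apply c

/-- Transposition of letters as a permutation. -/
def trPerm (A : Type*) : Equiv.Perm (Letter A) where
  toFun := Letter.tr
  invFun := Letter.tr
  left_inv := Letter.tr_tr
  right_inv := Letter.tr_tr

/-- The gluing of the cells. -/
def glue (π : Equiv.Perm (Row t r)) : Equiv.Perm (Bool × Row t r) where
  toFun c := match c with
    | (false, i) => (true, π i)
    | (true, i) => (false, π.symm i)
  invFun c := match c with
    | (false, i) => (true, π i)
    | (true, i) => (false, π.symm i)
  left_inv c := by rcases c with ⟨s, i⟩; cases s <;> simp
  right_inv c := by rcases c with ⟨s, i⟩; cases s <;> simp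

theorem glue_glue (π : Equiv.Perm (Row t r)) (c : Bool × Row t r) : glue π (glue π c) = c :=
  (glue π).left_inv c

theorem glue_fst (π : Equiv.Perm (Row t r)) (c : Bool × Row t r) : (glue π c).1 = !c.1 := by
  rcases c with ⟨s, i⟩; cases s <;> rfl

theorem glue_injective : Injective (glue : Equiv.Perm (Row t r) → _) := by
  intro π π' h
  ext i : 1
  exact congrArg Prod.snd (Equiv.congr_fun h (false, i))

theorem exists_glue (g : Bool × Row t r → Bool × Row t r) (hg : Involutive g)
    (h : ∀ c, (g c).1 = !c.1) : ∃ π : Equiv.Perm (Row t r), ∀ c, glue π c = g c := by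
  have hf : ∀ s i, g (s, i) = (!s, (g (s, i)).2) := fun s i => Prod.ext (h _) rfl
  refine ⟨⟨fun i => (g (false, i)).2, fun i => (g (true, i)).2, fun i => ?_, fun i => ?_⟩, ?_⟩
  · have := hg (false, i)
    rw [hf false i] at this
    exact congrArg Prod.snd this
  · have := hg (true, i)
    rw [hf true i] at this
    exact congrArg Prod.snd this
  · rintro ⟨s, i⟩
    cases s
    · exact (hf false i).symm
    · exact (hf true i).symm

theorem nextLetter_eq (π : Equiv.Perm (Row t r)) (b : Letter (Arr t r)) :
    nextLetter π b = withTail (glue π (cellHead b)) := by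
  rw [nextLetter]
  rcases cellHead b with ⟨s, i⟩
  cases s <;> rfl

/-- The successor map of letters. -/
def nextPerm (π : Equiv.Perm (Row t r)) : Equiv.Perm (Letter (Arr t r)) :=
  headEquiv.trans ((glue π).trans (headEquiv.symm.trans (trPerm _)))

theorem coe_nextPerm (π : Equiv.Perm (Row t r)) : (nextPerm π : _ → _) = nextLetter π := by
  funext b
  rw [nextLetter_eq]
  exact Letter.tr_tr _

theorem cellHead_tr_nextPerm (π : Equiv.Perm (Row t r)) (b : Letter (Arr t r)) :
    cellHead (nextPerm π b).tr = glue π (cellHead b) := by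
  rw [coe_nextPerm, nextLetter_eq, cellHead_tr_withTail]

theorem cellHead_injective : Injective (cellHead : Letter (Arr t r) → _) := headEquiv.injective

theorem nextPerm_eq_iff (π : Equiv.Perm (Row t r)) (b b' : Letter (Arr t r)) :
    nextPerm π b = b' ↔ glue π (cellHead b) = cellHead b'.tr := by
  rw [← cellHead_tr_nextPerm, cellHead_injective.eq_iff, Letter.tr_injective.eq_iff]

/-- Since the gluing is an involution, following transposed letters runs the path backwards. -/
theorem nextPerm_tr_nextPerm (π : Equiv.Perm (Row t r)) (b : Letter (Arr t r)) :
    nextPerm π (nextPerm π b).tr = b.tr := by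
  rw [nextPerm_eq_iff, cellHead_tr_nextPerm, glue_glue, Letter.tr_tr]

/-- A path turning straight back would need a cell glued to itself, but gluing changes the column.
-/
theorem nextPerm_ne_tr (π : Equiv.Perm (Row t r)) (b : Letter (Arr t r)) :
    nextPerm π b ≠ b.tr := by
  rw [Ne, nextPerm_eq_iff, Letter.tr_tr]
  intro h
  have := congrArg Prod.fst h
  rw [glue_fst] at this
  simp at this

theorem wordList_cycleWord (π : Equiv.Perm (Row t r)) (b : Letter (Arr t r)) :
    wordList (cycleWord π b) =
      (List.range (minimalPeriod (nextPerm π) b)).map fun i => (nextPerm π)^[i] b := by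
  obtain ⟨m, hm⟩ : ∃ m, minimalPeriod (nextPerm π) b = m + 1 :=
    ⟨_, (Nat.sub_add_cancel (perm_minimalPeriod_pos (nextPerm π) b)).symm⟩
  rw [wordList, cycleWord, ← coe_nextPerm, hm, List.range_succ_eq_map, List.map_cons, List.map_map]
  rfl

theorem wordList_cycleWord_cycle (π : Equiv.Perm (Row t r)) (b : Letter (Arr t r)) :
    (wordList (cycleWord π b) : Cycle (Letter (Arr t r))) = periodicOrbit (nextPerm π) b := by
  rw [wordList_cycleWord, periodicOrbit_def]

/-- The class of the closed path through a letter. -/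
noncomputable def pathClass (π : Equiv.Perm (Row t r)) (b : Letter (Arr t r)) :
    WordClass (Arr t r) := Quotient.mk _ (cycleWord π b)

theorem pathClass_eq_of_sameCycle {π : Equiv.Perm (Row t r)} {b b' : Letter (Arr t r)}
    (h : (nextPerm π).SameCycle b b') : pathClass π b = pathClass π b' := by
  refine Quotient.sound (Or.inl ?_)
  rw [← Cycle.coe_eq_coe, wordList_cycleWord_cycle, wordList_cycleWord_cycle]
  exact periodicOrbit_eq_of_sameCycle h

theorem iterate_nextPerm_tr (π : Equiv.Perm (Row t r)) (b : Letter (Arr t r)) (i : ℕ) :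
    (nextPerm π)^[i] ((nextPerm π)^[i] b).tr = b.tr := by
  induction i with
  | zero => rfl
  | succ i ih => rw [iterate_succ_apply, iterate_succ_apply', nextPerm_tr_nextPerm, ih]

theorem sameCycle_tr {π : Equiv.Perm (Row t r)} {b b' : Letter (Arr t r)}
    (h : (nextPerm π).SameCycle b b') : (nextPerm π).SameCycle b.tr b'.tr := by
  obtain ⟨i, rfl⟩ := sameCycle_iff_iterate.mp h
  exact (sameCycle_iff_iterate.mpr ⟨i, iterate_nextPerm_tr π b i⟩).symm

theorem minimalPeriod_tr (π : Equiv.Perm (Row t r)) (b : Letter (Arr t r)) :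
    minimalPeriod (nextPerm π) b.tr = minimalPeriod (nextPerm π) b := by
  refine minimalPeriod_eq_minimalPeriod_iff.mpr fun n => ?_
  have key : ∀ c : Letter (Arr t r), IsPeriodicPt (nextPerm π) n c →
      IsPeriodicPt (nextPerm π) n c.tr := by
    intro c hc
    have h := iterate_nextPerm_tr π c n
    rwa [hc.eq] at h
  exact ⟨fun h => by simpa [Letter.tr_tr] using key _ h, key b⟩

/-- The reversed path starts at the transpose of the last letter, hence the exponent `minimalPeriod
- 1`. -/
theorem wordList_cycleWord_tr (π : Equiv.Perm (Row t r)) (b : Letter (Arr t r)) :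
    wordList (cycleWord π ((nextPerm π)^[minimalPeriod (nextPerm π) b - 1] b).tr) =
      listTr (wordList (cycleWord π b)) := by
  have hm : minimalPeriod (nextPerm π) ((nextPerm π)^[minimalPeriod (nextPerm π) b - 1] b).tr =
      minimalPeriod (nextPerm π) b := by
    rw [minimalPeriod_tr, minimalPeriod_apply_iterate (perm_mem_periodicPts _ _)]
  rw [wordList_cycleWord, wordList_cycleWord, listTr, List.map_map, hm]
  refine List.ext_getElem (by simp) fun i hi _ => ?_
  simp only [List.length_map, List.length_range] at hi
  simp only [List.getElem_map, List.getElem_range, List.getElem_reverse, List.length_map,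
    List.length_range, comp_apply]
  rw [show minimalPeriod (nextPerm π) b - 1 = i + (minimalPeriod (nextPerm π) b - 1 - i) by omega,
    iterate_add_apply, iterate_nextPerm_tr]
  congr 3
  omega

theorem sameCycle_iterate_tr (π : Equiv.Perm (Row t r)) (b : Letter (Arr t r)) (i : ℕ) :
    (nextPerm π).SameCycle ((nextPerm π)^[i] b).tr b.tr :=
  sameCycle_tr (sameCycle_iff_iterate.mpr ⟨i, rfl⟩).symm

theorem pathClass_tr (π : Equiv.Perm (Row t r)) (b : Letter (Arr t r)) :
    pathClass π b.tr = pathClass π b := by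
  rw [← pathClass_eq_of_sameCycle
    (sameCycle_iterate_tr π b (minimalPeriod (nextPerm π) b - 1))]
  refine Quotient.sound (Or.inr ?_)
  rw [wordList_tr, wordList_cycleWord_tr]

/-- Otherwise the word of the path would be a rotation of its transpose, which `nextPerm_ne_tr`
rules out. Hence every closed path consists of two different cycles of letters, one for each
direction. -/
theorem not_sameCycle_tr (π : Equiv.Perm (Row t r)) (b : Letter (Arr t r)) :
    ¬ (nextPerm π).SameCycle b b.tr := by
  intro h
  refine not_isRotated_listTr (wordList_ne_nil (cycleWord π b)) (fun i hi he => ?_) ?_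
  · simp only [wordList_cycleWord, List.getElem_map, List.getElem_range, iterate_succ_apply'] at he
    refine nextPerm_ne_tr π ((nextPerm π)^[i] b) ?_
    rw [he, Letter.tr_tr, ← he]
  · rw [← wordList_cycleWord_tr, ← Cycle.coe_eq_coe, wordList_cycleWord_cycle,
      wordList_cycleWord_cycle]
    exact periodicOrbit_eq_of_sameCycle (h.trans (sameCycle_iterate_tr π b _).symm)

theorem pathClass_eq_iff (π : Equiv.Perm (Row t r)) (b b' : Letter (Arr t r)) :
    pathClass π b = pathClass π b' ↔
      (nextPerm π).SameCycle b b' ∨ (nextPerm π).SameCycle b b'.tr := by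
  constructor
  · intro h
    rcases (Quotient.exact h : cycleWord π b ≈ cycleWord π b') with h | h
    · left
      have hm : b' ∈ wordList (cycleWord π b) := h.mem_iff.mpr (List.mem_cons_self ..)
      rw [wordList_cycleWord, List.mem_map] at hm
      obtain ⟨i, -, hi⟩ := hm
      exact sameCycle_iff_iterate.mpr ⟨i, hi⟩
    · right
      rw [wordList_tr] at h
      have hm : b'.tr ∈ wordList (cycleWord π b) := h.mem_iff.mpr (by
        rw [listTr, List.mem_reverse]
        exact List.mem_map_of_mem (List.mem_cons_self ..))
      rw [wordList_cycleWord, List.mem_map] at hm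
      obtain ⟨i, -, hi⟩ := hm
      exact sameCycle_iff_iterate.mpr ⟨i, hi⟩
  · rintro (h | h)
    · exact pathClass_eq_of_sameCycle h
    · rw [pathClass_eq_of_sameCycle h, pathClass_tr]

end Gluing

end MatInv

namespace MatInv
open MvPolynomial Function

/-! ### Directions of the closed paths. -/

section Orientations
variable {t r : ℕ}

/-- `ν` follows the closed paths of `π`, where the arrow `a` is passed in direction `σ a`. -/
def Follows (π : Equiv.Perm (Row t r)) (σ : Arr t r → Bool) (ν : Equiv.Perm (Arr t r)) : Prop :=
  ∀ a, nextPerm π (a, σ a) = (ν a, σ (ν a))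

variable {π : Equiv.Perm (Row t r)} {σ : Arr t r → Bool} {ν : Equiv.Perm (Arr t r)}

theorem graph_injective (σ : Arr t r → Bool) : Injective fun a => ((a, σ a) : Letter (Arr t r)) :=
  fun _ _ h => congrArg Prod.fst h

theorem Follows.semiconj (h : Follows π σ ν) :
    Semiconj (fun a => ((a, σ a) : Letter (Arr t r))) ν (nextPerm π) := fun a => (h a).symm

theorem Follows.sameCycle (h : Follows π σ ν) {a a' : Arr t r} (ha : ν.SameCycle a a') :
    (nextPerm π).SameCycle (a, σ a) (a', σ a') := by
  obtain ⟨n, rfl⟩ := sameCycle_iff_iterate.mp ha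
  exact sameCycle_iff_iterate.mpr ⟨n, ((h.semiconj.iterate_right n).eq a).symm⟩

theorem Follows.exists_of_sameCycle (h : Follows π σ ν) {a : Arr t r} {b : Letter (Arr t r)}
    (ha : (nextPerm π).SameCycle (a, σ a) b) : σ b.1 = b.2 ∧ ν.SameCycle a b.1 := by
  obtain ⟨n, rfl⟩ := sameCycle_iff_iterate.mp ha
  have h2 : ((ν^[n] a, σ (ν^[n] a)) : Letter (Arr t r)) = (nextPerm π)^[n] (a, σ a) :=
    (h.semiconj.iterate_right n).eq a
  rw [← h2]
  exact ⟨rfl, sameCycle_iff_iterate.mpr ⟨n, rfl⟩⟩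

open Classical in
/-- The set of closed paths of a gluing. -/
noncomputable def pathClasses (π : Equiv.Perm (Row t r)) : Finset (WordClass (Arr t r)) :=
  Finset.univ.image (pathClass π)

theorem mem_graph_or (σ : Arr t r → Bool) (b : Letter (Arr t r)) :
    b = (b.1, σ b.1) ∨ b.tr = (b.1, σ b.1) := by
  rcases b with ⟨a, s⟩
  cases s <;> cases σ a <;> simp [Letter.tr]

theorem Follows.pathClass_mk (h : Follows π σ ν) (a : Arr t r) :
    pathClass π ((Quotient.mk _ a : Cyc ν).out, σ (Quotient.mk _ a : Cyc ν).out) =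
      pathClass π (a, σ a) :=
  pathClass_eq_of_sameCycle (h.sameCycle (Cyc.sameCycle_out a))

/-- The graph of `σ` contains exactly one of `b` and its transpose, so it meets each path in one of
its two cycles, and that cycle is a copy of a cycle of `ν`. -/
theorem Follows.prod_pathClasses (h : Follows π σ ν) {M : Type*} [CommMonoid M]
    (f : WordClass (Arr t r) → M) :
    ∏ c ∈ pathClasses π, f c = ∏ q : Cyc ν, f (pathClass π (q.out, σ q.out)) := by
  classical
  symm
  refine Finset.prod_nbij (fun q => pathClass π (q.out, σ q.out)) ?_ ?_ ?_ fun _ _ => rfl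
  · intro q _
    exact Finset.mem_image_of_mem _ (Finset.mem_univ _)
  · intro q _ q' _ hq
    rcases (pathClass_eq_iff _ _ _).mp hq with h2 | h2
    · rw [← Quotient.out_eq q, ← Quotient.out_eq q']
      exact Quotient.sound (h.exists_of_sameCycle h2).2
    · have h3 := (h.exists_of_sameCycle h2).1
      simp [Letter.tr] at h3
  · intro c hc
    obtain ⟨b, -, rfl⟩ := Finset.mem_image.mp (Finset.mem_coe.mp hc)
    refine ⟨Quotient.mk _ b.1, Finset.mem_coe.mpr (Finset.mem_univ _), ?_⟩
    refine (h.pathClass_mk b.1).trans ?_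
    rcases mem_graph_or σ b with hb | hb
    · rw [← hb]
    · rw [← hb, pathClass_tr]

theorem Follows.card_cyc (h : Follows π σ ν) : Fintype.card (Cyc ν) = (pathClasses π).card := by
  have h2 := h.prod_pathClasses (M := Multiplicative ℕ) (fun _ => Multiplicative.ofAdd 1)
  rw [Finset.prod_const, Finset.prod_const] at h2
  have h3 := congrArg Multiplicative.toAdd h2
  simpa using h3.symm

/-- A letter on a closed path. -/
noncomputable def pathLetter (c : pathClasses π) : Letter (Arr t r) := by
  classical
  exact (Finset.mem_image.mp c.2).choose

theorem pathClass_pathLetter (c : pathClasses π) : pathClass π (pathLetter c) = c.1 := by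
  classical
  exact (Finset.mem_image.mp c.2).choose_spec.2

theorem mem_pathClasses (π : Equiv.Perm (Row t r)) (b : Letter (Arr t r)) :
    pathClass π b ∈ pathClasses π := by
  classical
  exact Finset.mem_image_of_mem _ (Finset.mem_univ b)

theorem beq_apply_true (s : Letter (Arr t r) → Bool) (h : ∀ b, s b.tr = !s b)
    (b : Letter (Arr t r)) : (s (b.1, true) == b.2) = s b := by
  rcases b with ⟨a, x⟩
  cases x
  · have := h (a, true)
    simp only [Letter.tr, Bool.not_true] at this
    rw [this]
    simp
  · simp

/-- The selected letters are closed under the successor map and contain each arrow in exactly one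
direction, so the successor map induces a permutation of the arrows. -/
theorem exists_follows (s : Letter (Arr t r) → Bool) (h1 : ∀ b, s (nextPerm π b) = s b)
    (h2 : ∀ b, s b.tr = !s b) : ∃ ν, Follows π (fun a => s (a, true)) ν := by
  have hs : ∀ b : Letter (Arr t r), s b = true ↔ s (b.1, true) = b.2 := by
    intro b
    rw [← beq_apply_true s h2]
    simp
  have key : ∀ a, nextPerm π (a, s (a, true)) = ((nextPerm π (a, s (a, true))).1,
      s ((nextPerm π (a, s (a, true))).1, true)) := by
    intro a
    have := (hs (nextPerm π (a, s (a, true)))).mp (by rw [h1]; exact (hs _).mpr rfl)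
    rw [this]
  have hinj : Injective fun a => (nextPerm π (a, s (a, true))).1 := by
    intro a a' haa
    simp only at haa
    have := key a
    rw [haa, ← key a'] at this
    exact congrArg Prod.fst ((nextPerm π).injective this)
  exact ⟨Equiv.ofBijective _ (Finite.injective_iff_bijective.mp hinj), key⟩

open Classical in
theorem card_follows (π : Equiv.Perm (Row t r)) :
    Fintype.card {p : (Arr t r → Bool) × Equiv.Perm (Arr t r) // Follows π p.1 p.2} =
      2 ^ (pathClasses π).card := by
  have hcard : Fintype.card (pathClasses π → Bool) = 2 ^ (pathClasses π).card := by simp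
  rw [← hcard]
  -- A pair is encoded by whether it passes the marked letter of each path as that letter is
  -- directed. These choices are free and determine the pair.
  refine Fintype.card_of_bijective (f := fun p c => (p.1.1 (pathLetter c).1 == (pathLetter c).2))
    ⟨?_, ?_⟩
  · rintro ⟨⟨σ, ν⟩, h⟩ ⟨⟨σ', ν'⟩, h'⟩ he
    simp only at h h' he
    have hmem : ∀ {σ ν} (_ : Follows π σ ν) {b b'} (_ : (nextPerm π).SameCycle b b'),
        σ b.1 = b.2 → σ b'.1 = b'.2 := by
      intro σ ν h b b' hb hs
      rcases b with ⟨a, x⟩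
      simp only at hs
      subst hs
      exact (h.exists_of_sameCycle hb).1
    have hσ : σ = σ' := by
      funext a
      have hc := congrFun he ⟨pathClass π (a, σ a), mem_pathClasses π _⟩
      generalize hb : pathLetter ⟨pathClass π (a, σ a), mem_pathClasses π _⟩ = b at hc
      have hcl : pathClass π b = pathClass π (a, σ a) := hb ▸ pathClass_pathLetter _
      symm
      rcases (pathClass_eq_iff _ _ _).mp hcl with h1 | h1
      · have h2 := hmem h h1.symm rfl
        rw [h2] at hc
        exact hmem h' h1 (by simpa using hc)
      · have h1 := sameCycle_tr h1
        rw [Letter.tr_tr] at h1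
        have h2 := hmem h h1.symm rfl
        simp only [Letter.tr] at h2
        rw [h2] at hc
        refine hmem h' h1 ?_
        show σ' b.1 = !b.2
        cases hb2 : b.2 <;> cases hb3 : σ' b.1 <;> simp [hb2, hb3] at hc ⊢
    subst hσ
    have hν : ν = ν' := by
      ext a : 1
      exact congrArg Prod.fst ((h a).symm.trans (h' a))
    subst hν
    rfl
  · intro f
    set cl : Letter (Arr t r) → pathClasses π := fun b => ⟨pathClass π b, mem_pathClasses π b⟩
    -- Selects the cycle of the marked letter when `f` is true on the path, and the opposite cycle
    -- otherwise.
    set s : Letter (Arr t r) → Bool := fun b =>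
      decide ((nextPerm π).SameCycle (pathLetter (cl b)) b) == f (cl b) with hs
    have h1 : ∀ b, s (nextPerm π b) = s b := by
      intro b
      have hb : (nextPerm π).SameCycle b (nextPerm π b) := sameCycle_iff_iterate.mpr ⟨1, rfl⟩
      have hc : cl (nextPerm π b) = cl b := Subtype.ext (pathClass_eq_of_sameCycle hb).symm
      simp only [hs, hc, Equiv.Perm.sameCycle_apply_right]
    have h2 : ∀ b, s b.tr = !s b := by
      intro b
      have hc : cl b.tr = cl b := Subtype.ext (pathClass_tr π b)
      have h3 : (nextPerm π).SameCycle (pathLetter (cl b)) b.tr ↔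
          ¬ (nextPerm π).SameCycle (pathLetter (cl b)) b := by
        constructor
        · exact fun h h' => not_sameCycle_tr π b (h'.symm.trans h)
        · intro h
          exact ((pathClass_eq_iff _ _ _).mp (pathClass_pathLetter (cl b))).resolve_left h
      simp only [hs, hc, h3]
      by_cases h4 : (nextPerm π).SameCycle (pathLetter (cl b)) b <;> cases f (cl b) <;> simp [h4]
    obtain ⟨ν, hν⟩ := exists_follows s h1 h2
    refine ⟨⟨⟨_, ν⟩, hν⟩, funext fun c => ?_⟩
    refine (beq_apply_true s h2 (pathLetter c)).trans ?_
    have hc : cl (pathLetter c) = c := Subtype.ext (pathClass_pathLetter c)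
    rw [hs]
    simp [hc, Equiv.Perm.SameCycle.refl]

end Orientations

end MatInv

namespace MatInv
open MvPolynomial Function

/-! ### Signs of permutations commuting with the flip. -/

section SignLemma

/-- The permutation of `Bool` that is nontrivial if and only if `s` is true. -/
def flip (s : Bool) : Equiv.Perm Bool := if s then Equiv.boolNot else 1

theorem flip_apply (s x : Bool) : flip s x = (x ^^ s) := by
  cases s <;> cases x <;> rfl

theorem sign_flip (s : Bool) : Equiv.Perm.sign (flip s) = if s then -1 else 1 := by
  cases s <;> decide

/-- Such a `Z` is a signed permutation. Its permutation part acts twice, once per copy of `ι`, and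
is even; each flipped index contributes one transposition. -/
theorem sign_eq_of_comm_flip {ι : Type*} [Fintype ι] [DecidableEq ι] (Z : Equiv.Perm (Bool × ι))
    (h : ∀ s i, Z (!s, i) = (!(Z (s, i)).1, (Z (s, i)).2)) :
    Equiv.Perm.sign Z = ∏ i, if (Z (false, i)).1 then -1 else 1 := by
  have hZ : ∀ s i, Z (s, i) = (s ^^ (Z (false, i)).1, (Z (false, i)).2) := by
    intro s i
    cases s
    · simp
    · rw [← Bool.not_false, h]; simp
  have hinj : Injective fun i => (Z (false, i)).2 := by
    intro i i' hi
    simp only at hi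
    have : Z ((Z (false, i)).1, i) = Z ((Z (false, i')).1, i') := by
      rw [hZ (Z (false, i)).1 i, hZ (Z (false, i')).1 i', hi]; simp
    exact congrArg Prod.snd (Z.injective this)
  have hd : Z = Equiv.prodCongrRight (fun _ : Bool =>
      Equiv.ofBijective _ (Finite.injective_iff_bijective.mp hinj)) *
      Equiv.prodCongrLeft (fun i : ι => flip (Z (false, i)).1) := by
    ext1 ⟨s, i⟩
    rw [hZ s i, Equiv.Perm.mul_apply, Equiv.prodCongrLeft_apply, Equiv.prodCongrRight_apply,
      flip_apply]
    rfl
  rw [hd, Equiv.Perm.sign_mul, Equiv.Perm.sign_prodCongrRight, Equiv.Perm.sign_prodCongrLeft,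
    ← hd, Finset.prod_const, Finset.card_univ, Fintype.card_bool, Int.units_sq, one_mul]
  exact Finset.prod_congr rfl fun i _ => sign_flip _

end SignLemma

/-! ### Comparison of the signs of `π` and `ν`. -/

section Sign
variable {t r : ℕ}

theorem cellHead_fst (b : Letter (Arr t r)) :
    (cellHead b).1 = !qTail (letterMap arrLetter b) := by
  rcases b with ⟨i | j | j, s⟩ <;> rfl

theorem cellHead_tr_fst (b : Letter (Arr t r)) :
    (cellHead b.tr).1 = qHead (letterMap arrLetter b) := by
  rw [cellHead_fst, letterMap_tr, qTail_tr, Bool.not_not]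

/-- Sends `(a, false)` to the head of the arrow `a`, taken in direction `σ a`, and `(a, true)` to
the tail of its successor. -/
def gluedCells (σ : Arr t r → Bool) (ν : Equiv.Perm (Arr t r)) : Letter (Arr t r) ≃ Bool × Row t r :=
  (Equiv.prodCongrLeft (fun s : Bool => if s then ν else 1)).trans
    ((Equiv.prodCongrRight (fun a => flip (σ a))).trans headEquiv)

variable {σ : Arr t r → Bool} {ν : Equiv.Perm (Arr t r)} {π : Equiv.Perm (Row t r)}

theorem gluedCells_false (a : Arr t r) : gluedCells σ ν (a, false) = cellHead (a, σ a) := by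
  show cellHead (a, flip (σ a) false) = _
  rw [flip_apply, Bool.false_xor]

theorem gluedCells_true (a : Arr t r) :
    gluedCells σ ν (a, true) = cellHead (Letter.tr (ν a, σ (ν a))) := by
  show cellHead (ν a, flip (σ (ν a)) true) = _
  rw [flip_apply, Bool.true_xor]
  rfl

/-- `gluedCells` turns transposition of letters into the gluing of cells. This determines the gluing
from `(σ, ν)` and supplies the permutation whose sign is computed below. -/
theorem follows_iff : Follows π σ ν ↔
    ∀ b, glue π (gluedCells σ ν b) = gluedCells σ ν b.tr := by
  have h1 : Follows π σ ν ↔ ∀ a, glue π (gluedCells σ ν (a, false)) = gluedCells σ ν (a, true) := by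
    refine forall_congr' fun a => ?_
    rw [nextPerm_eq_iff, gluedCells_false, gluedCells_true]
  rw [h1]
  refine ⟨fun h b => ?_, fun h a => h (a, false)⟩
  rcases b with ⟨a, s⟩
  cases s
  · exact h a
  · exact (congrArg (glue π) (h a).symm).trans (glue_glue _ _)

/-- The labels along `ν` with directions `σ` form closed paths. -/
def Compat (σ : Arr t r → Bool) (ν : Equiv.Perm (Arr t r)) : Prop :=
  ∀ a, qTail (arrLetter a, σ a) = qHead (arrLetter (ν a), σ (ν a))

theorem gluedCells_tr_fst (h : Compat σ ν) (b : Letter (Arr t r)) :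
    (gluedCells σ ν b.tr).1 = !(gluedCells σ ν b).1 := by
  have key : ∀ a, (gluedCells σ ν (a, true)).1 = !(gluedCells σ ν (a, false)).1 := by
    intro a
    rw [gluedCells_false, gluedCells_true, cellHead_tr_fst, cellHead_fst, Bool.not_not]
    exact (h a).symm
  rcases b with ⟨a, s⟩
  cases s
  · exact key a
  · show (gluedCells σ ν (a, false)).1 = _
    rw [key, Bool.not_not]

theorem Follows.compat (h : Follows π σ ν) : Compat σ ν := by
  intro a
  have h2 := congrArg Prod.fst ((nextPerm_eq_iff π _ _).mp (h a))
  rw [glue_fst, cellHead_fst, Bool.not_not, cellHead_tr_fst] at h2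
  exact h2

/-- Transporting transposition along `gluedCells` gives an involution of the cells. Compatibility
says that it exchanges the columns, so it is the gluing of a permutation. -/
theorem Compat.existsUnique (h : Compat σ ν) : ∃! π, Follows π σ ν := by
  obtain ⟨π, hπ⟩ := exists_glue
    (fun c => gluedCells σ ν (Letter.tr ((gluedCells σ ν).symm c)))
    (fun c => by simp [Letter.tr_tr]) (fun c => by
      rw [gluedCells_tr_fst h, Equiv.apply_symm_apply])
  refine ⟨π, follows_iff.mpr fun b => by rw [hπ, Equiv.symm_apply_apply], fun π' h' => ?_⟩
  refine glue_injective (Equiv.ext fun c => ?_)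
  have := follows_iff.mp h' ((gluedCells σ ν).symm c)
  rw [Equiv.apply_symm_apply] at this
  rw [this, hπ]

/-- Cells as directed arrows such that transposition changes the column only. -/
def refCells : Letter (Arr t r) ≃ Bool × Row t r where
  toFun b := match b with
    | (Sum.inl i, s) => (s, Sum.inl i)
    | (Sum.inr (Sum.inl j), s) => (s, Sum.inr (j, false))
    | (Sum.inr (Sum.inr j), s) => (s, Sum.inr (j, true))
  invFun c := match c with
    | (s, Sum.inl i) => (Sum.inl i, s)
    | (s, Sum.inr (j, false)) => (Sum.inr (Sum.inl j), s)
    | (s, Sum.inr (j, true)) => (Sum.inr (Sum.inr j), s)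
  left_inv b := by rcases b with ⟨i | j | j, s⟩ <;> rfl
  right_inv c := by rcases c with ⟨s, i | ⟨j, b⟩⟩ <;> first | rfl | (cases b <;> rfl)

theorem refCells_symm_not (s : Bool) (i : Row t r) :
    refCells.symm (!s, i) = (refCells.symm (s, i)).tr := by
  rcases i with i | ⟨j, b⟩ <;> first | rfl | (cases b <;> rfl)

/-- The rotation of a square of cells. -/
def squareTurn : Equiv.Perm (Bool × Bool) where
  toFun c := (c.2, !c.1)
  invFun c := (!c.2, c.1)
  left_inv c := by simp
  right_inv c := by simp

theorem sign_squareTurn : Equiv.Perm.sign squareTurn = -1 := by decide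

/-- Each `x_i` contributes a transposition of two cells, and each pair `y_j`, `z_j` contributes a
4-cycle on a square of cells. -/
theorem sign_refCells : Equiv.Perm.sign ((refCells (t := t) (r := r)).symm.trans headEquiv) =
    (-1) ^ t * (-1) ^ r := by
  have h : (refCells (t := t) (r := r)).symm.trans headEquiv =
      ((Equiv.prodSumDistrib Bool (Fin t) (Fin r × Bool)).trans
        ((Equiv.refl (Bool × Fin t)).sumCongr
          ((Equiv.prodAssoc Bool (Fin r) Bool).symm.trans
            (((Equiv.prodComm Bool (Fin r)).prodCongr (Equiv.refl Bool)).trans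
              (Equiv.prodAssoc (Fin r) Bool Bool))))).symm.permCongr
        (Equiv.sumCongr (Equiv.prodCongrLeft fun _ : Fin t => Equiv.boolNot)
          (Equiv.prodCongrRight fun _ : Fin r => squareTurn)) := by
    ext1 ⟨s, i | ⟨j, b⟩⟩
    · rfl
    · cases s <;> cases b <;> rfl
  rw [h, Equiv.Perm.sign_permCongr, Equiv.Perm.sign_sumCongr, Equiv.Perm.sign_prodCongrLeft,
    Equiv.Perm.sign_prodCongrRight, Finset.prod_const, Finset.prod_const, sign_squareTurn,
    show Equiv.Perm.sign Equiv.boolNot = -1 by decide]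
  simp

theorem prod_row {M : Type*} [CommMonoid M] (f : Row t r → M) :
    ∏ i, f i = ∏ a : Arr t r, f (refCells (a, false)).2 := by
  rw [Fintype.prod_sum_type, Fintype.prod_sum_type, Fintype.prod_sum_type, Fintype.prod_prod_type,
    ← Finset.prod_mul_distrib]
  congr 1
  refine Finset.prod_congr rfl fun j _ => ?_
  rw [Fintype.prod_bool, mul_comm]
  rfl

/-- The sign of one permutation `Z` of the cells is computed twice: as a signed permutation, through
the columns of the heads, and as a composite involving `ν`, the directions `σ`, a fixed reference
and `π`. -/
theorem Follows.sign_eq (h : Follows π σ ν) : ((Equiv.Perm.sign π : ℤˣ) : ℤ) =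
    (∏ a, eps (arrLetter a, σ a)) * ((Equiv.Perm.sign ν : ℤˣ) : ℤ) := by
  -- The inverse of `P` reorders the second column so that the gluing becomes the column flip. Hence
  -- `Z` commutes with the flip.
  set P : Equiv.Perm (Bool × Row t r) := Equiv.prodCongrRight fun s => if s then π else 1 with hP
  have hP1 : ∀ s i, P (s, i) = (s, (if s then π else 1 : Equiv.Perm _) i) := fun s i => rfl
  have hP2 : ∀ c, (P.symm c).1 = c.1 := fun c => rfl
  have hglue : ∀ c, P.symm (glue π c) = (!(P.symm c).1, (P.symm c).2) := by
    intro c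
    rw [Equiv.symm_apply_eq, hP1]
    rcases c with ⟨s, i⟩
    cases s <;> rfl
  set Z : Equiv.Perm (Bool × Row t r) := refCells.symm.trans ((gluedCells σ ν).trans P.symm) with hZ
  have h1 := sign_eq_of_comm_flip Z (by
    intro s i
    simp only [hZ, Equiv.trans_apply]
    rw [refCells_symm_not, ← follows_iff.mp h, hglue])
  have h2 : Equiv.Perm.sign Z = Equiv.Perm.sign ν * ((∏ a, if σ a then -1 else 1) *
      ((-1) ^ t * (-1) ^ r * Equiv.Perm.sign π)) := by
    have e1 : Z = refCells.symm.trans ((Equiv.prodCongrLeft (fun s : Bool => if s then ν else 1)).trans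
        ((Equiv.prodCongrRight (fun a => flip (σ a))).trans (headEquiv.trans P.symm))) := rfl
    have e2 : refCells.symm.trans (headEquiv.trans P.symm) =
      P⁻¹ * (refCells.symm.trans headEquiv : Equiv.Perm (Bool × Row t r)) := rfl
    rw [e1, Equiv.Perm.sign_trans_trans, Equiv.Perm.sign_trans_trans, e2, map_mul, map_inv,
      sign_refCells, Equiv.Perm.sign_prodCongrLeft, Equiv.Perm.sign_prodCongrRight, hP,
      Equiv.Perm.sign_prodCongrRight, Fintype.prod_bool, Fintype.prod_bool]
    simp only [sign_flip]
    simp [mul_comm]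
  have h3 : ∀ a : Arr t r, (Z (false, (refCells (a, false)).2)).1 = (cellHead (a, σ a)).1 := by
    intro a
    have : (false, (refCells (a, false)).2) = refCells (a, false) := by
      rcases a with a | a | a <;> rfl
    rw [this, hZ, Equiv.trans_apply, Equiv.symm_apply_apply, Equiv.trans_apply, hP2,
      gluedCells_false]
  rw [prod_row] at h1
  simp only [h3] at h1
  rw [h2] at h1
  have hsq : ∀ u : ℤˣ, u * u = 1 := Int.units_mul_self
  have h4 : Equiv.Perm.sign π = (∏ a : Arr t r, ((if σ a then -1 else 1) *
      if (cellHead (a, σ a)).1 then -1 else 1)) * ((-1) ^ t * (-1) ^ r) * Equiv.Perm.sign ν := by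
    rw [Finset.prod_mul_distrib, ← h1]
    generalize (∏ a : Arr t r, if σ a then (-1 : ℤˣ) else 1) = A
    generalize ((-1 : ℤˣ) ^ t * (-1) ^ r) = B
    generalize Equiv.Perm.sign ν = D
    generalize Equiv.Perm.sign π = E
    calc E = (A * A) * (B * B) * (D * D) * E := by simp only [hsq, one_mul]
      _ = _ := by ac_rfl
  -- Checked arrow by arrow: the factors `-1` from the `x_i` and `y_j` make `x` neutral and leave
  -- `-1` exactly for untransposed `y` and `z`.
  have h5 : (∏ a : Arr t r, (((if σ a then -1 else 1) *
      if (cellHead (a, σ a)).1 then -1 else 1 : ℤˣ) : ℤ)) * ((-1) ^ t * (-1) ^ r) =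
      ∏ a, eps (arrLetter a, σ a) := by
    have hd : (∏ a : Arr t r, (Sum.elim (fun _ => -1) (Sum.elim (fun _ => -1) fun _ => 1) a : ℤ)) =
        (-1) ^ t * (-1) ^ r := by
      simp [Fintype.prod_sum_type]
    rw [← hd, ← Finset.prod_mul_distrib]
    refine Finset.prod_congr rfl fun a _ => ?_
    rcases a with a | a | a <;> simp only [arrLetter, eps, cellHead, Sum.elim_inl, Sum.elim_inr] <;>
      cases σ _ <;> simp
  rw [h4, ← h5]
  push_cast
  ring

end Sign

end MatInv

namespace MatInv
open MvPolynomial Function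

/-! ### The tableau sum as a sum over directions and permutations. -/

section TraceExpansion
variable {t r : ℕ} {σ : Arr t r → Bool} {ν : Equiv.Perm (Arr t r)} {π : Equiv.Perm (Row t r)}

theorem map_letterMap_equiv {A B : Type*} (δ : A → B) {v w : Word A} (h : v ≈ w) :
    FreeSemigroup.map (letterMap δ) v ≈ FreeSemigroup.map (letterMap δ) w := by
  rcases h with h | h
  · refine Or.inl ?_
    rw [wordList_map, wordList_map]
    exact h.map _
  · refine Or.inr ?_
    rw [wordList_tr] at h
    rw [wordList_tr, wordList_map, wordList_map]
    have h2 := h.map (letterMap δ)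
    rw [listTr, List.map_reverse, List.map_map] at h2
    rw [listTr, List.map_map]
    exact h2

/-- The product of the traces of all closed paths. -/
noncomputable def pathTrace (π : Equiv.Perm (Row t r)) : NSigma ℚ (Fin 3) :=
  ∏ c ∈ pathClasses π, sigmaWord ℚ 1 (FreeSemigroup.map (letterMap arrLetter) (Quotient.out c))

theorem trSum_eq : trSum ℚ (arrLetter : Arr t r → Fin 3) =
    ∑ π : Equiv.Perm (Row t r), ((Equiv.Perm.sign π : ℤˣ) : ℤ) • pathTrace π := rfl

theorem map_graph_eq (c : Cycle (Arr t r)) : c.map (fun a => ((arrLetter a, σ a) : Letter (Fin 3))) =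
    (c.map fun a => ((a, σ a) : Letter (Arr t r))).map (letterMap arrLetter) := by
  induction c using Quotient.inductionOn with
  | _ l => exact congrArg (fun l : List _ => (l : Cycle (Letter (Fin 3)))) (List.map_map (l := l)
      (g := letterMap arrLetter) (f := fun a => ((a, σ a) : Letter (Arr t r)))).symm

theorem chain_iff (a : Arr t r) : Cycle.Chain (fun a b => qTail a = qHead b)
    ((periodicOrbit ν a).map fun a => ((arrLetter a, σ a) : Letter (Fin 3))) ↔
      ∀ n, qTail (arrLetter (ν^[n] a), σ (ν^[n] a)) =
        qHead (arrLetter (ν^[n + 1] a), σ (ν^[n + 1] a)) := by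
  rw [Cycle.chain_map, periodicOrbit_chain' _ (perm_mem_periodicPts ν a)]

/-- A failure at one arrow makes the word of its cycle not closed, so its half-trace vanishes. Only
pairs coming from a gluing survive. -/
theorem prod_halfTr_of_not_compat (h : ¬ Compat σ ν) :
    ∏ q : Cyc ν, halfTr ((periodicOrbit ν q.out).map fun a => (arrLetter a, σ a)) = 0 := by
  simp only [Compat, not_forall] at h
  obtain ⟨a, ha⟩ := h
  refine Finset.prod_eq_zero (Finset.mem_univ (Quotient.mk _ a : Cyc ν)) ?_
  rw [periodicOrbit_eq_of_sameCycle (Cyc.sameCycle_out a), halfTr, if_neg]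
  rw [chain_iff]
  exact fun h => ha (h 0)

theorem Follows.halfTr_eq (h : Follows π σ ν) (a : Arr t r) :
    halfTr ((periodicOrbit ν a).map fun a => (arrLetter a, σ a)) = C (1 / 2) *
      sigmaWord ℚ 1 (FreeSemigroup.map (letterMap arrLetter) (pathClass π (a, σ a)).out) := by
  rw [halfTr, if_pos ((chain_iff a).mpr fun n => by
    rw [iterate_succ_apply']; exact h.compat _)]
  congr 1
  rw [map_graph_eq, ← periodicOrbit_semiconj (graph_injective σ) h.semiconj,
    ← wordList_cycleWord_cycle, Cycle.map_coe, ← wordList_map, trCycle_wordList]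
  exact sigmaWord_congr (map_letterMap_equiv _ (Setoid.symm (Quotient.mk_out (cycleWord π (a, σ a))))) 1

theorem Follows.prod_halfTr (h : Follows π σ ν) :
    ∏ q : Cyc ν, halfTr ((periodicOrbit ν q.out).map fun a => (arrLetter a, σ a)) =
      C (1 / 2) ^ (pathClasses π).card * pathTrace π := by
  rw [Finset.prod_congr rfl fun q _ => h.halfTr_eq (Quotient.out q), Finset.prod_mul_distrib,
    Finset.prod_const, Finset.card_univ, h.card_cyc, pathTrace, h.prod_pathClasses]

/-- Double counting of the triples `(π, σ, ν)` with `Follows π σ ν`: for fixed `π` the number of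
triples cancels the powers of `1/2`, and for fixed `(σ, ν)` there is at most one `π`. -/
theorem trSum_eq_orientedSum (t r : ℕ) :
    trSum ℚ (arrLetter : Arr t r → Fin 3) = orientedSum (arrLetter : Arr t r → Fin 3) := by
  classical
  have h1 : ∀ π : Equiv.Perm (Row t r), ((Equiv.Perm.sign π : ℤˣ) : ℤ) • pathTrace π =
      ∑ p : (Arr t r → Bool) × Equiv.Perm (Arr t r), if Follows π p.1 p.2 then
        ((Equiv.Perm.sign π : ℤˣ) : ℤ) • (C (1 / 2) ^ (pathClasses π).card * pathTrace π) else 0 := by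
    intro π
    rw [← Finset.sum_filter, Finset.sum_const, ← Fintype.card_subtype, card_follows, smul_comm]
    congr 1
    rw [nsmul_eq_mul, ← mul_assoc]
    push_cast
    rw [← mul_pow]
    have : (2 : NSigma ℚ (Fin 3)) * C (1 / 2) = 1 := by
      rw [← map_ofNat C 2, ← C_mul]
      norm_num
    rw [this, one_pow, one_mul]
  have h2 : ∀ p : (Arr t r → Bool) × Equiv.Perm (Arr t r), (∑ π : Equiv.Perm (Row t r),
      if Follows π p.1 p.2 then
        ((Equiv.Perm.sign π : ℤˣ) : ℤ) • (C (1 / 2) ^ (pathClasses π).card * pathTrace π) else 0) =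
      (∏ a, eps (arrLetter a, p.1 a)) • ((Equiv.Perm.sign p.2 : ℤˣ) : ℤ) •
        ∏ q : Cyc p.2, halfTr ((periodicOrbit p.2 q.out).map fun a => (arrLetter a, p.1 a)) := by
    rintro ⟨σ, ν⟩
    by_cases hc : Compat σ ν
    · obtain ⟨π, hπ, huniq⟩ := hc.existsUnique
      rw [Finset.sum_eq_single π (fun π' _ hne => if_neg fun h => hne (huniq π' h))
        (fun h => absurd (Finset.mem_univ π) h), if_pos hπ, hπ.prod_halfTr, hπ.sign_eq, mul_smul]
    · rw [prod_halfTr_of_not_compat hc, smul_zero, smul_zero]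
      exact Finset.sum_eq_zero fun π _ => if_neg fun h => hc h.compat
  rw [trSum_eq, Finset.sum_congr rfl fun π _ => h1 π, Finset.sum_comm,
    Finset.sum_congr rfl fun p _ => h2 p, Fintype.sum_prod_type, orientedSum]
  refine Finset.sum_congr rfl fun σ _ => ?_
  rw [labelSum, Finset.smul_sum]

end TraceExpansion

/-! ### The integral identity and its specialisations. -/

section Main

theorem map_trSum {R S : Type*} [CommRing R] [CommRing S] (φ : R →+* S) {t r : ℕ} {B : Type*}
    (δ : Arr t r → B) : map φ (trSum R δ) = trSum S δ := by
  simp only [trSum, map_sum, map_zsmul, map_prod, map_sigmaWord]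

theorem map_sigmaTRLetters {R S : Type*} [CommRing R] [CommRing S] (φ : R →+* S) (t r : ℕ) :
    map φ (sigmaTRLetters R t r) = sigmaTRLetters S t r := by
  simp only [sigmaTRLetters, map_sum, map_mul, map_pow, map_neg, map_one, Finsupp.prod, map_prod,
    map_gen]

/-- Both sides are defined over `ℤ`, so the rational identity descends by injectivity of `ℤ → ℚ` on
coefficients. -/
theorem factorial_smul_sigmaTRLetters (t r : ℕ) :
    (t.factorial * r.factorial ^ 2) • sigmaTRLetters ℤ t r =
      trSum ℤ (arrLetter : Arr t r → Fin 3) := by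
  refine map_injective (Int.castRingHom ℚ) Int.cast_injective ?_
  rw [map_nsmul, map_sigmaTRLetters, map_trSum, trSum_eq_orientedSum, nsmul_eq_mul,
    factorial_mul_sigmaTRLetters]

/-- `σ'_{t+2r,r}` for letters. -/
noncomputable def sigmaTRSwapped (t r : ℕ) : NSigma ℤ (Fin 3) :=
  subst (fun a => ofWord ℤ (FreeSemigroup.of ((![0, 2, 1] : Fin 3 → Fin 3) a, false)))
    (sigmaTRLetters ℤ t r)

theorem zubkovDen_add (t r : ℕ) : zubkovDen (t + 2 * r) r = t.factorial * r.factorial ^ 2 := by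
  rw [zubkovDen, Nat.add_sub_cancel]

theorem zubkovSum_add {R A : Type*} [CommRing R] (t r : ℕ) (x y z : MF R A) :
    zubkovSum (t + 2 * r) r x y z = trStarSum t r x z y := by
  rw [zubkovSum, Nat.add_sub_cancel]

/-- The exchange of `y` and `z` matches the convention that in `σ'` the third argument replaces the
`y_j` and the second one the `z_j`. -/
theorem isZubkovLetters_sigmaTRSwapped (t r : ℕ) :
    IsZubkovLetters (t + 2 * r) r (sigmaTRSwapped t r) := by
  rw [IsZubkovLetters, zubkovDen_add, zubkovSum_add, sigmaTRSwapped, ← map_nsmul,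
    factorial_smul_sigmaTRLetters]
  have h := subst_map_trSum (t := t) (r := r) (RingHom.id ℤ)
    (fun a => ofWord ℤ (FreeSemigroup.of ((![0, 2, 1] : Fin 3 → Fin 3) a, false))) 0 1 2
  rw [MvPolynomial.map_id] at h
  exact h

/-- The integer form is obtained by choice; cancelling the nonzero factor `t! (r!)²` over `ℤ`
identifies it. -/
theorem zubkovLetters_eq (t r : ℕ) : zubkovLetters (t + 2 * r) r = sigmaTRSwapped t r := by
  have hs := isZubkovLetters_sigmaTRSwapped t r
  have hex : ∃ s, IsZubkovLetters (t + 2 * r) r s := ⟨_, hs⟩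
  have h1 : IsZubkovLetters (t + 2 * r) r (zubkovLetters (t + 2 * r) r) := by
    rw [zubkovLetters, dif_pos hex]
    exact hex.choose_spec
  have h2 := Eq.trans h1 (Eq.symm hs)
  rw [zubkovDen_add, nsmul_eq_mul, nsmul_eq_mul] at h2
  exact mul_left_cancel₀ (Nat.cast_ne_zero.mpr (by positivity)) h2

theorem zubkovSigma_eq_sigmaTR {R A : Type*} [CommRing R] (t r : ℕ) (x y z : MF R A) :
    zubkovSigma (t + 2 * r) r x z y = sigmaTR t r x y z := by
  have hδ : Injective (![0, 2, 1] : Fin 3 → Fin 3) := by decide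
  rw [zubkovSigma, zubkovLetters_eq, sigmaTRSwapped, subst_map_subst_letters _ _ hδ,
    map_sigmaTRLetters, sigmaTR]
  congr 2
  funext a
  fin_cases a <;> rfl

theorem zubkovDen_smul_sigmaTR {R A : Type*} [CommRing R] (t r : ℕ) (x y z : MF R A) :
    zubkovDen (t + 2 * r) r • sigmaTR t r x y z = zubkovSum (t + 2 * r) r x z y := by
  rw [zubkovDen_add, zubkovSum_add, sigmaTR, ← map_sigmaTRLetters (Int.castRingHom R), ← map_nsmul,
    ← map_nsmul, factorial_smul_sigmaTRLetters]
  exact subst_map_trSum (Int.castRingHom R) ![x, y, z] 0 1 2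

end Main

end MatInv

theorem mainTheorem4 {F : Type*} [Field F] (d t r : ℕ) :
    MatInv.IsZubkovLetters (t + 2 * r) r (MatInv.zubkovLetters (t + 2 * r) r) ∧
    ∀ x y z : MatInv.MF F (Fin d),
      MatInv.zubkovDen (t + 2 * r) r • MatInv.zubkovSigma (t + 2 * r) r x z y
        = MatInv.zubkovSum (t + 2 * r) r x z y ∧
      MatInv.sigmaTR t r x y z = MatInv.zubkovSigma (t + 2 * r) r x z y := by
  refine ⟨?_, fun x y z => ?_⟩
  · rw [MatInv.zubkovLetters_eq]
    exact MatInv.isZubkovLetters_sigmaTRSwapped t r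
  · rw [MatInv.zubkovSigma_eq_sigmaTR]
    exact ⟨MatInv.zubkovDen_smul_sigmaTR t r x y z, rfl⟩
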